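/- **Setting.** Linear terms $\alpha=\sum_i c_i\theta_i+c$ have integer coefficients and range over parameters $\theta_i$; a valuation $v$ assigns a natural number to each parameter. There is one clock $x$, with values in $\mathbb N$. A *guard* is a boolean combination of atoms $x\sim\alpha$ and $\alpha\sim\beta$ with $\sim\,\in\{=,<,\le,>,\ge,\equiv_{a,\le},\equiv_{a,\ge}\}$, $a\ge 1$, where $y\equiv_{a,\le}z$ means $y\equiv z \bmod a$ and $y\le z$, and $y\equiv_{a,\ge}z$ means $y\equiv z\bmod a$ and $y\ge z$. A *parametric timed automaton* $\mathsf A$ consists of a finite set of states $q$, each with a finite set of atomic propositions and a guard $\mathsf I(q)$ (its invariant), and finitely many edges $(q,\tau,g,r,q')$, with $\tau\in\{0,1\}$, $g$ a guard, and $r$ telling whether the clock is reset. For a valuation $v$, a transition $(q,x)\xrightarrow{\tau}(q',x')$ of $\mathsf A^v$ requires that $\mathsf I(q)$ holds at $x$, that $\mathsf I(q')$ holds at $x'$, and that there is an edge $(q,\tau,g,r,q')$ such that $g$ holds at $x+\tau$ and $x'=0$ if $r$ resets the clock, $x'=x+\tau$ otherwise. A *run* is an infinite sequence of transitions $(q_i,x_i)\xrightarrow{\tau_i}(q_{i+1},x_{i+1})$,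 $i\ge0$, with $\sum_i\tau_i=\infty$; the duration at position $i$ is $D_i=\sum_{j<i}\tau_j$. An F-PTCTL formula is $f=Q_1\theta_1\cdots Q_k\theta_k\,\varphi$ with $k\ge0$, $Q_j\in\{\exists,\forall\}$, and $$\varphi::=\sigma\mid\alpha\sim\beta\mid\neg\varphi\mid\varphi\vee\varphi\mid\exists\bigcirc\varphi\mid\varphi\,\exists U_{\bowtie\alpha}\varphi\mid\varphi\,\forall U_{<\alpha}\varphi\mid\varphi\,\forall U_{\le\alpha}\varphi\mid\varphi\,\forall U\varphi ,$$ with $\sigma$ an atomic proposition, $\sim\,\in\{=,<,\le,>,\ge\}$, $\bowtie\,\in\{<,\le,>,\ge\}$, and $\forall U=\forall U_{\ge0}$. Satisfaction: $(q,x)\models_v\sigma$ (resp. $\alpha\sim\beta$) iff some run of $\mathsf A^v$ starts in $(q,x)$ and $\sigma$ labels $q$ (resp. $v(\alpha)\sim v(\beta)$); $\neg,\vee$ are as usual; $(q,x)\models_v\exists\bigcirc\varphi$ iff some run of $\mathsf A^v$ from $(q,x)$ has $(q_1,x_1)\models_v\varphi$; $(q,x)\models_v\varphi\,\exists U_{\sim\alpha}\psi$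 (resp. $\varphi\,\forall U_{\sim\alpha}\psi$) iff for some (resp. every) run of $\mathsf A^v$ from $(q,x)$ there is $i\ge0$ with $D_i\sim v(\alpha)$, $(q_i,x_i)\models_v\psi$ and $(q_j,x_j)\models_v\varphi$ for all $j<i$; quantifiers $Q_j\theta_j$ range over $\mathbb N$. Let $\Theta$ be the set of parameters that occur in $\mathsf A$ or $\varphi$, and $\Theta_f=\Theta\setminus\{\theta_1,\dots,\theta_k\}$. **Statement.** To every parametric timed automaton $\mathsf A$, state $q$ and quantifier-free F-PTCTL formula $\varphi$ one can effectively associate a boolean combination $\Delta_{q,\varphi}(x,\Theta)$ of atoms $x\sim\alpha$ and $\alpha\sim\beta$ as in guards, hence a Presburger formula, such that for every clock value $x_0\in\mathbb N$ and every F-PTCTL formula $f=Q_1\theta_1\cdots Q_k\theta_k\,\varphi$, the Presburger formula $$Q_1\theta_1\cdots Q_k\theta_k\,\Delta_{q,\varphi}(x_0,\Theta)$$ has its free variables in $\Theta_f$, is computable from $\mathsf A$, $q$, $x_0$ and $f$, and is true at a valuation $v$ of $\Theta_f$ if and only if $(q,x_0)\models_v f$. It is thus an effective characterization of the set of these valuations,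 which solves the parameter synthesis problem for F-PTCTL. -/

import Mathlib

namespace ParamTCTL

open FirstOrder FirstOrder.Language

/-! ### Linear terms, comparison symbols, guards

Parameters are named by natural numbers; a parameter valuation is a map `v : ℕ → ℕ`. Only the
finitely many parameters that occur in the automaton and in the formula are ever relevant. -/

/-- A linear term `∑ cᵢ θᵢ + c` with integer coefficients, as a list of pairs `(i, cᵢ)` together
with the constant `c`. -/
structure LinTerm where
  coeffs : List (ℕ × ℤ)
  const : ℤ

/-- The value `v(α)` of a linear term. -/
def LinTerm.eval (v : ℕ → ℕ) (α : LinTerm) : ℤ :=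
  (α.coeffs.map fun p => p.2 * (v p.1 : ℤ)).sum + α.const

/-- The constant linear term `0`. -/
def LinTerm.zero : LinTerm := ⟨[], 0⟩

/-- The parameters occurring in a linear term. -/
def LinTerm.params (α : LinTerm) : Finset ℕ := (α.coeffs.map Prod.fst).toFinset

/-- The comparison symbols `=, <, ≤, >, ≥` of the logic. -/
inductive Cmp
  | eq | lt | le | gt | ge

def Cmp.Holds : Cmp → ℤ → ℤ → Prop
  | .eq, a, b => a = b
  | .lt, a, b => a < b
  | .le, a, b => a ≤ b
  | .gt, a, b => a > b
  | .ge, a, b => a ≥ b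

/-- The comparison symbols of guards: those of the logic and, for `a ≥ 1`, the symbols
`≡_{a,≤}` and `≡_{a,≥}` (congruent modulo `a`, and at most / at least). -/
inductive GCmp
  | base (c : Cmp)
  | congLe (a : ℕ+)
  | congGe (a : ℕ+)

def GCmp.Holds : GCmp → ℤ → ℤ → Prop
  | .base c, y, z => c.Holds y z
  | .congLe a, y, z => y ≡ z [ZMOD ((a : ℕ) : ℤ)] ∧ y ≤ z
  | .congGe a, y, z => y ≡ z [ZMOD ((a : ℕ) : ℤ)] ∧ y ≥ z

/-- Guards: boolean combinations of `x`-atoms `x ∼ α` (`x` is the clock) and of `θ`-atoms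
`α ∼ β`. -/
inductive Guard
  | clock (c : GCmp) (α : LinTerm)
  | param (c : GCmp) (α β : LinTerm)
  | not (g : Guard)
  | and (g h : Guard)
  | or (g h : Guard)

/-- `x ⊨_v g`, the truth of the guard `g` at clock value `x` and valuation `v`. -/
def Guard.Holds (v : ℕ → ℕ) (x : ℕ) : Guard → Prop
  | .clock c α => c.Holds (x : ℤ) (α.eval v)
  | .param c α β => c.Holds (α.eval v) (β.eval v)
  | .not g => ¬ g.Holds v x
  | .and g h => g.Holds v x ∧ h.Holds v x
  | .or g h => g.Holds v x ∨ h.Holds v x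

def Guard.params : Guard → Finset ℕ
  | .clock _ α => α.params
  | .param _ α β => α.params ∪ β.params
  | .not g => g.params
  | .and g h => g.params ∪ h.params
  | .or g h => g.params ∪ h.params

/-! ### Parametric timed automata with one parametric clock, over discrete time -/

/-- An edge between states in `Fin n`: source, time increment `τ ∈ {0, 1}`, guard, whether the
clock is reset, target. -/
structure Edge (n : ℕ) where
  src : Fin n
  tick : Fin 2
  guard : Guard
  reset : Bool
  tgt : Fin n

/-- A parametric timed automaton with state set `Fin numStates`. Atomic propositions are named by
natural numbers; `label q` lists those that are true in `q`. -/
structure Automaton where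
  numStates : ℕ
  edges : List (Edge numStates)
  label : Fin numStates → List ℕ
  inv : Fin numStates → Guard

/-- The parameters occurring in the guards and the invariants of an automaton. -/
def Automaton.params (A : Automaton) : Finset ℕ :=
  A.edges.foldr (fun e s => e.guard.params ∪ s) ∅ ∪ Finset.univ.biUnion fun q => (A.inv q).params

/-- A configuration: a state and a clock value. -/
abbrev Config (A : Automaton) : Type := Fin A.numStates × ℕ

/-- The transition `(q, x) →τ (q', x')` is allowed in `A^v`. -/
def Step (A : Automaton) (v : ℕ → ℕ) (s : Config A) (τ : Fin 2) (s' : Config A) : Prop :=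
  (A.inv s.1).Holds v s.2 ∧ (A.inv s'.1).Holds v s'.2 ∧
    ∃ e ∈ A.edges, e.src = s.1 ∧ e.tick = τ ∧ e.tgt = s'.1 ∧
      e.guard.Holds v (s.2 + (τ : ℕ)) ∧ s'.2 = if e.reset then 0 else s.2 + (τ : ℕ)

/-- The duration of the first `i` transitions, for the sequence `τ` of time increments. -/
def duration (τ : ℕ → Fin 2) (i : ℕ) : ℕ := ∑ j ∈ Finset.range i, (τ j : ℕ)

/-- `ρ`, with the time increments `τ`, is an (infinite, non-Zeno) run of `A^v` from `s`. -/
def IsRun (A : Automaton) (v : ℕ → ℕ) (s : Config A) (ρ : ℕ → Config A) (τ : ℕ → Fin 2) : Prop :=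
  ρ 0 = s ∧ (∀ i, Step A v (ρ i) (τ i) (ρ (i + 1))) ∧
    Filter.Tendsto (duration τ) Filter.atTop Filter.atTop

/-! ### Parametric timed CTL -/

/-- Quantifier-free formulas of parametric timed CTL. -/
inductive QF
  | prop (σ : ℕ)
  | cmp (α : LinTerm) (c : Cmp) (β : LinTerm)
  | not (φ : QF)
  | or (φ ψ : QF)
  | exNext (φ : QF)
  | exUntil (φ : QF) (c : Cmp) (α : LinTerm) (ψ : QF)
  | allUntil (φ : QF) (c : Cmp) (α : LinTerm) (ψ : QF)

/-- The satisfaction relation `s ⊨_v φ` for quantifier-free formulas. -/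
def QF.Sat (A : Automaton) (v : ℕ → ℕ) : QF → Config A → Prop
  | .prop σ, s => (∃ ρ τ, IsRun A v s ρ τ) ∧ σ ∈ A.label s.1
  | .cmp α c β, s => (∃ ρ τ, IsRun A v s ρ τ) ∧ c.Holds (α.eval v) (β.eval v)
  | .not φ, s => ¬ φ.Sat A v s
  | .or φ ψ, s => φ.Sat A v s ∨ ψ.Sat A v s
  | .exNext φ, s => ∃ ρ τ, IsRun A v s ρ τ ∧ φ.Sat A v (ρ 1)
  | .exUntil φ c α ψ, s => ∃ ρ τ, IsRun A v s ρ τ ∧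
      ∃ i, c.Holds (duration τ i : ℤ) (α.eval v) ∧ ψ.Sat A v (ρ i) ∧ ∀ j < i, φ.Sat A v (ρ j)
  | .allUntil φ c α ψ, s => ∀ ρ τ, IsRun A v s ρ τ →
      ∃ i, c.Holds (duration τ i : ℤ) (α.eval v) ∧ ψ.Sat A v (ρ i) ∧ ∀ j < i, φ.Sat A v (ρ j)

/-- The fragment without `=` in the until operators and without `>, ≥` in the universal until
operator, except for the plain universal until, which abbreviates the one with subscript `≥ 0`. -/
def QF.IsF : QF → Prop
  | .prop _ => True
  | .cmp _ _ _ => True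
  | .not φ => φ.IsF
  | .or φ ψ => φ.IsF ∧ ψ.IsF
  | .exNext φ => φ.IsF
  | .exUntil φ c _ ψ => c ≠ .eq ∧ φ.IsF ∧ ψ.IsF
  | .allUntil φ c α ψ => (c = .lt ∨ c = .le ∨ (c = .ge ∧ α = LinTerm.zero)) ∧ φ.IsF ∧ ψ.IsF

def QF.params : QF → Finset ℕ
  | .prop _ => ∅
  | .cmp α _ β => α.params ∪ β.params
  | .not φ => φ.params
  | .or φ ψ => φ.params ∪ ψ.params
  | .exNext φ => φ.params
  | .exUntil φ _ α ψ => φ.params ∪ α.params ∪ ψ.params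
  | .allUntil φ _ α ψ => φ.params ∪ α.params ∪ ψ.params

inductive Quant
  | ex | all

/-- A formula `Q₁θ₁ ⋯ Q_kθ_k φ` of parametric timed CTL. -/
structure Formula where
  quants : List (Quant × ℕ)
  body : QF

/-- Satisfaction for a block of quantifiers over parameters followed by `φ`. -/
def satQuants (A : Automaton) (s : Config A) (φ : QF) : List (Quant × ℕ) → (ℕ → ℕ) → Prop
  | [], v => φ.Sat A v s
  | (.ex, θ) :: l, v => ∃ c : ℕ, satQuants A s φ l (Function.update v θ c)
  | (.all, θ) :: l, v => ∀ c : ℕ, satQuants A s φ l (Function.update v θ c)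

/-- `s ⊨_v f`. -/
def Formula.Sat (A : Automaton) (v : ℕ → ℕ) (f : Formula) (s : Config A) : Prop :=
  satQuants A s f.body f.quants v

/-- The free parameters of `f`: those that occur in the automaton or in the formula and are not
quantified. -/
def Formula.free (A : Automaton) (f : Formula) : Finset ℕ :=
  (A.params ∪ f.body.params) \ (f.quants.map Prod.snd).toFinset

/-! ### Presburger formulas

Guards are rewritten in the first-order language of `0, 1, +`. In what follows `env` tells which
variable stands for a parameter: a free variable (`Sum.inl`) or one bound by a quantifier
(`Sum.inr`). -/

/-- The sum of the monomials and constants of `α` with positive coefficients. -/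
def LinTerm.pos {k : ℕ} (env : ℕ → ℕ ⊕ Fin k) (α : LinTerm) : presburger.Term (ℕ ⊕ Fin k) :=
  α.coeffs.foldr (fun p t => p.2.toNat • Term.var (env p.1) + t)
    ((α.const.toNat : ℕ) : presburger.Term (ℕ ⊕ Fin k))

/-- The sum of the absolute values of the monomials and constants of `α` with negative
coefficients; thus `α` has value `pos - neg`. -/
def LinTerm.neg {k : ℕ} (env : ℕ → ℕ ⊕ Fin k) (α : LinTerm) : presburger.Term (ℕ ⊕ Fin k) :=
  α.coeffs.foldr (fun p t => (-p.2).toNat • Term.var (env p.1) + t)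
    (((-α.const).toNat : ℕ) : presburger.Term (ℕ ⊕ Fin k))

/-- The formula `∃ y, s + a y = t`. -/
def exAdd {k : ℕ} (a : ℕ) (s t : presburger.Term (ℕ ⊕ Fin k)) : presburger.BoundedFormula ℕ k :=
  BoundedFormula.ex
    (Term.bdEqual
      (s.relabel (Sum.map id Fin.castSucc) +
        a • (Term.var (Sum.inr (Fin.last k)) : presburger.Term (ℕ ⊕ Fin (k + 1))))
      (t.relabel (Sum.map id Fin.castSucc)))

/-- The formula `s ∼ t`. -/
def GCmp.toFormula {k : ℕ} (s t : presburger.Term (ℕ ⊕ Fin k)) :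
    GCmp → presburger.BoundedFormula ℕ k
  | .base .eq => Term.bdEqual s t
  | .base .lt => exAdd 1 (s + 1) t
  | .base .le => exAdd 1 s t
  | .base .gt => exAdd 1 (t + 1) s
  | .base .ge => exAdd 1 t s
  | .congLe a => exAdd a s t
  | .congGe a => exAdd a t s

/-- The guard `g` with the clock replaced by the numeral `x`, as a Presburger formula. -/
def Guard.toFormula {k : ℕ} (env : ℕ → ℕ ⊕ Fin k) (x : ℕ) : Guard → presburger.BoundedFormula ℕ k
  | .clock c α => c.toFormula ((x : presburger.Term (ℕ ⊕ Fin k)) + α.neg env) (α.pos env)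
  | .param c α β => c.toFormula (α.pos env + β.neg env) (β.pos env + α.neg env)
  | .not g => (g.toFormula env x).not
  | .and g h => g.toFormula env x ⊓ h.toFormula env x
  | .or g h => g.toFormula env x ⊔ h.toFormula env x

/-- The formula `Q₁θ₁ ⋯ Q_kθ_k g(x, Θ)`, with some parameters already bound as `env` tells. -/
def quantify (g : Guard) (x : ℕ) :
    {k : ℕ} → (ℕ → ℕ ⊕ Fin k) → List (Quant × ℕ) → presburger.BoundedFormula ℕ k
  | _, env, [] => g.toFormula env x
  | k, env, (.ex, θ) :: l => BoundedFormula.ex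
      (quantify g x
        (Function.update (fun i => (env i).map id Fin.castSucc) θ (Sum.inr (Fin.last k))) l)
  | k, env, (.all, θ) :: l => BoundedFormula.all
      (quantify g x
        (Function.update (fun i => (env i).map id Fin.castSucc) θ (Sum.inr (Fin.last k))) l)

/-- The Presburger formula `Q₁θ₁ ⋯ Q_kθ_k g(x, Θ)`, where `x` is a numeral. -/
def presburgerFormula (quants : List (Quant × ℕ)) (g : Guard) (x : ℕ) : presburger.Formula ℕ :=
  quantify g x (k := 0) Sum.inl quants

/-! ### Codes

Numerical codes of the syntactic objects, used to say that a construction is effective: a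
computable function sends the code of the input to the code of the output. -/

def LinTerm.code (α : LinTerm) : ℕ := Encodable.encode (α.coeffs, α.const)

def Cmp.code : Cmp → ℕ
  | .eq => 0
  | .lt => 1
  | .le => 2
  | .gt => 3
  | .ge => 4

def GCmp.code : GCmp → ℕ
  | .base c => Nat.pair 0 c.code
  | .congLe a => Nat.pair 1 a
  | .congGe a => Nat.pair 2 a

def Guard.code : Guard → ℕ
  | .clock c α => Nat.pair 0 (Nat.pair c.code α.code)
  | .param c α β => Nat.pair 1 (Nat.pair c.code (Nat.pair α.code β.code))
  | .not g => Nat.pair 2 g.code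
  | .and g h => Nat.pair 3 (Nat.pair g.code h.code)
  | .or g h => Nat.pair 4 (Nat.pair g.code h.code)

def Edge.code {n : ℕ} (e : Edge n) : ℕ :=
  Encodable.encode ((e.src : ℕ), (e.tick : ℕ), e.guard.code, e.reset, (e.tgt : ℕ))

def Automaton.code (A : Automaton) : ℕ :=
  Encodable.encode
    (A.numStates, A.edges.map Edge.code, List.ofFn A.label, List.ofFn fun q => (A.inv q).code)

def QF.code : QF → ℕ
  | .prop σ => Nat.pair 0 σ
  | .cmp α c β => Nat.pair 1 (Nat.pair α.code (Nat.pair c.code β.code))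
  | .not φ => Nat.pair 2 φ.code
  | .or φ ψ => Nat.pair 3 (Nat.pair φ.code ψ.code)
  | .exNext φ => Nat.pair 4 φ.code
  | .exUntil φ c α ψ => Nat.pair 5 (Nat.pair φ.code (Nat.pair c.code (Nat.pair α.code ψ.code)))
  | .allUntil φ c α ψ => Nat.pair 6 (Nat.pair φ.code (Nat.pair c.code (Nat.pair α.code ψ.code)))

def Quant.code : Quant → ℕ
  | .ex => 0
  | .all => 1

def Formula.code (f : Formula) : ℕ :=
  Encodable.encode (f.quants.map (fun p => (p.1.code, p.2)), f.body.code)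

/-- The code of a term of the language of Presburger arithmetic. -/
def termCode {k : ℕ} : presburger.Term (ℕ ⊕ Fin k) → ℕ
  | .var (Sum.inl i) => Nat.pair 0 i
  | .var (Sum.inr i) => Nat.pair 1 i
  | .func presburgerFunc.zero _ => Nat.pair 2 0
  | .func presburgerFunc.one _ => Nat.pair 3 0
  | .func presburgerFunc.add ts => Nat.pair 4 (Nat.pair (termCode (ts 0)) (termCode (ts 1)))

/-- The code of a formula of Presburger arithmetic (the language has no relation symbol besides
equality). -/
def formulaCode : {k : ℕ} → presburger.BoundedFormula ℕ k → ℕ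
  | _, .falsum => Nat.pair 0 0
  | _, .equal s t => Nat.pair 1 (Nat.pair (termCode s) (termCode t))
  | _, .rel R _ => Empty.elim R
  | _, .imp φ ψ => Nat.pair 2 (Nat.pair (formulaCode φ) (formulaCode ψ))
  | _, .all φ => Nat.pair 3 (formulaCode φ)

end ParamTCTL

-- For each state, the pairs of a clock value and a valuation that satisfy `φ` are defined by a
-- quantifier-free formula in disjunctive normal form, found by recursion on `φ`. `Eff` says that a
-- family of predicates has normal forms that depend primitive recursively on the index. The
-- quantifiers over parameters are then copied in front of the resulting guard, so none of them has
-- to be eliminated.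
--
-- Boolean operations on normal forms are immediate. The temporal operators reduce to questions
-- about a system of symbolic edges (`Sys`), whose conditions combine those of the automaton with
-- the normal form of a subformula: is there a path to a given target of duration less than `α`, or
-- at least `α` (`Eff.tpath_lt`, `Eff.tpath_ge`), and is there a run of infinite duration
-- (`Eff.tRun`)? An existential until is a path followed by a run (`exists_until_iff`); a universal
-- until is treated through its violations (`forall_until_iff`, `forall_plain_until_iff`).
--
-- Paths without resets: while the clock crosses no threshold, the conditions depend on the clock
-- only modulo a common period. The set of reachable states, sampled once per period, then evolves
-- by a fixed rule in a finite power set, so reachability is ultimately periodic in the duration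
-- with computable bounds (`Sys.nreach_periodic`). A general path without resets is cut at the
-- thresholds that it crosses. It becomes a walk in a finite graph whose nodes are pairs of a state
-- and a term, and its existence is a finite disjunction (`Eff.nreach`).
--
-- Paths with resets: such a path is a sequence of laps, each but the first starting at clock value
-- zero. By periodicity the end of a lap can be moved to within a constant of its start or of a
-- threshold, so finitely many terms suffice and paths become walks in a finite graph with
-- nonnegative weights. A small duration is achieved by a walk without repetition
-- (`Sys.exists_rpath_lt_iff`). A large one is achieved by such a walk, by a lap that ends beyond
-- all thresholds and can be prolonged at will, or by repeating a closed walk of positive duration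
-- (`Sys.exists_rpath_ge_iff`). Only one-sided bounds on durations are treated in this way, and only
-- those are needed for the fragment.
--
-- A run exists if and only if a configuration can be reached that recurs with positive duration, by
-- the pigeonhole principle (`Sys.tRun_iff`).
--
-- The recursion is carried out on codes, by course-of-values recursion, so that computability
-- becomes primitive recursiveness of explicit functions (`defines_satSet`, `primrec_satSet`).
-- Parameters that do not occur in the input are finally deleted, which is harmless as satisfaction
-- ignores them (`QF.sat_congr`).

attribute [fun_prop] Primrec
attribute [fun_prop] Primrec.id Primrec.const Primrec.comp Primrec.fst Primrec.snd Primrec.pair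

namespace ParamTCTL

/-! ### Course-of-values recursion -/

section CourseRec

variable {α σ : Type*}

/-- The table of the first `n` values of the function defined by course-of-values recursion. -/
def table (g : α → List σ → σ) (a : α) (n : ℕ) : List σ :=
  Nat.rec [] (fun _ l => l ++ [g a l]) n

theorem table_length (g : α → List σ → σ) (a : α) (n : ℕ) : (table g a n).length = n := by
  induction n with
  | zero => rfl
  | succ n ih => simp only [table] at ih ⊢; simp [ih]

/-- The function defined by course-of-values recursion. -/
def courseRec (g : α → List σ → σ) (a : α) (n : ℕ) : σ := g a (table g a n)

/-- The table only grows at its end, so an entry never changes. This is how a recursive call on a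
smaller code is evaluated. -/
theorem table_getD (g : α → List σ → σ) (a : α) (d : σ) {m n : ℕ} (h : m < n) :
    (table g a n).getD m d = courseRec g a m := by
  induction n with
  | zero => omega
  | succ n ih =>
    have e : table g a (n + 1) = table g a n ++ [g a (table g a n)] := rfl
    rw [e]
    rcases Nat.lt_succ_iff_lt_or_eq.1 h with h | rfl
    · rw [List.getD_append _ _ _ _ (by rwa [table_length]), ih h]
    · rw [List.getD_append_right _ _ _ _ (by rw [table_length]), table_length]
      simp [courseRec]

end CourseRec

/-! ### Closure properties of primitive recursive functions -/

section Toolkit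

variable {α β γ σ : Type*} [Primcodable α] [Primcodable β] [Primcodable γ] [Primcodable σ]

@[fun_prop] theorem primrec_add {f g : α → ℕ} (hf : Primrec f) (hg : Primrec g) :
    Primrec fun a => f a + g a := Primrec.nat_add.comp hf hg

@[fun_prop] theorem primrec_sub {f g : α → ℕ} (hf : Primrec f) (hg : Primrec g) :
    Primrec fun a => f a - g a := Primrec.nat_sub.comp hf hg

@[fun_prop] theorem primrec_mul {f g : α → ℕ} (hf : Primrec f) (hg : Primrec g) :
    Primrec fun a => f a * g a := Primrec.nat_mul.comp hf hg

@[fun_prop] theorem primrec_div {f g : α → ℕ} (hf : Primrec f) (hg : Primrec g) :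
    Primrec fun a => f a / g a := Primrec.nat_div.comp hf hg

@[fun_prop] theorem primrec_mod {f g : α → ℕ} (hf : Primrec f) (hg : Primrec g) :
    Primrec fun a => f a % g a := Primrec.nat_mod.comp hf hg

@[fun_prop] theorem primrec_natPair {f g : α → ℕ} (hf : Primrec f) (hg : Primrec g) :
    Primrec fun a => Nat.pair (f a) (g a) := Primrec₂.natPair.comp hf hg

@[fun_prop] theorem primrec_unpair {f : α → ℕ} (hf : Primrec f) :
    Primrec fun a => (f a).unpair := Primrec.unpair.comp hf

@[fun_prop] theorem primrec_cons {f : α → β} {g : α → List β} (hf : Primrec f) (hg : Primrec g) :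
    Primrec fun a => f a :: g a := Primrec.list_cons.comp hf hg

@[fun_prop] theorem primrec_append {f g : α → List β} (hf : Primrec f) (hg : Primrec g) :
    Primrec fun a => f a ++ g a := Primrec.list_append.comp hf hg

@[fun_prop] theorem primrec_map {f : α → List β} {g : α → β → γ} (hf : Primrec f)
    (hg : Primrec fun p : α × β => g p.1 p.2) : Primrec fun a => (f a).map (g a) :=
  Primrec.list_map hf hg

@[fun_prop] theorem primrec_flatMap {f : α → List β} {g : α → β → List γ} (hf : Primrec f)
    (hg : Primrec fun p : α × β => g p.1 p.2) : Primrec fun a => (f a).flatMap (g a) :=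
  Primrec.list_flatMap hf hg

@[fun_prop] theorem primrec_foldr {f : α → List β} {g : α → σ} {h : α → β → σ → σ}
    (hf : Primrec f) (hg : Primrec g) (hh : Primrec fun p : α × (β × σ) => h p.1 p.2.1 p.2.2) :
    Primrec fun a => (f a).foldr (h a) (g a) :=
  Primrec.list_foldr (h := fun a p => h a p.1 p.2) hf hg hh

@[fun_prop] theorem primrec_range {f : α → ℕ} (hf : Primrec f) :
    Primrec fun a => List.range (f a) := Primrec.list_range.comp hf

@[fun_prop] theorem primrec_length {f : α → List β} (hf : Primrec f) :
    Primrec fun a => (f a).length := Primrec.list_length.comp hf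

@[fun_prop] theorem primrec_optionGetD {f : α → Option β} {g : α → β} (hf : Primrec f)
    (hg : Primrec g) : Primrec fun a => (f a).getD (g a) := Primrec.option_getD.comp hf hg

@[fun_prop] theorem primrec_getD {f : α → List β} {g : α → ℕ} {d : α → β} (hf : Primrec f)
    (hg : Primrec g) (hd : Primrec d) : Primrec fun a => (f a).getD (g a) (d a) := by
  simp only [List.getD_eq_getElem?_getD]
  exact primrec_optionGetD (Primrec.list_getElem?.comp hf hg) hd

@[fun_prop] theorem primrec_decode {f : α → ℕ} (hf : Primrec f) :
    Primrec fun a => (Encodable.decode (f a) : Option β) := Primrec.decode.comp hf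

@[fun_prop] theorem primrec_encode {f : α → β} (hf : Primrec f) :
    Primrec fun a => Encodable.encode (f a) := Primrec.encode.comp hf

@[fun_prop] theorem primrec_bnot {f : α → Bool} (hf : Primrec f) : Primrec fun a => !(f a) :=
  Primrec.not.comp hf

@[fun_prop] theorem primrec_cond {c : α → Bool} {f g : α → β} (hc : Primrec c) (hf : Primrec f)
    (hg : Primrec g) : Primrec fun a => bif c a then f a else g a := Primrec.cond hc hf hg

@[fun_prop] theorem primrec_decide_eq [DecidableEq β] {f g : α → β} (hf : Primrec f)
    (hg : Primrec g) : Primrec fun a => decide (f a = g a) := (Primrec.eq.comp hf hg).decide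

@[fun_prop] theorem primrec_decide_le {f g : α → ℕ} (hf : Primrec f) (hg : Primrec g) :
    Primrec fun a => decide (f a ≤ g a) := (Primrec.nat_le.comp hf hg).decide

@[fun_prop] theorem primrec_ite {c : α → Prop} [DecidablePred c] {f g : α → β}
    (hc : Primrec fun a => decide (c a)) (hf : Primrec f) (hg : Primrec g) :
    Primrec fun a => if c a then f a else g a := Primrec.ite (Primrec.primrecPred hc) hf hg

@[fun_prop] theorem primrec_natRec {n : α → ℕ} {f : α → β} {g : α → ℕ → β → β} (hn : Primrec n)
    (hf : Primrec f) (hg : Primrec fun p : α × (ℕ × β) => g p.1 p.2.1 p.2.2) :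
    Primrec fun a => (Nat.rec (f a) (g a) (n a) : β) :=
  Primrec.nat_rec' (h := fun a p => g a p.1 p.2) hn hf hg

@[fun_prop] theorem primrec_pow {f g : α → ℕ} (hf : Primrec f) (hg : Primrec g) :
    Primrec fun a => f a ^ g a := by
  have h : Primrec fun a => (Nat.rec 1 (fun _ y => y * f a) (g a) : ℕ) := by fun_prop
  refine h.of_eq fun a => ?_
  induction g a with
  | zero => rfl
  | succ k ih => simp only [ih, pow_succ]

@[fun_prop] theorem primrec_factorial {f : α → ℕ} (hf : Primrec f) :
    Primrec fun a => (f a).factorial := by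
  have h : Primrec fun a => (Nat.rec 1 (fun n y => (n + 1) * y) (f a) : ℕ) := by fun_prop
  refine h.of_eq fun a => ?_
  induction f a with
  | zero => rfl
  | succ k ih => simp only [ih, Nat.factorial_succ]

/-! ### Integers -/

/-- The encoding of `ℤ` uses the even numbers for the nonnegative integers and the odd ones for the
negative integers. Integer operations are shown to be primitive recursive by computing on these
codes. -/
theorem encode_int_ofNat (n : ℕ) : Encodable.encode (n : ℤ) = 2 * n := rfl

theorem encode_int_negSucc (n : ℕ) : Encodable.encode (Int.negSucc n) = 2 * n + 1 := rfl

@[fun_prop] theorem primrec_toNat {f : α → ℤ} (hf : Primrec f) : Primrec fun a => (f a).toNat := by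
  have h : Primrec fun a => if Encodable.encode (f a) % 2 = 0 then Encodable.encode (f a) / 2
      else 0 := by fun_prop
  refine h.of_eq fun a => ?_
  rcases f a with n | n
  · rw [Int.ofNat_eq_natCast, encode_int_ofNat]
    simp
  · rw [encode_int_negSucc, if_neg (by omega)]; rfl

@[fun_prop] theorem primrec_natCast {f : α → ℕ} (hf : Primrec f) : Primrec fun a => (f a : ℤ) := by
  rw [← Primrec.encode_iff]
  exact (by fun_prop : Primrec fun a => 2 * f a).of_eq fun a => (encode_int_ofNat _).symm

@[fun_prop] theorem primrec_int_neg {f : α → ℤ} (hf : Primrec f) : Primrec fun a => -(f a) := by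
  rw [← Primrec.encode_iff]
  -- Negation swaps the codes `2n + 2` and `2n + 1`; truncated subtraction fixes the code of zero.
  have h : Primrec fun a => if Encodable.encode (f a) % 2 = 0 then Encodable.encode (f a) - 1
      else Encodable.encode (f a) + 1 := by fun_prop
  refine h.of_eq fun a => ?_
  rcases f a with n | n
  · rw [Int.ofNat_eq_natCast, encode_int_ofNat]
    rcases n with _ | n
    · rfl
    · rw [if_pos (by omega)]
      exact (encode_int_negSucc n).symm
  · rw [encode_int_negSucc, if_neg (by omega), Int.neg_negSucc, encode_int_ofNat]
    omega

theorem primrec_subNat {f g : α → ℕ} (hf : Primrec f) (hg : Primrec g) :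
    Primrec fun a => (f a : ℤ) - (g a : ℤ) := by
  have h : Primrec fun a => if g a ≤ f a then ((f a - g a : ℕ) : ℤ)
      else -((g a - f a : ℕ) : ℤ) := by fun_prop
  refine h.of_eq fun a => ?_
  split_ifs <;> omega

@[fun_prop] theorem primrec_int_add {f g : α → ℤ} (hf : Primrec f) (hg : Primrec g) :
    Primrec fun a => f a + g a := by
  have h : Primrec fun a => (((f a).toNat + (g a).toNat : ℕ) : ℤ) -
      (((-f a).toNat + (-g a).toNat : ℕ) : ℤ) :=
    primrec_subNat (by fun_prop) (by fun_prop)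
  exact h.of_eq fun a => by omega

@[fun_prop] theorem primrec_int_sub {f g : α → ℤ} (hf : Primrec f) (hg : Primrec g) :
    Primrec fun a => f a - g a := by
  simp only [sub_eq_add_neg]; fun_prop

@[fun_prop] theorem primrec_sign {f : α → ℤ} (hf : Primrec f) : Primrec fun a => (f a).sign := by
  have h : Primrec fun a => if 1 ≤ (f a).toNat then ((1 : ℕ) : ℤ) else
      if 1 ≤ (-f a).toNat then -((1 : ℕ) : ℤ) else ((0 : ℕ) : ℤ) := by fun_prop
  refine h.of_eq fun a => ?_
  rcases lt_trichotomy (f a) 0 with h | h | h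
  · rw [Int.sign_eq_neg_one_of_neg h]; split_ifs <;> omega
  · rw [h]; rfl
  · rw [Int.sign_eq_one_of_pos h]; split_ifs <;> omega

@[fun_prop] theorem primrec_courseRec {g : α → List σ → σ}
    (hg : Primrec fun p : α × List σ => g p.1 p.2) {f : γ → α} {n : γ → ℕ} (hf : Primrec f)
    (hn : Primrec n) : Primrec fun c => courseRec g (f c) (n c) := by
  unfold courseRec table
  fun_prop

end Toolkit

/-! ### Quantifier-free formulas in disjunctive normal form

The clock ranges over `ℤ` here. -/

/-- Linear terms in the parameters. -/
abbrev LT : Type := List (ℕ × ℤ) × ℤ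

namespace LT

def eval (v : ℕ → ℕ) (α : LT) : ℤ := (α.1.map fun p => p.2 * (v p.1 : ℤ)).sum + α.2

def const (c : ℤ) : LT := ([], c)

def add (α β : LT) : LT := (α.1 ++ β.1, α.2 + β.2)

def neg (α : LT) : LT := (α.1.map fun p => (p.1, -p.2), -α.2)

@[simp] theorem eval_const (v : ℕ → ℕ) (c : ℤ) : (const c).eval v = c := by simp [eval, const]

@[simp] theorem eval_add (v : ℕ → ℕ) (α β : LT) : (add α β).eval v = α.eval v + β.eval v := by
  simp [eval, add]; ring

@[simp] theorem eval_neg (v : ℕ → ℕ) (α : LT) : (neg α).eval v = -α.eval v := by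
  have : ∀ l : List (ℕ × ℤ), (l.map fun p => -(p.2 * (v p.1 : ℤ))).sum =
      -(l.map fun p => p.2 * (v p.1 : ℤ)).sum := by
    intro l
    induction l with
    | nil => simp
    | cons p l ih => simp [ih]; ring
  simp [eval, neg, Function.comp_def, this]; ring

end LT

section

variable {ι : Type*} [Primcodable ι]

@[fun_prop] theorem primrec_ltConst {c : ι → ℤ} (hc : Primrec c) :
    Primrec fun i => LT.const (c i) := by unfold LT.const; fun_prop

@[fun_prop] theorem primrec_ltAdd {f g : ι → LT} (hf : Primrec f) (hg : Primrec g) :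
    Primrec fun i => LT.add (f i) (g i) := by unfold LT.add; fun_prop

@[fun_prop] theorem primrec_ltNeg {f : ι → LT} (hf : Primrec f) :
    Primrec fun i => LT.neg (f i) := by unfold LT.neg; fun_prop

end

/-- A literal `(s, m, e, α)`: the atom `0 ≤ e x + α` (if `m = 0`) or `m ∣ e x + α` (if `m > 0`),
negated unless `s` is true. Only the sign of `e` matters. -/
abbrev Lit : Type := Bool × ℕ × ℤ × LT

namespace Lit

def val (v : ℕ → ℕ) (x : ℤ) (l : Lit) : ℤ := l.2.2.1.sign * x + l.2.2.2.eval v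

def Atom (m : ℕ) (z : ℤ) : Prop := if m = 0 then 0 ≤ z else (m : ℤ) ∣ z

def Holds (v : ℕ → ℕ) (x : ℤ) (l : Lit) : Prop := (l.1 = true ↔ Atom l.2.1 (l.val v x))

def neg (l : Lit) : Lit := (!l.1, l.2)

theorem holds_neg (v : ℕ → ℕ) (x : ℤ) (l : Lit) : l.neg.Holds v x ↔ ¬ l.Holds v x := by
  rcases l with ⟨_ | _, l⟩ <;> simp [neg, Holds, val]

end Lit

/-- A linear term that may contain the clock, with coefficient one. -/
abbrev Pos : Type := Bool × LT

namespace Pos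

def eval (v : ℕ → ℕ) (x : ℤ) (Y : Pos) : ℤ := (bif Y.1 then x else 0) + Y.2.eval v

def clock : Pos := (true, LT.const 0)

def ofTerm (α : LT) : Pos := (false, α)

def shift (Y : Pos) (n : ℤ) : Pos := (Y.1, LT.add Y.2 (LT.const n))

@[simp] theorem eval_clock (v : ℕ → ℕ) (x : ℤ) : clock.eval v x = x := by simp [eval, clock]

@[simp] theorem eval_ofTerm (v : ℕ → ℕ) (x : ℤ) (α : LT) : (ofTerm α).eval v x = α.eval v := by
  simp [eval, ofTerm]

@[simp] theorem eval_shift (v : ℕ → ℕ) (x : ℤ) (Y : Pos) (n : ℤ) :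
    (Y.shift n).eval v x = Y.eval v x + n := by simp [eval, shift]; ring

end Pos

namespace Lit

/-- Replace the clock by `Y`. -/
def subst (Y : Pos) (l : Lit) : Lit :=
  (l.1, l.2.1, bif Y.1 then l.2.2.1 else 0,
    if l.2.2.1.sign = 1 then LT.add Y.2 l.2.2.2 else
      if l.2.2.1.sign = -1 then LT.add (LT.neg Y.2) l.2.2.2 else l.2.2.2)

theorem val_subst (v : ℕ → ℕ) (x : ℤ) (Y : Pos) (l : Lit) :
    (l.subst Y).val v x = l.val v (Y.eval v x) := by
  rcases l with ⟨s, m, e, α⟩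
  rcases Y with ⟨b, β⟩
  rcases lt_trichotomy e 0 with h | h | h
  · cases b <;> simp [subst, val, Pos.eval, Int.sign_eq_neg_one_of_neg h]
    ring
  · subst h; cases b <;> simp [subst, val]
  · cases b <;> simp [subst, val, Pos.eval, Int.sign_eq_one_of_pos h]
    ring

theorem holds_subst (v : ℕ → ℕ) (x : ℤ) (Y : Pos) (l : Lit) :
    (l.subst Y).Holds v x ↔ l.Holds v (Y.eval v x) := by
  unfold Holds; rw [val_subst]; rfl

end Lit

/-- A disjunction of conjunctions of literals. -/
abbrev DNF : Type := List (List Lit)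

namespace DNF

def Holds (v : ℕ → ℕ) (x : ℤ) (D : DNF) : Prop := ∃ c ∈ D, ∀ l ∈ c, l.Holds v x

def conj (D E : DNF) : DNF := D.flatMap fun c => E.map fun d => c ++ d

/-- De Morgan, multiplied out: a conjunction of the result picks one literal from every conjunction
of `D` and negates it. The start value `[[]]` is the true normal form, the negation of the empty
disjunction. -/
def neg (D : DNF) : DNF :=
  D.foldr (fun c acc => c.flatMap fun l => acc.map fun d => l.neg :: d) [[]]

def subst (Y : Pos) (D : DNF) : DNF := D.map fun c => c.map fun l => l.subst Y

theorem holds_append (v : ℕ → ℕ) (x : ℤ) (D E : DNF) :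
    Holds v x (D ++ E) ↔ D.Holds v x ∨ E.Holds v x := by
  simp only [Holds, List.mem_append, or_and_right, exists_or]

theorem holds_conj (v : ℕ → ℕ) (x : ℤ) (D E : DNF) :
    (D.conj E).Holds v x ↔ D.Holds v x ∧ E.Holds v x := by
  simp only [Holds, conj, List.mem_flatMap, List.mem_map]
  constructor
  · rintro ⟨_, ⟨c, hc, d, hd, rfl⟩, h⟩
    exact ⟨⟨c, hc, fun l hl => h l (by simp [hl])⟩, ⟨d, hd, fun l hl => h l (by simp [hl])⟩⟩
  · rintro ⟨⟨c, hc, h⟩, ⟨d, hd, h'⟩⟩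
    exact ⟨c ++ d, ⟨c, hc, d, hd, rfl⟩, fun l hl => (List.mem_append.1 hl).elim (h l) (h' l)⟩

theorem holds_neg (v : ℕ → ℕ) (x : ℤ) (D : DNF) : D.neg.Holds v x ↔ ¬ D.Holds v x := by
  induction D with
  | nil => simp [neg, Holds]
  | cons c D ih =>
    have e : neg (c :: D) = c.flatMap fun l => (neg D).map fun d => l.neg :: d := rfl
    rw [e]
    simp only [Holds, List.mem_flatMap, List.mem_map, List.mem_cons, exists_eq_or_imp, not_or]
    rw [show (¬ ∃ c ∈ D, ∀ l ∈ c, l.Holds v x) ↔ _ from ih.symm]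
    constructor
    · rintro ⟨_, ⟨l, hl, d, hd, rfl⟩, h⟩
      refine ⟨fun h' => ?_, d, hd, fun k hk => h k (by simp [hk])⟩
      exact (Lit.holds_neg v x l).1 (h _ (by simp)) (h' l hl)
    · rintro ⟨h, d, hd, hd'⟩
      push Not at h
      obtain ⟨l, hl, hl'⟩ := h
      refine ⟨_, ⟨l, hl, d, hd, rfl⟩, fun k hk => ?_⟩
      rcases List.mem_cons.1 hk with rfl | hk
      · exact (Lit.holds_neg v x l).2 hl'
      · exact hd' k hk

theorem holds_subst (v : ℕ → ℕ) (x : ℤ) (Y : Pos) (D : DNF) :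
    (D.subst Y).Holds v x ↔ D.Holds v (Y.eval v x) := by
  simp only [Holds, subst, List.mem_map, exists_exists_and_eq_and, forall_exists_index, and_imp,
    forall_apply_eq_imp_iff₂, Lit.holds_subst]

theorem holds_flatMap {β : Type*} (v : ℕ → ℕ) (x : ℤ) (l : List β) (F : β → DNF) :
    Holds v x (l.flatMap F) ↔ ∃ b ∈ l, (F b).Holds v x := by
  simp only [Holds, List.mem_flatMap]
  grind

end DNF

section

variable {ι : Type*} [Primcodable ι]

@[fun_prop] theorem primrec_posShift {f : ι → Pos} {n : ι → ℤ} (hf : Primrec f)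
    (hn : Primrec n) : Primrec fun i => (f i).shift (n i) := by unfold Pos.shift; fun_prop

@[fun_prop] theorem primrec_posOfTerm {f : ι → LT} (hf : Primrec f) :
    Primrec fun i => Pos.ofTerm (f i) := by unfold Pos.ofTerm; fun_prop

@[fun_prop] theorem primrec_litNeg {f : ι → Lit} (hf : Primrec f) :
    Primrec fun i => (f i).neg := by unfold Lit.neg; fun_prop

@[fun_prop] theorem primrec_litSubst {f : ι → Lit} {Y : ι → Pos} (hf : Primrec f)
    (hY : Primrec Y) : Primrec fun i => (f i).subst (Y i) := by unfold Lit.subst; fun_prop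

@[fun_prop] theorem primrec_conj {f g : ι → DNF} (hf : Primrec f) (hg : Primrec g) :
    Primrec fun i => (f i).conj (g i) := by unfold DNF.conj; fun_prop

@[fun_prop] theorem primrec_neg {f : ι → DNF} (hf : Primrec f) :
    Primrec fun i => (f i).neg := by unfold DNF.neg; fun_prop

@[fun_prop] theorem primrec_subst {f : ι → DNF} {Y : ι → Pos} (hf : Primrec f)
    (hY : Primrec Y) : Primrec fun i => (f i).subst (Y i) := by unfold DNF.subst; fun_prop

end

/-! ### Effectively definable families of predicates -/

/-- The predicates `P i` of the clock and the valuation are defined by quantifier-free formulas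
that are computed from `i`. -/
def Eff {ι : Type*} [Primcodable ι] (P : ι → ℤ → (ℕ → ℕ) → Prop) : Prop :=
  ∃ F : ι → DNF, Primrec F ∧ ∀ i x v, (F i).Holds v x ↔ P i x v

namespace Eff

variable {ι κ β : Type*} [Primcodable ι] [Primcodable κ] [Primcodable β]
  {P Q : ι → ℤ → (ℕ → ℕ) → Prop}

theorem congr (h : Eff P) (e : ∀ i x v, P i x v ↔ Q i x v) : Eff Q :=
  let ⟨F, hF, hP⟩ := h
  ⟨F, hF, fun i x v => (hP i x v).trans (e i x v)⟩

theorem holds {F : ι → DNF} (hF : Primrec F) : Eff fun i x v => (F i).Holds v x :=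
  ⟨F, hF, fun _ _ _ => Iff.rfl⟩

theorem comp (h : Eff P) {f : κ → ι} (hf : Primrec f) : Eff fun i => P (f i) :=
  let ⟨F, hF, hP⟩ := h
  ⟨fun i => F (f i), hF.comp hf, fun i => hP (f i)⟩

theorem or (hP : Eff P) (hQ : Eff Q) : Eff fun i x v => P i x v ∨ Q i x v := by
  obtain ⟨F, hF, hP⟩ := hP
  obtain ⟨G, hG, hQ⟩ := hQ
  exact ⟨fun i => F i ++ G i, by fun_prop, fun i x v => by rw [DNF.holds_append, hP, hQ]⟩

theorem and (hP : Eff P) (hQ : Eff Q) : Eff fun i x v => P i x v ∧ Q i x v := by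
  obtain ⟨F, hF, hP⟩ := hP
  obtain ⟨G, hG, hQ⟩ := hQ
  exact ⟨fun i => (F i).conj (G i), by fun_prop, fun i x v => by rw [DNF.holds_conj, hP, hQ]⟩

theorem not (hP : Eff P) : Eff fun i x v => ¬ P i x v := by
  obtain ⟨F, hF, hP⟩ := hP
  exact ⟨fun i => (F i).neg, by fun_prop, fun i x v => by rw [DNF.holds_neg, hP]⟩

/-- A quantifier over a list that is computed from the index alone is a finite disjunction. The
later arguments serve to bring every existential statement about paths into this form. -/
theorem ex {l : ι → List β} (hl : Primrec l) {P : ι → β → ℤ → (ℕ → ℕ) → Prop}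
    (h : Eff fun p : ι × β => P p.1 p.2) : Eff fun i x v => ∃ b ∈ l i, P i b x v := by
  obtain ⟨F, hF, hP⟩ := h
  exact ⟨fun i => (l i).flatMap fun b => F (i, b), by fun_prop, fun i x v => by
    simp only [DNF.holds_flatMap, hP]⟩

theorem all {l : ι → List β} (hl : Primrec l) {P : ι → β → ℤ → (ℕ → ℕ) → Prop}
    (h : Eff fun p : ι × β => P p.1 p.2) : Eff fun i x v => ∀ b ∈ l i, P i b x v :=
  (ex hl (P := fun i b x v => ¬ P i b x v) h.not).not.congr fun i x v => by push Not; rfl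

theorem ex_lt {n : ι → ℕ} (hn : Primrec n) {P : ι → ℕ → ℤ → (ℕ → ℕ) → Prop}
    (h : Eff fun p : ι × ℕ => P p.1 p.2) : Eff fun i x v => ∃ k < n i, P i k x v :=
  (ex (l := fun i => List.range (n i)) (by fun_prop) h).congr fun i x v => by simp

theorem all_lt {n : ι → ℕ} (hn : Primrec n) {P : ι → ℕ → ℤ → (ℕ → ℕ) → Prop}
    (h : Eff fun p : ι × ℕ => P p.1 p.2) : Eff fun i x v => ∀ k < n i, P i k x v :=
  (all (l := fun i => List.range (n i)) (by fun_prop) h).congr fun i x v => by simp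

theorem const {p : ι → Prop} [DecidablePred p] (h : Primrec fun i => decide (p i)) :
    Eff fun i _ _ => p i :=
  ⟨fun i => bif decide (p i) then [[]] else [], by fun_prop, fun i x v => by
    by_cases hp : p i <;> simp [hp, DNF.Holds]⟩

theorem subst (h : Eff P) {Y : ι → Pos} (hY : Primrec Y) :
    Eff fun i x v => P i ((Y i).eval v x) v := by
  obtain ⟨F, hF, hP⟩ := h
  exact ⟨fun i => (F i).subst (Y i), by fun_prop, fun i x v => by rw [DNF.holds_subst, hP]⟩

theorem atom {m : ι → ℕ} {e : ι → ℤ} {α : ι → LT} (hm : Primrec m) (he : Primrec e)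
    (hα : Primrec α) : Eff fun i x v => Lit.Atom (m i) ((e i).sign * x + (α i).eval v) :=
  ⟨fun i => [[(true, m i, e i, α i)]], by fun_prop, fun i x v => by
    simp only [DNF.Holds, List.mem_singleton, exists_eq_left, forall_eq, Lit.Holds, Lit.val,
      true_iff]⟩

/-- The coefficient of the clock in `Z - Y`. -/
def diffCoeff (Y Z : Pos) : ℤ := (bif Z.1 then 1 else 0) - (bif Y.1 then 1 else 0)

theorem diffCoeff_eval (Y Z : Pos) (v : ℕ → ℕ) (x : ℤ) :
    (diffCoeff Y Z).sign * x + (LT.add Z.2 (LT.neg Y.2)).eval v = Z.eval v x - Y.eval v x := by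
  rcases Y with ⟨_ | _, β⟩ <;> rcases Z with ⟨_ | _, γ⟩ <;> simp [diffCoeff, Pos.eval] <;> ring

theorem posLe {Y Z : ι → Pos} (hY : Primrec Y) (hZ : Primrec Z) :
    Eff fun i x v => (Y i).eval v x ≤ (Z i).eval v x :=
  (atom (m := fun _ => 0) (e := fun i => diffCoeff (Y i) (Z i))
    (α := fun i => LT.add (Z i).2 (LT.neg (Y i).2)) (by fun_prop)
    (by unfold diffCoeff; fun_prop) (by fun_prop)).congr fun i x v => by
      rw [diffCoeff_eval]; simp [Lit.Atom]

theorem posEq {Y Z : ι → Pos} (hY : Primrec Y) (hZ : Primrec Z) :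
    Eff fun i x v => (Y i).eval v x = (Z i).eval v x :=
  ((posLe hY hZ).and (posLe hZ hY)).congr fun _ _ _ => le_antisymm_iff.symm

theorem posLt {Y Z : ι → Pos} (hY : Primrec Y) (hZ : Primrec Z) :
    Eff fun i x v => (Y i).eval v x < (Z i).eval v x :=
  (posLe hZ hY).not.congr fun _ _ _ => not_le

theorem posDvd {m : ι → ℕ} {Y Z : ι → Pos} (hm : Primrec m) (h0 : ∀ i, 0 < m i)
    (hY : Primrec Y) (hZ : Primrec Z) :
    Eff fun i x v => (m i : ℤ) ∣ (Z i).eval v x - (Y i).eval v x :=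
  (atom (m := m) (e := fun i => diffCoeff (Y i) (Z i))
    (α := fun i => LT.add (Z i).2 (LT.neg (Y i).2)) hm
    (by unfold diffCoeff; fun_prop) (by fun_prop)).congr fun i x v => by
      rw [diffCoeff_eval]; simp [Lit.Atom, (h0 i).ne']

end Eff

/-! ### Walks -/

section Walk

variable {β : Type*}

/-- `l` lists the successive nodes, without the first one, of a walk from `a` to `b`. -/
def Walk (r : β → β → Prop) : β → List β → β → Prop
  | a, [], b => a = b
  | a, c :: l, b => r a c ∧ Walk r c l b

variable {r : β → β → Prop}

theorem walk_append {a b : β} {l l' : List β} :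
    Walk r a (l ++ l') b ↔ ∃ c, Walk r a l c ∧ Walk r c l' b := by
  induction l generalizing a with
  | nil => simp [Walk]
  | cons d l ih => simp only [List.cons_append, Walk, ih]; grind

/-- With positions in place of recursion, being a walk is a bounded conjunction of links and hence
definable when the links are. -/
theorem walk_iff_getD {a b : β} {l : List β} : Walk r a l b ↔
    (∀ k < l.length, r ((a :: l).getD k a) (l.getD k a)) ∧ (a :: l).getD l.length a = b := by
  induction l generalizing a with
  | nil => simp [Walk]
  | cons c l ih =>
    -- Within range the default value is irrelevant; it is changed from `a` to `c` to fit the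
    -- induction hypothesis.
    have hd : ∀ k, k ≤ l.length → (c :: l).getD k a = (c :: l).getD k c := fun k hk => by
      simp [List.getD_eq_getElem?_getD, List.getElem?_eq_getElem (l := c :: l) (i := k)
        (by simp; omega)]
    have hl : ∀ k, k < l.length → l.getD k a = l.getD k c := fun k hk => by
      simp [List.getD_eq_getElem?_getD, List.getElem?_eq_getElem hk]
    simp only [Walk, ih, List.length_cons, List.getD_cons_succ, hd _ le_rfl]
    rw [← and_assoc]
    refine and_congr_left fun _ => ⟨fun h k hk => ?_, fun h => ⟨by simpa using h 0 (by simp),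
      fun k hk => ?_⟩⟩
    · rcases k with _ | k
      · simpa using h.1
      · have := h.2 k (by omega)
        rwa [List.getD_cons_succ, List.getD_cons_succ, hd _ (by omega), hl _ (by omega)]
    · have := h (k + 1) (by omega)
      rwa [List.getD_cons_succ, List.getD_cons_succ, hd _ (by omega), hl _ (by omega)] at this

theorem walk_of_mem {a b d : β} {l : List β} (h : Walk r a l b) (hd : d ∈ l) :
    ∃ l₁ l₂, l = l₁ ++ d :: l₂ ∧ Walk r a (l₁ ++ [d]) d ∧ Walk r d l₂ b := by
  obtain ⟨l₁, l₂, rfl⟩ := List.append_of_mem hd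
  obtain ⟨c, h₁, h₂⟩ := walk_append.1 h
  exact ⟨l₁, l₂, rfl, walk_append.2 ⟨c, h₁, h₂.1, rfl⟩, h₂.2⟩

theorem exists_append_of_not_nodup {l : List β} (h : ¬ l.Nodup) :
    ∃ c l₁ l₂ l₃, l = l₁ ++ c :: (l₂ ++ c :: l₃) := by
  induction l with
  | nil => simp at h
  | cons c l ih =>
    rw [List.nodup_cons, not_and_or, not_not] at h
    rcases h with h | h
    · obtain ⟨l₂, l₃, rfl⟩ := List.append_of_mem h
      exact ⟨c, [], l₂, l₃, rfl⟩
    · obtain ⟨d, l₁, l₂, l₃, rfl⟩ := ih h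
      exact ⟨d, c :: l₁, l₂, l₃, rfl⟩

theorem walk_shorten {a b c : β} {l₁ l₂ l₃ : List β}
    (h : Walk r a (l₁ ++ c :: (l₂ ++ c :: l₃)) b) :
    Walk r a (l₁ ++ [c]) c ∧ Walk r c (l₂ ++ [c]) c ∧ Walk r c l₃ b ∧
      Walk r a (l₁ ++ c :: l₃) b := by
  obtain ⟨d, h₁, h₂, h₃⟩ := walk_append.1 h
  obtain ⟨d', h₄, h₅, h₆⟩ := walk_append.1 h₃
  exact ⟨walk_append.2 ⟨d, h₁, h₂, rfl⟩, walk_append.2 ⟨d', h₄, h₅, rfl⟩, h₆,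
    walk_append.2 ⟨d, h₁, h₂, h₆⟩⟩

/-- Between two visits of the same node lies a closed walk of nonnegative weight, which is cut out
until no node is repeated. -/
theorem exists_short_walk_le {a b : β} {w : β → ℤ} {l : List β} (h : Walk r a l b)
    (hw : ∀ c ∈ l, 0 ≤ w c) :
    ∃ l', Walk r a l' b ∧ l'.Nodup ∧ l' ⊆ l ∧ (l'.map w).sum ≤ (l.map w).sum := by
  induction hn : l.length using Nat.strong_induction_on generalizing l with
  | _ n ih =>
    subst hn
    by_cases hl : l.Nodup
    · exact ⟨l, h, hl, List.Subset.refl l, le_rfl⟩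
    obtain ⟨c, l₁, l₂, l₃, rfl⟩ := exists_append_of_not_nodup hl
    have hsub : l₁ ++ c :: l₃ ⊆ l₁ ++ c :: (l₂ ++ c :: l₃) := by
      intro d; simp only [List.mem_append, List.mem_cons]; tauto
    obtain ⟨l', h', hd, hs, hle⟩ := ih _ (by simp) (walk_shorten h).2.2.2
      (fun d hd => hw d (hsub hd)) rfl
    refine ⟨l', h', hd, List.Subset.trans hs hsub, hle.trans ?_⟩
    have h2 : 0 ≤ (l₂.map w).sum := List.sum_nonneg fun z hz => by
      obtain ⟨d, hd, rfl⟩ := List.mem_map.1 hz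
      exact hw d (by simp [hd])
    have h3 := hw c (by simp)
    simp only [List.map_append, List.map_cons, List.sum_append, List.sum_cons]
    omega

/-- A closed part without positive weights can be cut out at no loss. Otherwise some node of
positive weight lies on a closed walk, and arbitrarily large weights are possible. -/
theorem exists_short_walk_ge {a b : β} {w : β → ℤ} {l : List β} (h : Walk r a l b)
    (hw : ∀ c ∈ l, 0 ≤ w c) :
    (∃ l', Walk r a l' b ∧ l'.Nodup ∧ l' ⊆ l ∧ (l.map w).sum ≤ (l'.map w).sum) ∨
      ∃ d ∈ l, 0 < w d ∧ ∃ l₁ l₂ l₃, l₁ ⊆ l ∧ l₂ ⊆ l ∧ l₃ ⊆ l ∧ l₂ ≠ [] ∧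
        Walk r a l₁ d ∧ Walk r d l₂ d ∧ Walk r d l₃ b := by
  induction hn : l.length using Nat.strong_induction_on generalizing l with
  | _ n ih =>
    subst hn
    by_cases hl : l.Nodup
    · exact Or.inl ⟨l, h, hl, List.Subset.refl l, le_rfl⟩
    obtain ⟨c, l₁, l₂, l₃, rfl⟩ := exists_append_of_not_nodup hl
    have hsub : l₁ ++ c :: l₃ ⊆ l₁ ++ c :: (l₂ ++ c :: l₃) := by
      intro d; simp only [List.mem_append, List.mem_cons]; tauto
    obtain ⟨h₁, h₂, h₃, h₄⟩ := walk_shorten h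
    by_cases hpos : ∃ d ∈ l₂ ++ [c], 0 < w d
    · obtain ⟨d, hd, hd0⟩ := hpos
      obtain ⟨m₁, m₂, e, k₁, k₂⟩ := walk_of_mem h₂ hd
      have hm : ∀ x, x ∈ m₁ ∨ x = d ∨ x ∈ m₂ → x ∈ l₂ ∨ x = c := fun x hx => by
        have : x ∈ l₂ ++ [c] := by rw [e]; simpa using hx
        simpa using this
      right
      -- The closed walk through `c` is rotated so that it starts and ends at `d`.
      refine ⟨d, ?_, hd0, (l₁ ++ [c]) ++ (m₁ ++ [d]), m₂ ++ (m₁ ++ [d]), m₂ ++ l₃, ?_, ?_, ?_,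
        by simp, walk_append.2 ⟨c, h₁, k₁⟩, walk_append.2 ⟨c, k₂, k₁⟩,
        walk_append.2 ⟨c, k₂, h₃⟩⟩
      all_goals grind
    · push Not at hpos
      rcases ih _ (by simp) h₄ (fun d hd => hw d (hsub hd)) rfl with
        ⟨l', h', hd, hs, hle⟩ | ⟨d, hd, hd0, m₁, m₂, m₃, s₁, s₂, s₃, h'⟩
      · refine Or.inl ⟨l', h', hd, List.Subset.trans hs hsub, le_trans ?_ hle⟩
        have h2 : ((l₂ ++ [c]).map w).sum ≤ 0 := by
          simpa using List.sum_le_card_nsmul ((l₂ ++ [c]).map w) 0 fun z hz => by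
            obtain ⟨d, hd, rfl⟩ := List.mem_map.1 hz
            exact hpos d hd
        simp only [List.map_append, List.map_cons, List.sum_append, List.sum_cons,
          List.map_nil, List.sum_nil] at h2 ⊢
        omega
      · exact Or.inr ⟨d, hsub hd, hd0, m₁, m₂, m₃, List.Subset.trans s₁ hsub,
          List.Subset.trans s₂ hsub, List.Subset.trans s₃ hsub, h'⟩

theorem exists_walk_of_reflTransGen {N : List β} {a b : β}
    (h : Relation.ReflTransGen (fun c d => d ∈ N ∧ r c d) a b) : ∃ l ⊆ N, Walk r a l b := by
  induction h with
  | refl => exact ⟨[], by simp, rfl⟩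
  | @tail c d _ hcd ih =>
    obtain ⟨l, hl, h⟩ := ih
    exact ⟨l ++ [d], by simp [hl, hcd.1], walk_append.2 ⟨c, h, hcd.2, rfl⟩⟩

theorem Walk.reflTransGen {N : List β} {a b : β} {l : List β} (h : Walk r a l b) (hl : l ⊆ N) :
    Relation.ReflTransGen (fun c d => d ∈ N ∧ r c d) a b := by
  induction l generalizing a with
  | nil => cases h; exact .refl
  | cons c l ih =>
    rw [List.cons_subset] at hl
    exact .head ⟨hl.1, h.1⟩ (ih h.2 hl.2)

/-- The lists of length at most `n` with elements in `N`. -/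
def allLists (N : List β) (n : ℕ) : List (List β) :=
  Nat.rec [[]] (fun _ L => [] :: L.flatMap fun l => N.map fun c => c :: l) n

theorem mem_allLists {N : List β} {n : ℕ} {l : List β} :
    l ∈ allLists N n ↔ l ⊆ N ∧ l.length ≤ n := by
  induction n generalizing l with
  | zero => simp [allLists]; rintro rfl; simp
  | succ n ih =>
    have e : allLists N (n + 1) =
      [] :: (allLists N n).flatMap fun l => N.map fun c => c :: l := rfl
    rw [e]
    cases l with
    | nil => simp
    | cons c l => simp [ih]; tauto

theorem mem_allLists_of_nodup {N l : List β} (h : l ⊆ N) (hl : l.Nodup) :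
    l ∈ allLists N N.length :=
  mem_allLists.2 ⟨h, (List.subperm_of_subset hl h).length_le⟩

/-- Walks without repetition suffice, and these are not longer than the list of nodes; the weight is
zero as only the repetitions matter. -/
theorem reflTransGen_iff_exists_walk {N : List β} {a b : β} :
    Relation.ReflTransGen (fun c d => d ∈ N ∧ r c d) a b ↔
      ∃ l ∈ allLists N N.length, Walk r a l b := by
  constructor
  · intro h
    obtain ⟨l, hl, h⟩ := exists_walk_of_reflTransGen h
    obtain ⟨l', h', hd, hs, -⟩ := exists_short_walk_le (w := fun _ => 0) h (by simp)
    exact ⟨l', mem_allLists_of_nodup (List.Subset.trans hs hl) hd, h'⟩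
  · rintro ⟨l, hl, h⟩
    exact h.reflTransGen (mem_allLists.1 hl).1

end Walk

@[fun_prop] theorem primrec_allLists {ι β : Type*} [Primcodable ι] [Primcodable β]
    {N : ι → List β} {n : ι → ℕ} (hN : Primrec N) (hn : Primrec n) :
    Primrec fun i => allLists (N i) (n i) := by unfold allLists; fun_prop

namespace Eff

variable {ι β : Type*} [Primcodable ι] [Primcodable β] [DecidableEq β]

theorem walk {link : ι → β → β → ℤ → (ℕ → ℕ) → Prop}
    (h : Eff fun p : ι × β × β => link p.1 p.2.1 p.2.2) :
    Eff fun (p : ι × β × List β × β) x v =>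
      Walk (fun c d => link p.1 c d x v) p.2.1 p.2.2.1 p.2.2.2 := by
  simp only [walk_iff_getD]
  refine and (all_lt (by fun_prop) ?_) (const (by fun_prop))
  exact h.comp (f := fun q : (ι × β × List β × β) × ℕ =>
    (q.1.1, (q.1.2.1 :: q.1.2.2.1).getD q.2 q.1.2.1, q.1.2.2.1.getD q.2 q.1.2.1)) (by fun_prop)

/-- The truth of a link depends on the clock and the valuation, but the list of possible walks does
not. So a transitive closure becomes a finite disjunction over candidate walks. -/
theorem reach {N : ι → List β} (hN : Primrec N) {link : ι → β → β → ℤ → (ℕ → ℕ) → Prop}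
    (h : Eff fun p : ι × β × β => link p.1 p.2.1 p.2.2) :
    Eff fun (p : ι × β × β) x v =>
      Relation.ReflTransGen (fun c d => d ∈ N p.1 ∧ link p.1 c d x v) p.2.1 p.2.2 := by
  simp only [reflTransGen_iff_exists_walk]
  exact ex (by fun_prop) ((walk h).comp (f := fun q : (ι × β × β) × List β =>
    (q.1.1, q.1.2.1, q.2, q.1.2.2)) (by fun_prop))

end Eff

/-! ### Symbolic transition systems

An edge `(src, tick, cond, reset, tgt)` can be taken from `src` at clock value `x` if `cond` holds
at `x`. -/

abbrev REdge : Type := ℕ × Bool × DNF × Bool × ℕ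

namespace REdge

def src (e : REdge) : ℕ := e.1

def tick (e : REdge) : ℕ := bif e.2.1 then 1 else 0

def cond (e : REdge) : DNF := e.2.2.1

def reset (e : REdge) : Bool := e.2.2.2.1

def tgt (e : REdge) : ℕ := e.2.2.2.2

theorem tick_le (e : REdge) : e.tick ≤ 1 := by
  rcases e with ⟨s, _ | _, r⟩ <;> simp [tick]

end REdge

section

variable {ι : Type*} [Primcodable ι] {e : ι → REdge}

@[fun_prop] theorem primrec_src (he : Primrec e) : Primrec fun i => (e i).src := by
  unfold REdge.src; fun_prop

@[fun_prop] theorem primrec_tick (he : Primrec e) : Primrec fun i => (e i).tick := by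
  unfold REdge.tick; fun_prop

@[fun_prop] theorem primrec_edgeCond (he : Primrec e) : Primrec fun i => (e i).cond := by
  unfold REdge.cond; fun_prop

@[fun_prop] theorem primrec_reset (he : Primrec e) : Primrec fun i => (e i).reset := by
  unfold REdge.reset; fun_prop

@[fun_prop] theorem primrec_tgt (he : Primrec e) : Primrec fun i => (e i).tgt := by
  unfold REdge.tgt; fun_prop

end

abbrev Sys : Type := List REdge

namespace Sys

/-- The literals that occur in the conditions of the edges. -/
def lits (S : Sys) : List Lit := S.flatMap fun e => e.cond.flatMap fun c => c

/-- Terms such that every inequality that occurs in `S` keeps its truth value as long as the clock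
does not cross one of them. -/
def thresholds (S : Sys) : List LT :=
  S.lits.flatMap fun l => [LT.neg l.2.2.2, LT.add l.2.2.2 (LT.const 1)]

/-- A common multiple of the moduli that occur in `S`. -/
def period (S : Sys) : ℕ := S.lits.foldr (fun l m => (if l.2.1 = 0 then 1 else l.2.1) * m) 1

def targets (S : Sys) : List ℕ := S.map REdge.tgt

/-- An upper bound for the number of sets of states that are reachable from a given state. -/
def bound (S : Sys) : ℕ := 2 ^ (S.length + 1)

/-- The durations from which on the reachability without crossing a threshold is periodic. -/
def preperiod (S : Sys) : ℕ := S.bound * S.period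

/-- The period of the reachability without crossing a threshold. -/
def superperiod (S : Sys) : ℕ := S.bound.factorial * S.period

/-- No threshold lies in `(a, b]`. -/
def Free (S : Sys) (v : ℕ → ℕ) (a b : ℤ) : Prop :=
  ∀ t ∈ S.thresholds, ¬ (a < t.eval v ∧ t.eval v ≤ b)

theorem Free.mono {S : Sys} {v : ℕ → ℕ} {a b a' b' : ℤ} (h : S.Free v a b) (ha : a ≤ a')
    (hb : b' ≤ b) : S.Free v a' b' :=
  fun t ht h' => h t ht ⟨ha.trans_lt h'.1, h'.2.trans hb⟩

theorem period_pos (S : Sys) : 0 < S.period := by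
  unfold period
  induction S.lits with
  | nil => simp
  | cons l L ih =>
    simp only [List.foldr_cons]
    refine Nat.mul_pos ?_ ih
    split_ifs <;> omega

theorem superperiod_pos (S : Sys) : 0 < S.superperiod :=
  Nat.mul_pos (Nat.factorial_pos _) S.period_pos

theorem dvd_period {S : Sys} {l : Lit} (h : l ∈ S.lits) (h0 : l.2.1 ≠ 0) : l.2.1 ∣ S.period := by
  unfold period
  generalize S.lits = L at h ⊢
  induction L with
  | nil => simp at h
  | cons k L ih =>
    simp only [List.foldr_cons]
    rcases List.mem_cons.1 h with rfl | h
    · simp [h0]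
    · exact Dvd.dvd.mul_left (ih h) _

/-- An inequality changes its truth value only at a threshold, and a congruence does not notice
multiples of the period. -/
theorem lit_shift {S : Sys} {l : Lit} (hl : l ∈ S.lits) {v : ℕ → ℕ} {u : ℤ} {K : ℕ}
    (hK : S.period ∣ K) (hF : S.Free v u (u + K)) : l.Holds v u ↔ l.Holds v (u + K) := by
  unfold Lit.Holds
  refine Iff.iff Iff.rfl ?_
  unfold Lit.Atom
  split_ifs with h0
  · have h₁ := hF (LT.neg l.2.2.2) (List.mem_flatMap.2 ⟨l, hl, by simp⟩)
    have h₂ := hF (LT.add l.2.2.2 (LT.const 1)) (List.mem_flatMap.2 ⟨l, hl, by simp⟩)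
    simp only [LT.eval_neg, LT.eval_add, LT.eval_const] at h₁ h₂
    unfold Lit.val
    rcases lt_trichotomy l.2.2.1 0 with h | h | h
    · rw [Int.sign_eq_neg_one_of_neg h]; omega
    · rw [h]; simp
    · rw [Int.sign_eq_one_of_pos h]; omega
  · obtain ⟨k, hk⟩ := (dvd_period hl h0).trans hK
    have e : l.val v (u + K) = l.val v u + (l.2.1 : ℤ) * (l.2.2.1.sign * k) := by
      unfold Lit.val; rw [hk]; push_cast; ring
    rw [e, Int.dvd_add_left (Dvd.intro _ rfl)]

theorem cond_shift {S : Sys} {e : REdge} (he : e ∈ S) {v : ℕ → ℕ} {u : ℤ} {K : ℕ}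
    (hK : S.period ∣ K) (hF : S.Free v u (u + K)) :
    e.cond.Holds v u ↔ e.cond.Holds v (u + K) := by
  unfold DNF.Holds
  refine exists_congr fun c => and_congr_right fun hc => forall₂_congr fun l hl => ?_
  exact lit_shift (List.mem_flatMap.2 ⟨e, he, List.mem_flatMap.2 ⟨c, hc, hl⟩⟩) hK hF

/-! ### Reachability without resets and its periodicity -/

/-- A transition that does not reset the clock. -/
def NStep (S : Sys) (v : ℕ → ℕ) (c c' : ℕ × ℤ) : Prop :=
  ∃ e ∈ S, e.reset = false ∧ e.src = c.1 ∧ e.cond.Holds v c.2 ∧ c' = (e.tgt, c.2 + e.tick)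

/-- Reachability without resetting the clock. -/
def NReach (S : Sys) (v : ℕ → ℕ) : ℕ × ℤ → ℕ × ℤ → Prop := Relation.ReflTransGen (S.NStep v)

variable {S : Sys} {v : ℕ → ℕ}

theorem NStep.le {c c' : ℕ × ℤ} (h : S.NStep v c c') : c.2 ≤ c'.2 ∧ c'.2 ≤ c.2 + 1 := by
  obtain ⟨e, -, -, -, -, rfl⟩ := h
  have := e.tick_le
  dsimp only
  omega

theorem NReach.le {c c' : ℕ × ℤ} (h : S.NReach v c c') : c.2 ≤ c'.2 := by
  induction h with
  | refl => exact le_rfl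
  | tail _ h ih => exact ih.trans h.le.1

theorem NReach.fst_mem {c c' : ℕ × ℤ} (h : S.NReach v c c') : c'.1 = c.1 ∨ c'.1 ∈ S.targets := by
  rcases h.cases_tail with rfl | ⟨d, -, e, he, -, -, -, rfl⟩
  · exact Or.inl rfl
  · exact Or.inr (List.mem_map.2 ⟨e, he, rfl⟩)

/-- A discrete intermediate value theorem: one transition increases the clock by at most one. -/
theorem NReach.split {c c' : ℕ × ℤ} (h : S.NReach v c c') {u : ℤ} (h₁ : c.2 ≤ u) (h₂ : u ≤ c'.2) :
    ∃ a, S.NReach v c (a, u) ∧ S.NReach v (a, u) c' := by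
  induction h with
  | refl =>
    obtain rfl := le_antisymm h₁ h₂
    exact ⟨c.1, .refl, .refl⟩
  | @tail b d hb hd ih =>
    by_cases hu : u ≤ b.2
    · obtain ⟨a, ha, ha'⟩ := ih hu
      exact ⟨a, ha, ha'.tail hd⟩
    · have := hd.le
      obtain rfl : u = d.2 := by omega
      exact ⟨d.1, hb.tail hd, .refl⟩

/-- The same edges can be taken `K` later or earlier, since by `cond_shift` their conditions agree
at both clock values. All values involved lie between `x` and `y + K`. -/
theorem nreach_shift {q p : ℕ} {x y : ℤ} {K : ℕ} (hK : S.period ∣ K) (hF : S.Free v x (y + K)) :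
    S.NReach v (q, x) (p, y) ↔ S.NReach v (q, x + K) (p, y + K) := by
  constructor
  · intro h
    have : ∀ c : ℕ × ℤ, S.NReach v (q, x) c → S.Free v x (c.2 + K) →
        S.NReach v (q, x + K) (c.1, c.2 + K) := by
      intro c h
      induction h with
      | refl => exact fun _ => .refl
      | @tail b d hb hd ih =>
        intro hF
        have hle := hd.le
        refine .tail (ih (hF.mono le_rfl (by omega))) ?_
        obtain ⟨e, he, h₁, h₂, h₃, rfl⟩ := hd
        have h0 := NReach.le hb
        exact ⟨e, he, h₁, h₂, (cond_shift he hK (hF.mono h0 (by simp))).1 h₃, by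
          simp only [Prod.mk.injEq, true_and]; ring⟩
    exact this _ h hF
  · intro h
    have : ∀ c : ℕ × ℤ, S.NReach v (q, x + K) c → S.Free v x c.2 →
        S.NReach v (q, x) (c.1, c.2 - K) := by
      intro c h
      induction h with
      | refl => intro _; rw [add_sub_cancel_right]; exact .refl
      | @tail b d hb hd ih =>
        intro hF
        have hle := hd.le
        refine .tail (ih (hF.mono le_rfl (by omega))) ?_
        obtain ⟨e, he, h₁, h₂, h₃, rfl⟩ := hd
        have h0 := NReach.le hb
        refine ⟨e, he, h₁, h₂, (cond_shift he hK (hF.mono ?_ ?_)).2 (by simpa using h₃), by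
          simp only [Prod.mk.injEq, true_and]; ring⟩
        · dsimp only at h0 ⊢; omega
        · dsimp only at hle ⊢; omega
    simpa using this _ h hF

/-- Let `A i` be the set of states reachable at clock value `x + i L`, where `L` is the period. Two
of these sets coincide, say for `i < j`. What is reachable later depends only on that set, up to a
shift by a multiple of `L`, so from `i L` on reachability has period `(j - i) L`. -/
theorem nreach_periodic {q p : ℕ} {x : ℤ} {n : ℕ} (hn : S.preperiod ≤ n) (k : ℕ)
    (hF : S.Free v x (x + n + (k * S.superperiod : ℕ))) :
    S.NReach v (q, x) (p, x + n) ↔ S.NReach v (q, x) (p, x + n + (k * S.superperiod : ℕ)) := by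
  classical
  set L := S.period with hL
  let st : Finset ℕ := insert q S.targets.toFinset
  let A : ℕ → Finset ℕ := fun i => st.filter fun a => S.NReach v (q, x) (a, x + (i * L : ℕ))
  have hA : ∀ i a, a ∈ A i ↔ S.NReach v (q, x) (a, x + (i * L : ℕ)) := fun i a => by
    simp only [A, Finset.mem_filter, and_iff_right_iff_imp]
    intro h
    simpa [st] using h.fst_mem
  have hcard : st.card ≤ S.length + 1 := (Finset.card_insert_le _ _).trans (by
    have := S.targets.toFinset_card_le
    simp only [targets, List.length_map] at this
    exact Nat.succ_le_succ this)
  -- There are `S.bound + 1` indices, and at most `S.bound` sets of states, as only `q` and the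
  -- targets of edges can occur.
  obtain ⟨i, hi, j, hj, hij, e⟩ := Finset.exists_ne_map_eq_of_card_lt_of_maps_to
    (s := Finset.range (S.bound + 1)) (t := st.powerset) (f := A) (by
      rw [Finset.card_powerset, Finset.card_range]
      exact Nat.lt_succ_of_le (Nat.pow_le_pow_right (by norm_num) hcard))
    (fun i _ => Finset.mem_coe.2 (Finset.mem_powerset.2 (Finset.filter_subset _ _)))
  wlog hlt : i < j generalizing i j
  · exact this j hj i hi hij.symm e.symm (by omega)
  rw [Finset.mem_range] at hi hj
  -- shifting by `(j - i) L`
  obtain ⟨d, rfl⟩ := Nat.exists_eq_add_of_lt hlt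
  have key : ∀ m : ℕ, i * L ≤ m → S.Free v x (x + m + ((d + 1) * L : ℕ)) →
      (S.NReach v (q, x) (p, x + m) ↔ S.NReach v (q, x) (p, x + m + ((d + 1) * L : ℕ))) := by
    intro m hm hF
    have hsh : ∀ a, S.NReach v (a, x + (i * L : ℕ)) (p, x + m) ↔
        S.NReach v (a, x + ((i + d + 1) * L : ℕ)) (p, x + m + ((d + 1) * L : ℕ)) := fun a => by
      rw [nreach_shift (K := (d + 1) * L) (Dvd.intro_left _ rfl)
        (hF.mono (by omega) le_rfl)]
      rw [show x + ((i * L : ℕ) : ℤ) + ((d + 1) * L : ℕ) = x + ((i + d + 1) * L : ℕ) by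
        push_cast; ring]
    constructor
    · intro h
      obtain ⟨a, h₁, h₂⟩ := h.split (u := x + (i * L : ℕ)) (by dsimp only; omega) (by dsimp only; omega)
      rw [← hA, e, hA] at h₁
      exact h₁.trans ((hsh a).1 h₂)
    · intro h
      have hle : ((i + d + 1) * L : ℕ) ≤ m + (d + 1) * L := by nlinarith
      obtain ⟨a, h₁, h₂⟩ := h.split (u := x + ((i + d + 1) * L : ℕ)) (by dsimp only; omega)
        (by dsimp only; omega)
      rw [← hA, ← e, hA] at h₁
      exact h₁.trans ((hsh a).2 h₂)
  have key' : ∀ r : ℕ, S.Free v x (x + n + (r * ((d + 1) * L) : ℕ)) →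
      (S.NReach v (q, x) (p, x + n) ↔ S.NReach v (q, x) (p, x + n + (r * ((d + 1) * L) : ℕ))) := by
    intro r
    induction r with
    | zero => intro _; simp
    | succ r ih =>
      intro hF
      have e' : x + (n : ℤ) + (((r + 1) * ((d + 1) * L) : ℕ) : ℤ) =
        x + ((n + r * ((d + 1) * L) : ℕ) : ℤ) + (((d + 1) * L : ℕ) : ℤ) := by push_cast; ring
      have e'' : x + ((n + r * ((d + 1) * L) : ℕ) : ℤ) =
        x + n + ((r * ((d + 1) * L) : ℕ) : ℤ) := by push_cast; ring
      rw [e'] at hF ⊢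
      rw [ih (hF.mono le_rfl (by rw [e'']; omega)), ← key _ ?_ hF, e'']
      have : i * L ≤ S.preperiod := Nat.mul_le_mul (by omega) le_rfl
      omega
  -- The gap between the two indices depends on the valuation and is not known in advance; the
  -- factorial is a multiple of every possible gap.
  obtain ⟨r, hr⟩ : d + 1 ∣ S.bound.factorial := Nat.dvd_factorial (by omega) (by omega)
  have e' : k * S.superperiod = k * r * ((d + 1) * L) := by
    rw [superperiod, hr, hL]; ring
  rw [e'] at hF ⊢
  exact key' _ hF

end Sys

section

variable {ι : Type*} [Primcodable ι] {S : ι → Sys}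

@[fun_prop] theorem primrec_lits (hS : Primrec S) : Primrec fun i => (S i).lits := by
  unfold Sys.lits; fun_prop

@[fun_prop] theorem primrec_thresholds (hS : Primrec S) : Primrec fun i => (S i).thresholds := by
  unfold Sys.thresholds; fun_prop

@[fun_prop] theorem primrec_period (hS : Primrec S) : Primrec fun i => (S i).period := by
  unfold Sys.period; fun_prop

@[fun_prop] theorem primrec_targets (hS : Primrec S) : Primrec fun i => (S i).targets := by
  unfold Sys.targets; fun_prop

@[fun_prop] theorem primrec_bound (hS : Primrec S) : Primrec fun i => (S i).bound := by
  unfold Sys.bound; fun_prop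

@[fun_prop] theorem primrec_preperiod (hS : Primrec S) : Primrec fun i => (S i).preperiod := by
  unfold Sys.preperiod; fun_prop

@[fun_prop] theorem primrec_superperiod (hS : Primrec S) :
    Primrec fun i => (S i).superperiod := by
  unfold Sys.superperiod; fun_prop

end

/-! ### Paths without resets, cut at the thresholds -/

namespace Sys

variable {S : Sys} {v : ℕ → ℕ}

/-- Reachability within constant time as reachability in a finite graph of states and offsets. -/
theorem nreach_const_iff {q p n : ℕ} {x : ℤ} : S.NReach v (q, x) (p, x + n) ↔
    Relation.ReflTransGen (fun c d : ℕ × ℕ =>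
      d ∈ (S.targets.flatMap fun a => (List.range (n + 1)).map fun k => (a, k)) ∧
      ∃ e ∈ S, e.reset = false ∧ e.src = c.1 ∧ e.cond.Holds v (x + c.2) ∧
        d = (e.tgt, c.2 + e.tick)) (q, 0) (p, n) := by
  constructor
  · intro h
    have : ∀ c : ℕ × ℤ, S.NReach v (q, x) c → ∀ m : ℕ, c.2 = x + m → m ≤ n →
        Relation.ReflTransGen (fun c d : ℕ × ℕ =>
          d ∈ (S.targets.flatMap fun a => (List.range (n + 1)).map fun k => (a, k)) ∧
          ∃ e ∈ S, e.reset = false ∧ e.src = c.1 ∧ e.cond.Holds v (x + c.2) ∧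
            d = (e.tgt, c.2 + e.tick)) (q, 0) (c.1, m) := by
      intro c h
      induction h with
      | refl =>
        intro m hm _
        obtain rfl : m = 0 := by simpa using hm
        exact .refl
      | @tail b d hb hd ih =>
        intro m hm hmn
        have hle := hd.le
        have h0 := NReach.le hb
        dsimp only at h0
        obtain ⟨k, hk⟩ : ∃ k : ℕ, b.2 = x + k := ⟨(b.2 - x).toNat, by omega⟩
        obtain ⟨e, he, h₁, h₂, h₃, rfl⟩ := hd
        dsimp only at hm hle
        obtain rfl : m = k + e.tick := by omega
        refine .tail (ih k hk (by omega)) ⟨?_, e, he, h₁, h₂, hk ▸ h₃, rfl⟩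
        simp only [List.mem_flatMap, List.mem_map, List.mem_range]
        exact ⟨e.tgt, List.mem_map.2 ⟨e, he, rfl⟩, _, by omega, rfl⟩
    exact this _ h n rfl le_rfl
  · intro h
    have : ∀ c d : ℕ × ℕ, (d ∈ (S.targets.flatMap fun a => (List.range (n + 1)).map
        fun k => (a, k)) ∧ ∃ e ∈ S, e.reset = false ∧ e.src = c.1 ∧ e.cond.Holds v (x + c.2) ∧
        d = (e.tgt, c.2 + e.tick)) → S.NStep v (c.1, x + c.2) (d.1, x + d.2) := by
      rintro c d ⟨-, e, he, h₁, h₂, h₃, rfl⟩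
      exact ⟨e, he, h₁, h₂, h₃, by simp only [Prod.mk.injEq, true_and]; push_cast; ring⟩
    have := h.lift (p := S.NStep v) (fun c : ℕ × ℕ => ((c.1, x + c.2) : ℕ × ℤ)) this
    simpa [Function.onFun, NReach] using this

/-- Reachability within a short time, or within a long time without crossing a threshold. -/
def Link (S : Sys) (v : ℕ → ℕ) (c d : ℕ × ℤ) : Prop :=
  ∃ n < S.preperiod + S.superperiod, S.NReach v c (d.1, c.2 + n) ∧
    (d.2 = c.2 + n ∨ (S.preperiod ≤ n ∧ (S.superperiod : ℤ) ∣ d.2 - (c.2 + n) ∧ c.2 + n ≤ d.2 ∧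
      S.Free v c.2 d.2))

/-- In the second alternative, periodicity extends the path of duration `n` to one with the
prescribed end. -/
theorem Link.nreach {c d : ℕ × ℤ} (h : S.Link v c d) : S.NReach v c d := by
  obtain ⟨n, -, h, h' | ⟨hn, ⟨k, hk⟩, hle, hF⟩⟩ := h
  · rwa [← h'] at h
  · have hP := S.superperiod_pos
    obtain ⟨k, rfl⟩ : ∃ m : ℕ, k = m := ⟨k.toNat, by
      have : 0 ≤ k := nonneg_of_mul_nonneg_right (by omega : 0 ≤ (S.superperiod : ℤ) * k)
        (by omega)
      omega⟩
    have e : d.2 = c.2 + n + (k * S.superperiod : ℕ) := by push_cast; linarith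
    rw [e] at hF
    have := (nreach_periodic hn k hF).1 h
    rwa [← e] at this

theorem NReach.link {c d : ℕ × ℤ} (h : S.NReach v c d) (hF : S.Free v c.2 d.2) :
    S.Link v c d := by
  have hle := h.le
  obtain ⟨m, hm⟩ : ∃ m : ℕ, d.2 = c.2 + m := ⟨(d.2 - c.2).toNat, by omega⟩
  by_cases hlt : m < S.preperiod + S.superperiod
  · exact ⟨m, hlt, by rwa [← hm], Or.inl hm⟩
  · set P := S.superperiod with hP
    have h0 : 0 < P := S.superperiod_pos
    -- A long duration is reduced modulo the superperiod to one in `[preperiod, preperiod +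
    -- superperiod)`.
    have e : m = S.preperiod + (m - S.preperiod) % P + (m - S.preperiod) / P * P := by
      have := Nat.mod_add_div' (m - S.preperiod) P
      omega
    set n := S.preperiod + (m - S.preperiod) % P with hn
    have e' : d.2 = c.2 + n + ((m - S.preperiod) / P * P : ℕ) := by
      rw [hm]; omega
    refine ⟨n, ?_, ?_, Or.inr ⟨by omega, ?_, by omega, hF⟩⟩
    · have := Nat.mod_lt (m - S.preperiod) h0; omega
    · rw [e'] at hF
      refine (nreach_periodic (by omega) _ hF).2 ?_
      rwa [← hP, ← e']
    · rw [e']; exact ⟨((m - S.preperiod) / P : ℕ), by push_cast; ring⟩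

/-- The key clock values on the way to `y`. -/
def IsKey (S : Sys) (v : ℕ → ℕ) (y u : ℤ) : Prop :=
  u = y ∨ ∃ t ∈ S.thresholds, u = t.eval v ∨ u = t.eval v - 1

/-- A path that crosses no threshold is a single link. Otherwise it is cut at `t - 1` and `t` for a
crossed threshold `t`: the step in between is a link of duration one, and both remaining parts are
shorter. The intermediate clock values come from a finite list of terms that does not depend on the
path. -/
theorem NReach.links {c d : ℕ × ℤ} (h : S.NReach v c d) :
    Relation.ReflTransGen (fun a b => S.IsKey v d.2 b.2 ∧ b.1 ∈ c.1 :: S.targets ∧ S.Link v a b)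
      c d := by
  induction hm : (d.2 - c.2).toNat using Nat.strong_induction_on generalizing c d with
  | _ m ih =>
    by_cases hF : S.Free v c.2 d.2
    · exact .single ⟨Or.inl rfl, List.mem_cons.2 h.fst_mem, h.link hF⟩
    · simp only [Free, not_forall, not_not] at hF
      obtain ⟨t, ht, h₁, h₂⟩ := hF
      obtain ⟨a, ha, ha'⟩ := h.split (u := t.eval v - 1) (by omega) (by omega)
      obtain ⟨b, hb, hb'⟩ := ha'.split (u := t.eval v) (by dsimp only; omega) h₂
      have i₁ := ih _ (by dsimp only; omega) ha rfl
      have i₃ := ih _ (by dsimp only; omega) hb' rfl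
      have hab : S.Link v (a, t.eval v - 1) (b, t.eval v) := by
        refine ⟨1, ?_, by simpa using hb, Or.inl (by simp)⟩
        have := S.superperiod_pos
        have : 0 < S.preperiod := Nat.mul_pos (by simp [bound]) S.period_pos
        omega
      have hb0 : b ∈ c.1 :: S.targets := List.mem_cons.2 (NReach.fst_mem (ha.trans hb))
      refine (Relation.ReflTransGen.mono ?_ _ _ i₁).trans
        (.head ⟨Or.inr ⟨t, ht, Or.inl rfl⟩, hb0, hab⟩ (Relation.ReflTransGen.mono ?_ _ _ i₃))
      · rintro e e' ⟨hk | hk, he, hl⟩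
        · exact ⟨Or.inr ⟨t, ht, Or.inr hk⟩, he, hl⟩
        · exact ⟨Or.inr hk, he, hl⟩
      · rintro e e' ⟨hk, he, hl⟩
        refine ⟨hk, ?_, hl⟩
        rcases List.mem_cons.1 he with he | he
        · exact he ▸ hb0
        · exact List.mem_cons_of_mem _ he

end Sys

/-! ### Definability of reachability without resets -/

namespace Eff

theorem free : Eff fun (i : Sys × Pos × Pos) x v =>
    i.1.Free v (i.2.1.eval v x) (i.2.2.eval v x) := by
  unfold Sys.Free
  refine (all (l := fun i : Sys × Pos × Pos => i.1.thresholds)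
    (P := fun i t x v => ¬ (i.2.1.eval v x < (Pos.ofTerm t).eval v x ∧
      (Pos.ofTerm t).eval v x ≤ i.2.2.eval v x)) (by fun_prop) ?_).congr
    fun i x v => by simp only [Pos.eval_ofTerm]
  exact ((posLt (by fun_prop) (by fun_prop)).and (posLe (by fun_prop) (by fun_prop))).not

/-- The duration is part of the index and not a function of the valuation, so the graph of states
and offsets is finite. -/
theorem nreach_const : Eff fun (i : Sys × ℕ × ℕ × ℕ) x v =>
    i.1.NReach v (i.2.1, x) (i.2.2.1, x + i.2.2.2) := by
  have hl : Eff fun (q : (Sys × ℕ × ℕ × ℕ) × (ℕ × ℕ) × (ℕ × ℕ)) x v =>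
      ∃ e ∈ q.1.1, e.reset = false ∧ e.src = q.2.1.1 ∧
        e.cond.Holds v (x + q.2.1.2) ∧ q.2.2 = (e.tgt, q.2.1.2 + e.tick) := by
    refine ex (by fun_prop) (and (const (by fun_prop)) (and (const (by fun_prop))
      (and ?_ (const (by fun_prop)))))
    exact (subst (holds (F := fun q : ((Sys × ℕ × ℕ × ℕ) × (ℕ × ℕ) × ℕ × ℕ) × REdge => q.2.cond)
      (by fun_prop)) (Y := fun q => Pos.clock.shift q.1.2.1.2) (by fun_prop)).congr
      fun q x v => by simp
  have h := reach (ι := Sys × ℕ × ℕ × ℕ) (β := ℕ × ℕ)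
    (N := fun i => i.1.targets.flatMap fun a => (List.range (i.2.2.2 + 1)).map fun k => (a, k))
    (by fun_prop) (link := fun i c d x v => ∃ e ∈ i.1, e.reset = false ∧ e.src = c.1 ∧
      e.cond.Holds v (x + c.2) ∧ d = (e.tgt, c.2 + e.tick)) hl
  have hf : Primrec fun i : Sys × ℕ × ℕ × ℕ => (i, (i.2.1, 0), (i.2.2.1, i.2.2.2)) := by fun_prop
  refine (h.comp hf).congr fun i x v => ?_
  exact Sys.nreach_const_iff.symm

theorem link : Eff fun (i : Sys × (ℕ × Pos) × (ℕ × Pos)) x v =>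
    i.1.Link v (i.2.1.1, i.2.1.2.eval v x) (i.2.2.1, i.2.2.2.eval v x) := by
  unfold Sys.Link
  refine ex_lt (by fun_prop) (and ?_ (or ?_ (and (const (by fun_prop)) (and ?_ (and ?_ ?_)))))
  · exact subst (nreach_const.comp (f := fun q : (Sys × (ℕ × Pos) × (ℕ × Pos)) × ℕ =>
      (q.1.1, q.1.2.1.1, q.1.2.2.1, q.2)) (by fun_prop)) (Y := fun q => q.1.2.1.2) (by fun_prop)
  · exact (posEq (Y := fun q : (Sys × (ℕ × Pos) × (ℕ × Pos)) × ℕ => q.1.2.2.2)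
      (Z := fun q => q.1.2.1.2.shift q.2) (by fun_prop) (by fun_prop)).congr
      fun q x v => by simp
  · exact (posDvd (m := fun q : (Sys × (ℕ × Pos) × (ℕ × Pos)) × ℕ => q.1.1.superperiod)
      (Z := fun q => q.1.2.2.2) (Y := fun q => q.1.2.1.2.shift q.2) (by fun_prop)
      (fun q => q.1.1.superperiod_pos) (by fun_prop) (by fun_prop)).congr
      fun q x v => by simp
  · exact (posLe (Z := fun q : (Sys × (ℕ × Pos) × (ℕ × Pos)) × ℕ => q.1.2.2.2)
      (Y := fun q => q.1.2.1.2.shift q.2) (by fun_prop) (by fun_prop)).congr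
      fun q x v => by simp
  · exact free.comp (f := fun q : (Sys × (ℕ × Pos) × (ℕ × Pos)) × ℕ =>
      (q.1.1, q.1.2.1.2, q.1.2.2.2)) (by fun_prop)

end Eff

namespace Sys

/-- Syntactic nodes for the key clock values on the way to `Y`. -/
def keyNodes (S : Sys) (p : ℕ) (Y : Pos) : List (ℕ × Pos) :=
  (p :: S.targets).flatMap fun a =>
    (Y :: S.thresholds.flatMap fun t => [Pos.ofTerm t, (Pos.ofTerm t).shift (-1)]).map
      fun Z => (a, Z)

/-- Clock values are replaced by terms that denote them. Different terms may have the same value, so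
the last node only has to agree with `m` in state and value; `n` is added for the empty path. -/
theorem nreach_iff_links (S : Sys) (v : ℕ → ℕ) (x : ℤ) (n m : ℕ × Pos) :
    S.NReach v (n.1, n.2.eval v x) (m.1, m.2.eval v x) ↔
      ∃ m' ∈ n :: S.keyNodes n.1 m.2, (m'.1 = m.1 ∧ m'.2.eval v x = m.2.eval v x) ∧
        Relation.ReflTransGen (fun c d : ℕ × Pos => d ∈ S.keyNodes n.1 m.2 ∧
          S.Link v (c.1, c.2.eval v x) (d.1, d.2.eval v x)) n m' := by
  constructor
  · intro h
    have : ∀ d, Relation.ReflTransGen (fun a b : ℕ × ℤ => S.IsKey v (m.2.eval v x) b.2 ∧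
        b.1 ∈ n.1 :: S.targets ∧ S.Link v a b) (n.1, n.2.eval v x) d →
        ∃ m' ∈ n :: S.keyNodes n.1 m.2, d = (m'.1, m'.2.eval v x) ∧
        Relation.ReflTransGen (fun c d : ℕ × Pos => d ∈ S.keyNodes n.1 m.2 ∧
          S.Link v (c.1, c.2.eval v x) (d.1, d.2.eval v x)) n m' := by
      intro d hd
      induction hd with
      | refl => exact ⟨n, by simp, rfl, .refl⟩
      | @tail b d _ h ih =>
        obtain ⟨m', -, rfl, hr⟩ := ih
        obtain ⟨hk, hb, hl⟩ := h
        obtain ⟨Z, hZ, hZd⟩ : ∃ Z ∈ m.2 :: S.thresholds.flatMap fun t =>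
            [Pos.ofTerm t, (Pos.ofTerm t).shift (-1)], d.2 = Z.eval v x := by
          rcases hk with hk | ⟨t, ht, hk | hk⟩
          · exact ⟨m.2, by simp, hk⟩
          · exact ⟨Pos.ofTerm t, List.mem_cons_of_mem _ (List.mem_flatMap.2 ⟨t, ht, by simp⟩),
              by simp [hk]⟩
          · exact ⟨(Pos.ofTerm t).shift (-1),
              List.mem_cons_of_mem _ (List.mem_flatMap.2 ⟨t, ht, by simp⟩), by simp [hk]; ring⟩
        have hmem : (d.1, Z) ∈ S.keyNodes n.1 m.2 :=
          List.mem_flatMap.2 ⟨d.1, hb, List.mem_map.2 ⟨Z, hZ, rfl⟩⟩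
        have hd : d = (d.1, Z.eval v x) := by rw [← hZd]
        exact ⟨(d.1, Z), List.mem_cons_of_mem _ hmem, hd, hr.tail ⟨hmem, by rwa [← hd]⟩⟩
    obtain ⟨m', hm', e, hr⟩ := this _ h.links
    simp only [Prod.mk.injEq] at e
    exact ⟨m', hm', ⟨e.1.symm, e.2.symm⟩, hr⟩
  · rintro ⟨m', -, ⟨e₁, e₂⟩, h⟩
    have := h.lift (p := S.NReach v)
      (fun c : ℕ × Pos => ((c.1, c.2.eval v x) : ℕ × ℤ)) (fun c d h => h.2.nreach)
    rw [← e₁, ← e₂]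
    unfold NReach at this
    rwa [Relation.reflTransGen_eq_self] at this

end Sys

@[fun_prop] theorem primrec_keyNodes {ι : Type*} [Primcodable ι] {S : ι → Sys} {p : ι → ℕ}
    {Y : ι → Pos} (hS : Primrec S) (hp : Primrec p) (hY : Primrec Y) :
    Primrec fun i => (S i).keyNodes (p i) (Y i) := by unfold Sys.keyNodes; fun_prop

theorem Eff.nreach : Eff fun (i : Sys × (ℕ × Pos) × (ℕ × Pos)) x v =>
    i.1.NReach v (i.2.1.1, i.2.1.2.eval v x) (i.2.2.1, i.2.2.2.eval v x) := by
  simp only [Sys.nreach_iff_links]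
  refine ex (by fun_prop) (and (and (const (by fun_prop)) (posEq (by fun_prop) (by fun_prop))) ?_)
  exact (reach (ι := Sys × ℕ × Pos) (N := fun i => i.1.keyNodes i.2.1 i.2.2) (by fun_prop)
    (link := fun i c d x v => i.1.Link v (c.1, c.2.eval v x) (d.1, d.2.eval v x))
    (link.comp (f := fun q : (Sys × ℕ × Pos) × (ℕ × Pos) × (ℕ × Pos) => (q.1.1, q.2))
      (by fun_prop))).comp
    (f := fun q : (Sys × (ℕ × Pos) × (ℕ × Pos)) × (ℕ × Pos) =>
      ((q.1.1, q.1.2.1.1, q.1.2.2.2), q.1.2.1, q.2)) (by fun_prop)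

/-! ### Laps between resets, and their normalization -/

namespace Sys

variable {S : Sys} {v : ℕ → ℕ}

/-- From `c`, the clock is not reset until it is reset by the edge `e` at clock value `y`. -/
def Lap (S : Sys) (v : ℕ → ℕ) (c : ℕ × ℤ) (y : ℤ) (e : REdge) : Prop :=
  e ∈ S ∧ e.reset = true ∧ S.NReach v c (e.src, y) ∧ e.cond.Holds v y

/-- A path from `c` of duration `D` the last transition of which resets the clock and leads
to `p`. -/
inductive RPath (S : Sys) (v : ℕ → ℕ) : ℕ × ℤ → ℤ → ℕ → Prop
  | last {c : ℕ × ℤ} {y : ℤ} {e : REdge} (h : S.Lap v c y e) :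
    RPath S v c (y - c.2 + e.tick) e.tgt
  | cons {c : ℕ × ℤ} {y : ℤ} {e : REdge} {D : ℤ} {p : ℕ} (h : S.Lap v c y e)
    (h' : RPath S v (e.tgt, 0) D p) : RPath S v c (y - c.2 + e.tick + D) p

theorem RPath.trans {c : ℕ × ℤ} {D D' : ℤ} {p p' : ℕ} (h : S.RPath v c D p)
    (h' : S.RPath v (p, 0) D' p') : S.RPath v c (D + D') p' := by
  induction h with
  | last h => exact .cons h h'
  | cons h _ ih => rw [add_assoc]; exact .cons h (ih h')

theorem RPath.nonneg {c : ℕ × ℤ} {D : ℤ} {p : ℕ} (h : S.RPath v c D p) : 0 ≤ D := by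
  induction h with
  | last h => have := h.2.2.1.le; dsimp only at this; omega
  | cons h _ ih => have := h.2.2.1.le; dsimp only at this; omega

/-- Clock values from which on the lap starting at clock value `z` can be prolonged
indefinitely. -/
def Pump (S : Sys) (v : ℕ → ℕ) (z y : ℤ) : Prop :=
  z + S.preperiod ≤ y ∧ ∀ t ∈ S.thresholds, t.eval v + S.preperiod ≤ y

/-- Periodicity is applied only to the last stretch, of length `S.preperiod`, before the reset. The
path up to there is kept, so earlier thresholds do no harm. -/
theorem Lap.shift {c : ℕ × ℤ} {y : ℤ} {e : REdge} (h : c.2 + S.preperiod ≤ y) {k : ℕ}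
    (hF : S.Free v (y - S.preperiod) (y + (k * S.superperiod : ℕ))) :
    S.Lap v c y e ↔ S.Lap v c (y + (k * S.superperiod : ℕ)) e := by
  have key : ∀ a, S.NReach v (a, y - S.preperiod) (e.src, y) ↔
      S.NReach v (a, y - S.preperiod) (e.src, y + (k * S.superperiod : ℕ)) := fun a => by
    have := nreach_periodic (S := S) (v := v) (q := a) (p := e.src) (x := y - S.preperiod)
      (n := S.preperiod) le_rfl k (by rwa [sub_add_cancel])
    rwa [sub_add_cancel] at this
  unfold Lap
  refine and_congr_right fun he => and_congr_right fun _ => and_congr ?_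
    (cond_shift he (Dvd.dvd.mul_left (Dvd.intro_left _ rfl) k)
      (hF.mono (by omega) le_rfl))
  constructor
  · intro h'
    obtain ⟨a, h₁, h₂⟩ := h'.split (u := y - S.preperiod) (by omega) (by dsimp only; omega)
    exact h₁.trans ((key a).1 h₂)
  · intro h'
    obtain ⟨a, h₁, h₂⟩ := h'.split (u := y - S.preperiod) (by omega) (by dsimp only; omega)
    exact h₁.trans ((key a).2 h₂)

/-- The last stretch lies beyond all thresholds, so any number of superperiods can be inserted. -/
theorem Lap.pump {c : ℕ × ℤ} {y : ℤ} {e : REdge} (h : S.Lap v c y e) (hp : S.Pump v c.2 y)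
    (m : ℤ) : ∃ y', m ≤ y' ∧ S.Lap v c y' e := by
  have hP := S.superperiod_pos
  refine ⟨y + ((m - y).toNat * S.superperiod : ℕ), ?_, (Lap.shift hp.1 fun t ht => ?_).1 h⟩
  · have : (m - y).toNat ≤ (m - y).toNat * S.superperiod := Nat.le_mul_of_pos_right _ hP
    omega
  · have := hp.2 t ht
    omega

/-- The value `z` and the thresholds. -/
def IsBase (S : Sys) (v : ℕ → ℕ) (z κ : ℤ) : Prop := κ = z ∨ ∃ t ∈ S.thresholds, κ = t.eval v

def maxOffset (S : Sys) : ℕ := S.preperiod + S.superperiod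

/-- The values that are near to `z` or to a threshold. -/
def IsCand (S : Sys) (v : ℕ → ℕ) (z y : ℤ) : Prop :=
  ∃ κ, S.IsBase v z κ ∧ |y - κ| ≤ S.maxOffset

/-- While `y` is far above the start of the lap and above every threshold below it, one superperiod
can be subtracted. Then no threshold is crossed downwards, so a value that can be pumped stays one.
-/
theorem Lap.exists_cand_le {c : ℕ × ℤ} {y : ℤ} {e : REdge} (h : S.Lap v c y e) :
    ∃ y' ≤ y, S.IsCand v c.2 y' ∧ S.Lap v c y' e ∧ (S.Pump v c.2 y → S.Pump v c.2 y') := by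
  have hP := S.superperiod_pos
  induction hm : (y - c.2).toNat using Nat.strong_induction_on generalizing y with
  | _ m ih =>
    by_cases hc : S.IsCand v c.2 y
    · exact ⟨y, le_rfl, hc, h, id⟩
    have hb : ∀ κ, S.IsBase v c.2 κ → κ ≤ y → κ + S.preperiod + S.superperiod < y := by
      intro κ hκ hle
      by_contra hlt
      refine hc ⟨κ, hκ, abs_le.2 ⟨?_, ?_⟩⟩ <;> simp only [maxOffset] <;> push_cast <;> omega
    have h0 := hb c.2 (Or.inl rfl) h.2.2.1.le
    have ht : ∀ t ∈ S.thresholds, t.eval v ≤ y →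
        t.eval v + S.preperiod + S.superperiod < y := fun t ht =>
      hb _ (Or.inr ⟨t, ht, rfl⟩)
    have hl : S.Lap v c (y - S.superperiod) e := by
      refine (Lap.shift (k := 1) (by omega) ?_).2 (by simpa using h)
      intro t ht' ⟨h₁, h₂⟩
      have := ht t ht' (by simpa using h₂)
      omega
    obtain ⟨y', hle, hc', hl', hp⟩ := ih _ (by omega) hl rfl
    refine ⟨y', by omega, hc', hl', fun hp' => hp ⟨by omega, fun t ht' => ?_⟩⟩
    have := hp'.2 t ht'
    have := ht t ht' (by omega)
    omega

/-- Below some threshold `t`, superperiods are added until `y` comes near to a base value; since `y`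
is still far below `t` before each addition, it cannot jump over `t`. If no threshold is left above,
a value that is not near to any base value can be pumped, and it is lowered by `Lap.exists_cand_le`.
-/
theorem Lap.exists_cand_ge {c : ℕ × ℤ} {y : ℤ} {e : REdge} (h : S.Lap v c y e) :
    ∃ y', S.IsCand v c.2 y' ∧ S.Lap v c y' e ∧ (y ≤ y' ∨ S.Pump v c.2 y') := by
  have hP := S.superperiod_pos
  by_cases ht : ∃ t ∈ S.thresholds, y < t.eval v
  · obtain ⟨t, ht, hlt⟩ := ht
    induction hm : (t.eval v - y).toNat using Nat.strong_induction_on generalizing y with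
    | _ m ih =>
      by_cases hc : S.IsCand v c.2 y
      · exact ⟨y, hc, h, Or.inl le_rfl⟩
      have hb : ∀ κ, S.IsBase v c.2 κ → κ + S.maxOffset < y ∨ y + S.maxOffset < κ := by
        intro κ hκ
        by_contra hlt
        exact hc ⟨κ, hκ, abs_le.2 ⟨by omega, by omega⟩⟩
      have hle := h.2.2.1.le
      have h0 := hb c.2 (Or.inl rfl)
      simp only [maxOffset] at hb h0
      push_cast at hb h0
      dsimp only at hle
      have hl : S.Lap v c (y + S.superperiod) e := by
        have := (Lap.shift (S := S) (v := v) (c := c) (e := e) (y := y) (k := 1) (by omega) ?_).1 h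
        · simpa using this
        · intro t ht' ⟨h₁, h₂⟩
          have := hb _ (Or.inr ⟨t, ht', rfl⟩)
          simp only [one_mul] at h₂
          omega
      have := hb _ (Or.inr ⟨t, ht, rfl⟩)
      obtain ⟨y', hc', hl', h'⟩ := ih _ (by omega) hl (by omega) rfl
      exact ⟨y', hc', hl', h'.imp_left (by omega)⟩
  · push Not at ht
    by_cases hc : S.IsCand v c.2 y
    · exact ⟨y, hc, h, Or.inl le_rfl⟩
    obtain ⟨y', -, hc', hl', hp⟩ := h.exists_cand_le
    refine ⟨y', hc', hl', Or.inr (hp ?_)⟩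
    have hb : ∀ κ, S.IsBase v c.2 κ → κ ≤ y → κ + S.maxOffset < y := by
      intro κ hκ hle
      by_contra hlt
      exact hc ⟨κ, hκ, abs_le.2 ⟨by omega, by omega⟩⟩
    simp only [maxOffset] at hb
    push_cast at hb
    refine ⟨?_, fun t ht' => ?_⟩
    · have := hb c.2 (Or.inl rfl) h.2.2.1.le; omega
    · have := hb _ (Or.inr ⟨t, ht', rfl⟩) (ht t ht'); omega

/-- Syntactic versions of the values that are near to `X` or to a threshold. -/
def cands (S : Sys) (X : Pos) : List Pos :=
  (X :: S.thresholds.map Pos.ofTerm).flatMap fun Y =>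
    (List.range (2 * S.maxOffset + 1)).map fun k : ℕ => Y.shift ((k : ℤ) - (S.maxOffset : ℤ))

theorem IsCand.exists_cands {x : ℤ} {X : Pos} {y : ℤ} (h : S.IsCand v (X.eval v x) y) :
    ∃ Y ∈ S.cands X, Y.eval v x = y := by
  obtain ⟨κ, hκ, hj⟩ := h
  obtain ⟨Y, hY, rfl⟩ : ∃ Y ∈ X :: S.thresholds.map Pos.ofTerm, κ = Y.eval v x := by
    rcases hκ with rfl | ⟨t, ht, rfl⟩
    · exact ⟨X, by simp, rfl⟩
    · exact ⟨Pos.ofTerm t, List.mem_cons_of_mem _ (List.mem_map.2 ⟨t, ht, rfl⟩), by simp⟩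
  rw [abs_le] at hj
  refine ⟨Y.shift (y - Y.eval v x), List.mem_flatMap.2 ⟨Y, hY, List.mem_map.2
    ⟨(y - Y.eval v x + S.maxOffset).toNat, List.mem_range.2 (by omega), ?_⟩⟩, by simp⟩
  congr 1
  omega

/-- Laps that start after a reset end at values of terms without the clock, so their durations do
not depend on the initial clock value. -/
theorem fst_eq_false_of_mem_cands {α : LT} {Y : Pos} (h : Y ∈ S.cands (Pos.ofTerm α)) :
    Y.1 = false := by
  obtain ⟨Z, hZ, h⟩ := List.mem_flatMap.1 h
  obtain ⟨k, -, rfl⟩ := List.mem_map.1 h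
  rcases List.mem_cons.1 hZ with rfl | hZ
  · rfl
  · obtain ⟨t, -, rfl⟩ := List.mem_map.1 hZ
    rfl

/-- Syntactic laps: the term for the clock value before the reset and the resetting edge. -/
abbrev LNode : Type := Pos × REdge

def zeroPos : Pos := Pos.ofTerm (LT.const 0)

def lapNodes (S : Sys) (X : Pos) : List LNode := (S.cands X).flatMap fun Y => S.map fun e => (Y, e)

theorem mem_lapNodes {X : Pos} {n : LNode} : n ∈ S.lapNodes X ↔ n.1 ∈ S.cands X ∧ n.2 ∈ S := by
  rcases n with ⟨Y, e⟩
  simp only [lapNodes, List.mem_flatMap, List.mem_map, Prod.mk.injEq]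
  grind

/-- Of the first lap only the state after its reset matters, as the clock restarts from zero. -/
def LapLink (S : Sys) (v : ℕ → ℕ) (x : ℤ) (n m : LNode) : Prop :=
  S.Lap v (n.2.tgt, 0) (m.1.eval v x) m.2

/-- The duration of a lap that starts at clock value `0`. -/
def lapTerm (n : LNode) : LT := LT.add n.1.2 (LT.const n.2.tick)

def lapWeight (v : ℕ → ℕ) (n : LNode) : ℤ := (lapTerm n).eval v

theorem lapWeight_eq {n : LNode} (h : n ∈ S.lapNodes zeroPos) (x : ℤ) :
    lapWeight v n = n.1.eval v x - 0 + n.2.tick := by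
  have := fst_eq_false_of_mem_cands (mem_lapNodes.1 h).1
  simp [lapWeight, lapTerm, Pos.eval, this]

/-- A term in the list of nodes may have a negative value, but on a walk it is the final clock value
of an actual lap that starts at zero. -/
theorem lapWeight_nonneg {x : ℤ} {n : LNode} {a b : LNode} {l : List LNode}
    (h : Walk (S.LapLink v x) a l b) (hl : l ⊆ S.lapNodes zeroPos) (hn : n ∈ l) :
    0 ≤ lapWeight v n := by
  obtain ⟨l₁, l₂, -, h₁, -⟩ := walk_of_mem h hn
  obtain ⟨d, -, h₂, -⟩ := walk_append.1 h₁
  have := h₂.2.2.1.le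
  dsimp only at this
  rw [lapWeight_eq (hl hn) x]
  omega

theorem rpath_of_walk {x : ℤ} {c : ℕ × ℤ} {f b : LNode} {l : List LNode}
    (hf : S.Lap v c (f.1.eval v x) f.2) (h : Walk (S.LapLink v x) f l b)
    (hl : l ⊆ S.lapNodes zeroPos) :
    S.RPath v c (f.1.eval v x - c.2 + f.2.tick + (l.map (lapWeight v)).sum) b.2.tgt := by
  induction l generalizing c f with
  | nil => cases h; simpa using RPath.last hf
  | cons d l ih =>
    rw [List.cons_subset] at hl
    have := RPath.cons hf (ih h.1 h.2 hl.2)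
    rwa [← lapWeight_eq hl.1 x] at this

/-- The laps can be normalized independently of each other: moving the end of a lap does not affect
the next one, which starts at clock value zero in any case. -/
theorem RPath.exists_walk_le {c : ℕ × ℤ} {D : ℤ} {p : ℕ} (h : S.RPath v c D p) (x : ℤ) {X : Pos}
    (hX : X.eval v x = c.2) :
    ∃ f ∈ S.lapNodes X, S.Lap v c (f.1.eval v x) f.2 ∧ ∃ l ⊆ S.lapNodes zeroPos, ∃ b : LNode,
      b.2.tgt = p ∧ Walk (S.LapLink v x) f l b ∧
      f.1.eval v x - c.2 + f.2.tick + (l.map (lapWeight v)).sum ≤ D := by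
  induction h generalizing X with
  | @last c y e h =>
    obtain ⟨y', hle, hc, hl, -⟩ := h.exists_cand_le
    rw [← hX] at hc
    obtain ⟨Y, hY, rfl⟩ := hc.exists_cands
    exact ⟨(Y, e), mem_lapNodes.2 ⟨hY, h.1⟩, hl, [], by simp, (Y, e), rfl, rfl, by simp; omega⟩
  | @cons c y e D p h h' ih =>
    obtain ⟨y', hle, hc, hl, -⟩ := h.exists_cand_le
    rw [← hX] at hc
    obtain ⟨Y, hY, rfl⟩ := hc.exists_cands
    obtain ⟨f, hf, hlf, l, hls, b, hb, hw, hD⟩ := ih (X := zeroPos) (by simp [zeroPos])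
    refine ⟨(Y, e), mem_lapNodes.2 ⟨hY, h.1⟩, hl, f :: l, by simp [hf, hls], b, hb, ⟨hlf, hw⟩, ?_⟩
    simp only [List.map_cons, List.sum_cons, lapWeight_eq hf x]
    dsimp only at hD ⊢
    omega

/-- As for the lower bound, but a lap that cannot be replaced by a longer candidate yields one that
can be pumped, and then its actual duration is of no importance. -/
theorem RPath.exists_walk_ge {c : ℕ × ℤ} {D : ℤ} {p : ℕ} (h : S.RPath v c D p) (x : ℤ) {X : Pos}
    (hX : X.eval v x = c.2) :
    ∃ f ∈ S.lapNodes X, S.Lap v c (f.1.eval v x) f.2 ∧ ∃ l ⊆ S.lapNodes zeroPos, ∃ b : LNode,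
      b.2.tgt = p ∧ Walk (S.LapLink v x) f l b ∧
      (D ≤ f.1.eval v x - c.2 + f.2.tick + (l.map (lapWeight v)).sum ∨
        S.Pump v c.2 (f.1.eval v x) ∨ ∃ d ∈ l, S.Pump v 0 (d.1.eval v x)) := by
  induction h generalizing X with
  | @last c y e h =>
    obtain ⟨y', hc, hl, hle⟩ := h.exists_cand_ge
    rw [← hX] at hc
    obtain ⟨Y, hY, rfl⟩ := hc.exists_cands
    refine ⟨(Y, e), mem_lapNodes.2 ⟨hY, h.1⟩, hl, [], by simp, (Y, e), rfl, rfl, ?_⟩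
    rcases hle with hle | hle
    · left; simp; omega
    · exact Or.inr (Or.inl hle)
  | @cons c y e D p h h' ih =>
    obtain ⟨y', hc, hl, hle⟩ := h.exists_cand_ge
    rw [← hX] at hc
    obtain ⟨Y, hY, rfl⟩ := hc.exists_cands
    obtain ⟨f, hf, hlf, l, hls, b, hb, hw, hD⟩ := ih (X := zeroPos) (by simp [zeroPos])
    refine ⟨(Y, e), mem_lapNodes.2 ⟨hY, h.1⟩, hl, f :: l, by simp [hf, hls], b, hb, ⟨hlf, hw⟩, ?_⟩
    rcases hle with hle | hle
    · rcases hD with hD | hD | ⟨d, hd, hp⟩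
      · left
        simp only [List.map_cons, List.sum_cons, lapWeight_eq hf x]
        dsimp only at hD ⊢
        omega
      · exact Or.inr (Or.inr ⟨f, by simp, hD⟩)
      · exact Or.inr (Or.inr ⟨d, by simp [hd], hp⟩)
    · exact Or.inr (Or.inl hle)

end Sys

end ParamTCTL

set_option synthInstance.maxSize 4096

namespace ParamTCTL

theorem Walk.mem {β : Type*} {r : β → β → Prop} {a b : β} {l : List β} (h : Walk r a l b) :
    b ∈ a :: l := by
  induction l generalizing a with
  | nil => cases h; simp
  | cons c l ih => exact List.mem_cons_of_mem _ (ih h.2)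

/-! ### Small and large durations of paths that end with a reset -/

namespace Sys

variable {S : Sys} {v : ℕ → ℕ}

/-- Shorter laps and the removal of repetitions both decrease the duration, so finitely many walks
decide whether a bound can be undercut. -/
theorem exists_rpath_lt_iff {q p : ℕ} {x α : ℤ} : (∃ D, S.RPath v (q, x) D p ∧ D < α) ↔
    ∃ f ∈ S.lapNodes Pos.clock, S.Lap v (q, x) (f.1.eval v x) f.2 ∧
      ∃ l ∈ allLists (S.lapNodes zeroPos) (S.lapNodes zeroPos).length,
      ∃ b ∈ f :: S.lapNodes zeroPos, b.2.tgt = p ∧ Walk (S.LapLink v x) f l b ∧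
        f.1.eval v x - x + f.2.tick + (l.map (lapWeight v)).sum < α := by
  constructor
  · rintro ⟨D, h, hD⟩
    obtain ⟨f, hf, hl, l, hls, b, hb, hw, hle⟩ := h.exists_walk_le x (X := Pos.clock) (by simp)
    obtain ⟨l', hw', hd, hs, hle'⟩ := exists_short_walk_le (w := lapWeight v) hw
      fun n hn => lapWeight_nonneg hw hls hn
    have hls' := List.Subset.trans hs hls
    refine ⟨f, hf, hl, l', mem_allLists_of_nodup hls' hd, b, ?_, hb, hw', ?_⟩
    · exact List.cons_subset_cons f hls' hw'.mem
    · dsimp only at hle; omega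
  · rintro ⟨f, -, hl, l, hls, b, -, rfl, hw, hD⟩
    exact ⟨_, rpath_of_walk hl hw (mem_allLists.1 hls).1, hD⟩

/-- Reachability between laps. -/
def LapReach (S : Sys) (v : ℕ → ℕ) (x : ℤ) : LNode → LNode → Prop :=
  Relation.ReflTransGen fun c d => d ∈ S.lapNodes zeroPos ∧ S.LapLink v x c d

/-- The first lap is allowed to end at any `y`, and its duration bounds that of the path from below;
so a pumped lap makes the whole path long. -/
theorem LapReach.rpath {x : ℤ} {n m : LNode} (h : S.LapReach v x n m) {c : ℕ × ℤ} {y : ℤ}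
    (hn : S.Lap v c y n.2) : ∃ D, y - c.2 + n.2.tick ≤ D ∧ S.RPath v c D m.2.tgt := by
  induction h with
  | refl => exact ⟨_, le_rfl, .last hn⟩
  | tail _ h ih =>
    obtain ⟨D, hD, h'⟩ := ih
    have := RPath.last h.2
    exact ⟨_, by have := this.nonneg; omega, h'.trans this⟩

theorem RPath.repeat {p : ℕ} {D : ℤ} (h : S.RPath v (p, 0) D p) (n : ℕ) :
    S.RPath v (p, 0) ((n + 1) * D) p := by
  induction n with
  | zero => simpa using h
  | succ n ih =>
    have := ih.trans h
    rwa [show ((n : ℤ) + 1) * D + D = ((n + 1 : ℕ) + 1) * D by push_cast; ring] at this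

/-- A lap that allows arbitrarily long durations: it can itself be arbitrarily long, or it has
positive duration and can be repeated. -/
def Unbounded (S : Sys) (v : ℕ → ℕ) (x : ℤ) (d : LNode) : Prop :=
  S.Pump v 0 (d.1.eval v x) ∨ (0 < lapWeight v d ∧
    ∃ d' ∈ S.lapNodes zeroPos, S.LapReach v x d d' ∧ S.LapLink v x d' d)

/-- Either a walk without repetition is long enough, or durations are unbounded: the first lap can
be pumped, or some later lap `d` can be pumped or lies with positive duration on a closed walk. The
first lap is separate since it starts at `x` and not at zero. -/
theorem exists_rpath_ge_iff {q p : ℕ} {x α : ℤ} : (∃ D, S.RPath v (q, x) D p ∧ α ≤ D) ↔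
    ∃ f ∈ S.lapNodes Pos.clock, S.Lap v (q, x) (f.1.eval v x) f.2 ∧
      ∃ b ∈ f :: S.lapNodes zeroPos, b.2.tgt = p ∧
      ((∃ l ∈ allLists (S.lapNodes zeroPos) (S.lapNodes zeroPos).length,
        Walk (S.LapLink v x) f l b ∧
        α ≤ f.1.eval v x - x + f.2.tick + (l.map (lapWeight v)).sum) ∨
      (S.Pump v x (f.1.eval v x) ∧ S.LapReach v x f b) ∨
      ∃ d ∈ S.lapNodes zeroPos, S.Unbounded v x d ∧ S.LapReach v x d b ∧
        ∃ d₀ ∈ f :: S.lapNodes zeroPos, S.LapReach v x f d₀ ∧ S.LapLink v x d₀ d) := by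
  constructor
  · rintro ⟨D, h, hD⟩
    obtain ⟨f, hf, hl, l, hls, b, hb, hw, hge⟩ := h.exists_walk_ge x (X := Pos.clock) (by simp)
    -- The link into `d` is split off, since the lap `d` itself is going to be modified while the
    -- walk up to its predecessor stays as it is.
    have hlast : ∀ {d : LNode} {l₁ : List LNode}, l₁ ⊆ l → l₁ ≠ [] →
        Walk (S.LapLink v x) f l₁ d →
        ∃ d₀ ∈ f :: S.lapNodes zeroPos, S.LapReach v x f d₀ ∧ S.LapLink v x d₀ d := by
      intro d l₁ hs hne hw
      obtain ⟨l₂, e, rfl⟩ := List.eq_nil_or_concat l₁ |>.resolve_left hne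
      rw [List.concat_eq_append] at hw hs
      obtain ⟨d₀, h₁, h₂⟩ := walk_append.1 hw
      have hs' := List.Subset.trans (List.subset_append_left _ _) (List.Subset.trans hs hls)
      obtain ⟨h₂, rfl⟩ := h₂
      exact ⟨d₀, List.cons_subset_cons f hs' h₁.mem, h₁.reflTransGen hs', h₂⟩
    refine ⟨f, hf, hl, b, List.cons_subset_cons f hls hw.mem, hb, ?_⟩
    rcases hge with hge | hge | ⟨d, hd, hp⟩
    · rcases exists_short_walk_ge (w := lapWeight v) hw
        fun n hn => lapWeight_nonneg hw hls hn with
        ⟨l', hw', hd, hs, hle'⟩ | ⟨d, hd, hd0, l₁, l₂, l₃, s₁, s₂, s₃, hne, w₁, w₂, w₃⟩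
      · exact Or.inl ⟨l', mem_allLists_of_nodup (List.Subset.trans hs hls) hd, hw', by
          dsimp only at hge; omega⟩
      · obtain ⟨m, e, rfl⟩ := List.eq_nil_or_concat l₂ |>.resolve_left hne
        rw [List.concat_eq_append] at w₂ s₂
        obtain ⟨d', h₁, h₂, rfl⟩ := walk_append.1 w₂
        have s' := List.Subset.trans (List.subset_append_left _ _) (List.Subset.trans s₂ hls)
        have hd' : d' ∈ S.lapNodes zeroPos := by
          rcases List.mem_cons.1 h₁.mem with rfl | h
          · exact hls hd
          · exact s' h
        refine Or.inr (Or.inr ⟨_, hls hd, Or.inr ⟨hd0, d', hd', h₁.reflTransGen s', h₂⟩,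
          w₃.reflTransGen (List.Subset.trans s₃ hls), ?_⟩)
        exact hlast (l₁ := l₁ ++ (m ++ [e])) (by simp [s₁, List.append_subset.1 s₂])
          (by simp) (walk_append.2 ⟨_, w₁, w₂⟩)
    · exact Or.inr (Or.inl ⟨hge, hw.reflTransGen hls⟩)
    · obtain ⟨l₁, l₂, rfl, w₁, w₂⟩ := walk_of_mem hw hd
      rw [List.append_subset, List.cons_subset] at hls
      refine Or.inr (Or.inr ⟨d, hls.2.1, Or.inl hp, w₂.reflTransGen hls.2.2, ?_⟩)
      exact hlast (l₁ := l₁ ++ [d]) (by simp) (by simp) w₁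
  · rintro ⟨f, -, hl, b, -, rfl, ⟨l, hls, hw, hD⟩ | ⟨hp, hr⟩ |
      ⟨d, hd, hu, hdb, d₀, -, hr, hlink⟩⟩
    · exact ⟨_, rpath_of_walk hl hw (mem_allLists.1 hls).1, hD⟩
    · obtain ⟨y', hy, hl'⟩ := hl.pump hp (α + x)
      obtain ⟨D, hD, h⟩ := hr.rpath hl'
      exact ⟨D, h, by dsimp only at hD; omega⟩
    · obtain ⟨D₀, hD₀, h₀⟩ := hr.rpath hl
      have hn₀ := h₀.nonneg
      rcases hu with hp | ⟨hpos, d', hd', hdd, hlink'⟩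
      · obtain ⟨y', hy, hl'⟩ := Lap.pump hlink hp α
        obtain ⟨D, hD, h⟩ := hdb.rpath hl'
        exact ⟨_, h₀.trans h, by dsimp only at hD; omega⟩
      · have hdl : S.RPath v (d₀.2.tgt, 0) _ d.2.tgt := .last hlink
        have hcyc' : ∃ C, 0 < C ∧ S.RPath v (d.2.tgt, 0) C d.2.tgt := by
          rw [lapWeight_eq hd x] at hpos
          have hlast := RPath.last hlink'
          rcases hdd.cases_head with rfl | ⟨d₁, h₁, h₂⟩
          · exact ⟨_, hpos, hlast⟩
          · obtain ⟨C, hC, h⟩ := LapReach.rpath (S := S) (v := v) h₂ h₁.2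
            have := h.nonneg
            exact ⟨_, by dsimp only; omega, h.trans hlast⟩
        obtain ⟨C, hC, hcyc⟩ := hcyc'
        -- The closed path has duration `C ≥ 1`, so running through it `α.toNat + 1` times suffices.
        have h₁ := (h₀.trans hdl).trans (hcyc.repeat (α.toNat))
        have hn₁ := hdl.nonneg
        have hge : α ≤ (α.toNat + 1) * C := by nlinarith [Int.self_le_toNat α]
        rcases hdb.cases_head with rfl | ⟨d₁, k₁, k₂⟩
        · exact ⟨_, h₁, by linarith⟩
        · obtain ⟨D, hD, h⟩ := LapReach.rpath (S := S) (v := v) k₂ k₁.2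
          have := h.nonneg
          exact ⟨_, h₁.trans h, by linarith⟩

end Sys

section

variable {ι : Type*} [Primcodable ι] {S : ι → Sys}

@[fun_prop] theorem primrec_maxOffset (hS : Primrec S) : Primrec fun i => (S i).maxOffset := by
  unfold Sys.maxOffset; fun_prop

@[fun_prop] theorem primrec_cands {X : ι → Pos} (hS : Primrec S) (hX : Primrec X) :
    Primrec fun i => (S i).cands (X i) := by unfold Sys.cands; fun_prop

@[fun_prop] theorem primrec_lapNodes {X : ι → Pos} (hS : Primrec S) (hX : Primrec X) :
    Primrec fun i => (S i).lapNodes (X i) := by unfold Sys.lapNodes; fun_prop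

@[fun_prop] theorem primrec_lapTerm {n : ι → Sys.LNode} (hn : Primrec n) :
    Primrec fun i => Sys.lapTerm (n i) := by unfold Sys.lapTerm; fun_prop

end

instance : DecidableEq REdge := Encodable.decidableEqOfEncodable REdge

instance : DecidableEq Sys.LNode := Encodable.decidableEqOfEncodable Sys.LNode

/-! ### Definability of one-sided bounds on durations -/

namespace Eff

theorem lap : Eff fun (i : Sys × (ℕ × Pos) × Sys.LNode) x v =>
    i.1.Lap v (i.2.1.1, i.2.1.2.eval v x) (i.2.2.1.eval v x) i.2.2.2 := by
  unfold Sys.Lap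
  refine and ?_ (and (const (by fun_prop)) (and ?_ ?_))
  · exact (ex (l := fun i : Sys × (ℕ × Pos) × Sys.LNode => i.1) (by fun_prop)
      (P := fun i e _ _ => e = i.2.2.2) (const (by fun_prop))).congr fun i x v => by simp
  · exact nreach.comp (f := fun i : Sys × (ℕ × Pos) × Sys.LNode =>
      (i.1, i.2.1, (i.2.2.2.src, i.2.2.1))) (by fun_prop)
  · exact subst (holds (F := fun i : Sys × (ℕ × Pos) × Sys.LNode => i.2.2.2.cond) (by fun_prop))
      (Y := fun i => i.2.2.1) (by fun_prop)

theorem firstLap : Eff fun (i : Sys × ℕ × Sys.LNode) x v =>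
    i.1.Lap v (i.2.1, x) (i.2.2.1.eval v x) i.2.2.2 :=
  (lap.comp (f := fun i : Sys × ℕ × Sys.LNode => (i.1, (i.2.1, Pos.clock), i.2.2))
    (by fun_prop)).congr fun i x v => by simp

theorem lapLink : Eff fun (i : Sys × Sys.LNode × Sys.LNode) x v =>
    i.1.LapLink v x i.2.1 i.2.2 :=
  (lap.comp (f := fun i : Sys × Sys.LNode × Sys.LNode => (i.1, (i.2.1.2.tgt, Sys.zeroPos), i.2.2))
    (by fun_prop)).congr fun i x v => by simp [Sys.zeroPos, Sys.LapLink]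

theorem lapReach : Eff fun (i : Sys × Sys.LNode × Sys.LNode) x v =>
    i.1.LapReach v x i.2.1 i.2.2 :=
  reach (N := fun S : Sys => S.lapNodes Sys.zeroPos) (by fun_prop)
    (link := fun S c d x v => S.LapLink v x c d) lapLink

theorem pump : Eff fun (i : Sys × Pos × Pos) x v =>
    i.1.Pump v (i.2.1.eval v x) (i.2.2.eval v x) := by
  unfold Sys.Pump
  refine ((posLe (Y := fun i : Sys × Pos × Pos => i.2.1.shift i.1.preperiod)
    (Z := fun i => i.2.2) (by fun_prop) (by fun_prop)).and
    (all (l := fun i : Sys × Pos × Pos => i.1.thresholds) (by fun_prop)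
      (P := fun i t x v => ((Pos.ofTerm t).shift i.1.preperiod).eval v x ≤ i.2.2.eval v x)
      (posLe (by fun_prop) (by fun_prop)))).congr fun i x v => by simp

theorem unbounded : Eff fun (i : Sys × Sys.LNode) x v => i.1.Unbounded v x i.2 := by
  unfold Sys.Unbounded
  refine or ?_ (and ?_ (ex (by fun_prop) (and ?_ ?_)))
  · exact (pump.comp (f := fun i : Sys × Sys.LNode => (i.1, Sys.zeroPos, i.2.1))
      (by fun_prop)).congr fun i x v => by simp [Sys.zeroPos]
  · exact (posLt (Y := fun i : Sys × Sys.LNode => Sys.zeroPos)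
      (Z := fun i => Pos.ofTerm (Sys.lapTerm i.2)) (by fun_prop) (by fun_prop)).congr
      fun i x v => by simp [Sys.zeroPos, Sys.lapWeight]
  · exact lapReach.comp (f := fun i : (Sys × Sys.LNode) × Sys.LNode => (i.1.1, i.1.2, i.2))
      (by fun_prop)
  · exact lapLink.comp (f := fun i : (Sys × Sys.LNode) × Sys.LNode => (i.1.1, i.2, i.1.2))
      (by fun_prop)

theorem lapWalk : Eff fun (i : Sys × Sys.LNode × List Sys.LNode × Sys.LNode) x v =>
    Walk (i.1.LapLink v x) i.2.1 i.2.2.1 i.2.2.2 :=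
  walk (link := fun (S : Sys) c d x v => S.LapLink v x c d) lapLink

/-- The duration of a sequence of laps, without the initial clock value. -/
def totalTerm (f : Sys.LNode) (l : List Sys.LNode) : Pos :=
  (f.1.1, LT.add (Sys.lapTerm f) (l.foldr (fun n α => LT.add (Sys.lapTerm n) α) (LT.const 0)))

theorem totalTerm_eval (f : Sys.LNode) (l : List Sys.LNode) (v : ℕ → ℕ) (x : ℤ) :
    (totalTerm f l).eval v x = f.1.eval v x + f.2.tick + (l.map (Sys.lapWeight v)).sum := by
  have : ∀ l : List Sys.LNode, (l.foldr (fun n α => LT.add (Sys.lapTerm n) α)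
      (LT.const 0)).eval v = (l.map (Sys.lapWeight v)).sum := by
    intro l
    induction l with
    | nil => simp
    | cons n l ih => simp [ih, Sys.lapWeight]
  simp only [totalTerm, Pos.eval, LT.eval_add, this]
  simp [Sys.lapTerm]
  ring

@[fun_prop] theorem primrec_totalTerm {ι : Type*} [Primcodable ι]
    {f : ι → Sys.LNode} {l : ι → List Sys.LNode} (hf : Primrec f) (hl : Primrec l) :
    Primrec fun i => totalTerm (f i) (l i) := by unfold totalTerm; fun_prop

theorem rpath_lt : Eff fun (i : Sys × ℕ × ℕ × LT) x v =>
    ∃ D, i.1.RPath v (i.2.1, x) D i.2.2.1 ∧ D < i.2.2.2.eval v := by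
  simp only [Sys.exists_rpath_lt_iff]
  refine ex (by fun_prop) (and ?_ (ex (by fun_prop) (ex (by fun_prop) (and (const (by fun_prop))
    (and ?_ ?_)))))
  · exact firstLap.comp (f := fun i : (Sys × ℕ × ℕ × LT) × Sys.LNode => (i.1.1, i.1.2.1, i.2))
      (by fun_prop)
  · exact lapWalk.comp (f := fun i : (((Sys × ℕ × ℕ × LT) × Sys.LNode) × List Sys.LNode) ×
      Sys.LNode => (i.1.1.1.1, i.1.1.2, i.1.2, i.2)) (by fun_prop)
  -- The initial clock value is moved to the other side: the pair with `true` denotes `x + α`.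
  · exact (posLt (Y := fun i : (((Sys × ℕ × ℕ × LT) × Sys.LNode) × List Sys.LNode) ×
      Sys.LNode => totalTerm i.1.1.2 i.1.2) (Z := fun i => (true, i.1.1.1.2.2.2))
      (by fun_prop) (by fun_prop)).congr fun i x v => by
        rw [totalTerm_eval]; simp only [Pos.eval, cond_true]; constructor <;> intro h <;> linarith

theorem rpath_ge : Eff fun (i : Sys × ℕ × ℕ × LT) x v =>
    ∃ D, i.1.RPath v (i.2.1, x) D i.2.2.1 ∧ i.2.2.2.eval v ≤ D := by
  simp only [Sys.exists_rpath_ge_iff]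
  refine ex (by fun_prop) (and ?_ (ex (by fun_prop) (and (const (by fun_prop))
    (or (ex (by fun_prop) (and ?_ ?_)) (or (and ?_ ?_) (ex (by fun_prop) (and ?_ (and ?_
      (ex (by fun_prop) (and ?_ ?_)))))))))) 
  · exact firstLap.comp (f := fun i : (Sys × ℕ × ℕ × LT) × Sys.LNode => (i.1.1, i.1.2.1, i.2))
      (by fun_prop)
  · exact lapWalk.comp (f := fun i : (((Sys × ℕ × ℕ × LT) × Sys.LNode) × Sys.LNode) ×
      List Sys.LNode => (i.1.1.1.1, i.1.1.2, i.2, i.1.2)) (by fun_prop)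
  · exact (posLe (Z := fun i : (((Sys × ℕ × ℕ × LT) × Sys.LNode) × Sys.LNode) ×
      List Sys.LNode => totalTerm i.1.1.2 i.2) (Y := fun i => (true, i.1.1.1.2.2.2))
      (by fun_prop) (by fun_prop)).congr fun i x v => by
        rw [totalTerm_eval]; simp only [Pos.eval, cond_true]; constructor <;> intro h <;> linarith
  · exact (pump.comp (f := fun i : ((Sys × ℕ × ℕ × LT) × Sys.LNode) × Sys.LNode =>
      (i.1.1.1, Pos.clock, i.1.2.1)) (by fun_prop)).congr fun i x v => by simp
  · exact lapReach.comp (f := fun i : ((Sys × ℕ × ℕ × LT) × Sys.LNode) × Sys.LNode =>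
      (i.1.1.1, i.1.2, i.2)) (by fun_prop)
  · exact unbounded.comp (f := fun i : (((Sys × ℕ × ℕ × LT) × Sys.LNode) × Sys.LNode) ×
      Sys.LNode => (i.1.1.1.1, i.2)) (by fun_prop)
  · exact lapReach.comp (f := fun i : (((Sys × ℕ × ℕ × LT) × Sys.LNode) × Sys.LNode) ×
      Sys.LNode => (i.1.1.1.1, i.2, i.1.2)) (by fun_prop)
  · exact lapReach.comp (f := fun i : ((((Sys × ℕ × ℕ × LT) × Sys.LNode) × Sys.LNode) ×
      Sys.LNode) × Sys.LNode => (i.1.1.1.1.1, i.1.1.1.2, i.2)) (by fun_prop)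
  · exact lapLink.comp (f := fun i : ((((Sys × ℕ × ℕ × LT) × Sys.LNode) × Sys.LNode) ×
      Sys.LNode) × Sys.LNode => (i.1.1.1.1.1, i.2, i.1.2)) (by fun_prop)

end Eff

/-! ### Timed paths and divergent runs -/

section Timed

variable {C : Type*}

/-- `TPath r c D c'`: there is a path from `c` to `c'` of duration `D`. -/
inductive TPath (r : C → ℕ → C → Prop) : C → ℕ → C → Prop
  | refl (c : C) : TPath r c 0 c
  | head {c d c' : C} {t D : ℕ} (h : r c t d) (h' : TPath r d D c') : TPath r c (t + D) c'

/-- There is an infinite path from `c` of infinite duration. -/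
def TRun (r : C → ℕ → C → Prop) (c : C) : Prop :=
  ∃ (ρ : ℕ → C) (τ : ℕ → ℕ), ρ 0 = c ∧ (∀ i, r (ρ i) (τ i) (ρ (i + 1))) ∧
    Filter.Tendsto (fun n => ∑ i ∈ Finset.range n, τ i) Filter.atTop Filter.atTop

variable {r : C → ℕ → C → Prop}

theorem TPath.trans {c d e : C} {D E : ℕ} (h : TPath r c D d) (h' : TPath r d E e) :
    TPath r c (D + E) e := by
  induction h with
  | refl => simpa using h'
  | head h _ ih => rw [add_assoc]; exact .head h (ih h')

theorem TPath.single {c d : C} {t : ℕ} (h : r c t d) : TPath r c t d := by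
  simpa using TPath.head h (.refl d)

theorem tpath_iff {c c' : C} {D : ℕ} : TPath r c D c' ↔ ∃ (n : ℕ) (ρ : ℕ → C) (τ : ℕ → ℕ),
    ρ 0 = c ∧ ρ n = c' ∧ (∀ i < n, r (ρ i) (τ i) (ρ (i + 1))) ∧
      ∑ i ∈ Finset.range n, τ i = D := by
  constructor
  · intro h
    induction h with
    | refl c => exact ⟨0, fun _ => c, fun _ => 0, rfl, rfl, by simp, by simp⟩
    | @head c d c' t D h _ ih =>
      obtain ⟨n, ρ, τ, h₀, h₁, h₂, h₃⟩ := ih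
      refine ⟨n + 1, fun i => Nat.casesOn i c ρ, fun i => Nat.casesOn i t τ, rfl, h₁, ?_, ?_⟩
      · rintro (_ | i) hi
        · simpa [h₀] using h
        · exact h₂ i (by omega)
      · rw [Finset.sum_range_succ', add_comm]
        simpa using h₃
  · rintro ⟨n, ρ, τ, rfl, rfl, h₂, rfl⟩
    induction n with
    | zero => simpa using TPath.refl (r := r) (ρ 0)
    | succ n ih =>
      rw [Finset.sum_range_succ]
      exact (ih fun i hi => h₂ i (by omega)).trans (.single (h₂ n (by omega)))

theorem tpath_of_steps {ρ : ℕ → C} {τ : ℕ → ℕ} (h : ∀ i, r (ρ i) (τ i) (ρ (i + 1))) {i j : ℕ}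
    (hij : i ≤ j) : ∃ D, ∑ k ∈ Finset.range j, τ k = ∑ k ∈ Finset.range i, τ k + D ∧
      TPath r (ρ i) D (ρ j) := by
  induction j, hij using Nat.le_induction with
  | base => exact ⟨0, rfl, .refl _⟩
  | succ j _ ih =>
    obtain ⟨D, hD, h'⟩ := ih
    exact ⟨D + τ j, by rw [Finset.sum_range_succ, hD, add_assoc], h'.trans (.single (h j))⟩

theorem TRun.cons {c d : C} {t : ℕ} (h : r c t d) (hd : TRun r d) : TRun r c := by
  obtain ⟨ρ, τ, rfl, h₁, h₂⟩ := hd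
  refine ⟨fun i => Nat.casesOn i c ρ, fun i => Nat.casesOn i t τ, rfl, ?_, ?_⟩
  · rintro (_ | i)
    · exact h
    · exact h₁ i
  · rw [← Filter.tendsto_add_atTop_iff_nat 1]
    refine Filter.tendsto_atTop_mono (fun n => ?_) h₂
    rw [Finset.sum_range_succ']
    exact Nat.le_add_right _ _

theorem TPath.run {c d : C} {D : ℕ} (h : TPath r c D d) (hd : TRun r d) : TRun r c := by
  induction h with
  | refl => exact hd
  | head h _ ih => exact (ih hd).cons h

theorem TRun.suffix {ρ : ℕ → C} {τ : ℕ → ℕ} (h : ∀ i, r (ρ i) (τ i) (ρ (i + 1)))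
    (hd : Filter.Tendsto (fun n => ∑ i ∈ Finset.range n, τ i) Filter.atTop Filter.atTop) (n : ℕ) :
    TRun r (ρ n) := by
  refine ⟨fun i => ρ (n + i), fun i => τ (n + i), rfl, fun i => h (n + i), ?_⟩
  rw [← Filter.tendsto_add_atTop_iff_nat n] at hd
  refine Filter.tendsto_atTop.2 fun b => ?_
  filter_upwards [Filter.tendsto_atTop.1 hd (b + ∑ i ∈ Finset.range n, τ i)] with m hm
  rw [add_comm m n, Finset.sum_range_add] at hm
  omega

/-- Paths of positive duration that lead from `W` to `W` can be concatenated to a run. -/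
theorem tRun_of_recurrent {W : Set C}
    (hW : ∀ c ∈ W, ∃ D > 0, ∃ c' ∈ W, TPath r c D c') {c₀ : C} (h₀ : c₀ ∈ W) : TRun r c₀ := by
  -- Finite paths from `c₀` to `W`, stored as a length together with sequences whose values beyond
  -- the length are irrelevant.
  let Inv : ℕ × (ℕ → C) × (ℕ → ℕ) → Prop := fun X =>
    X.2.1 0 = c₀ ∧ (∀ i < X.1, r (X.2.1 i) (X.2.2 i) (X.2.1 (i + 1))) ∧ X.2.1 X.1 ∈ W
  have hext : ∀ X : {X // Inv X}, ∃ Y : {X // Inv X}, X.1.1 < Y.1.1 ∧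
      (∀ i ≤ X.1.1, Y.1.2.1 i = X.1.2.1 i) ∧ (∀ i < X.1.1, Y.1.2.2 i = X.1.2.2 i) ∧
      ∑ i ∈ Finset.range X.1.1, X.1.2.2 i < ∑ i ∈ Finset.range Y.1.1, Y.1.2.2 i := by
    rintro ⟨⟨n, ρ, τ⟩, k₀, k₁, k₂⟩
    obtain ⟨D, hD, c', hc', hp⟩ := hW _ k₂
    obtain ⟨m, ρ', τ', e₀, rfl, e₂, rfl⟩ := tpath_iff.1 hp
    dsimp only at k₀ k₁ k₂ e₀
    have hm : 0 < m := by
      rcases Nat.eq_zero_or_pos m with rfl | h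
      · simp at hD
      · exact h
    refine ⟨⟨⟨n + m, fun i => if i ≤ n then ρ i else ρ' (i - n),
      fun i => if i < n then τ i else τ' (i - n)⟩, ?_, ?_, ?_⟩, ?_, ?_, ?_, ?_⟩
    · simpa using k₀
    · intro i hi
      dsimp only at hi ⊢
      rcases lt_trichotomy i n with h | rfl | h
      · rw [if_pos h.le, if_pos h, if_pos (Nat.succ_le_of_lt h)]; exact k₁ i h
      · rw [if_pos le_rfl, if_neg (by omega), if_neg (by omega), ← e₀]
        simpa using e₂ 0 hm
      · rw [if_neg (by omega), if_neg (by omega), if_neg (by omega),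
          show i + 1 - n = i - n + 1 by omega]
        exact e₂ _ (by omega)
    · dsimp only
      rw [if_neg (by omega), Nat.add_sub_cancel_left]
      exact hc'
    · dsimp only; omega
    · intro i hi
      exact if_pos hi
    · intro i hi
      exact if_pos hi
    · dsimp only
      rw [Finset.sum_range_add]
      have : ∑ i ∈ Finset.range n, (if i < n then τ i else τ' (i - n)) =
          ∑ i ∈ Finset.range n, τ i :=
        Finset.sum_congr rfl fun i hi => if_pos (Finset.mem_range.1 hi)
      rw [this]
      simpa using hD
  choose next hn₁ hn₂ hn₃ hn₄ using hext
  let s : ℕ → {X // Inv X} := fun k => next^[k] ⟨(0, fun _ => c₀, fun _ => 0), rfl, by simp, h₀⟩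
  have hs : ∀ k, s (k + 1) = next (s k) := fun k => Function.iterate_succ_apply' _ _ _
  have hlen : ∀ k, k ≤ (s k).1.1 := by
    intro k
    induction k with
    | zero => exact Nat.zero_le _
    | succ k ih => rw [hs]; exact Nat.succ_le_of_lt (ih.trans_lt (hn₁ _))
  have hmono : ∀ j k, j ≤ k → (s j).1.1 ≤ (s k).1.1 ∧
      (∀ i ≤ (s j).1.1, (s k).1.2.1 i = (s j).1.2.1 i) ∧
      (∀ i < (s j).1.1, (s k).1.2.2 i = (s j).1.2.2 i) := by
    intro j k hjk
    induction k, hjk using Nat.le_induction with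
    | base => exact ⟨le_rfl, fun _ _ => rfl, fun _ _ => rfl⟩
    | succ k _ ih =>
      rw [hs]
      refine ⟨ih.1.trans (hn₁ _).le, fun i hi => ?_, fun i hi => ?_⟩
      · rw [hn₂ _ i (hi.trans ih.1), ih.2.1 i hi]
      · rw [hn₃ _ i (hi.trans_le ih.1), ih.2.2 i hi]
  have hdur : ∀ k, k ≤ ∑ i ∈ Finset.range (s k).1.1, (s k).1.2.2 i := by
    intro k
    induction k with
    | zero => exact Nat.zero_le _
    | succ k ih => rw [hs]; exact Nat.succ_le_of_lt (ih.trans_lt (hn₄ _))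
  -- The limit is read off diagonally. Stage `i` has length at least `i`, which fixes position `i`;
  -- the increment with index `i` is fixed only by a length above `i`, hence stage `i + 1`.
  refine ⟨fun i => (s i).1.2.1 i, fun i => (s (i + 1)).1.2.2 i, (s 0).2.1, fun i => ?_, ?_⟩
  · have := (s (i + 1)).2.2.1 i (hlen (i + 1))
    rwa [(hmono i (i + 1) (by omega)).2.1 i (hlen i)] at this
  · have hm : Monotone fun n => ∑ i ∈ Finset.range n, (s (i + 1)).1.2.2 i := fun a b hab =>
      Finset.sum_le_sum_of_subset (Finset.range_mono hab)
    refine Filter.tendsto_atTop_atTop_of_monotone hm fun k => ⟨(s k).1.1, (hdur k).trans ?_⟩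
    refine Finset.sum_le_sum fun i hi => le_of_eq ?_
    rw [Finset.mem_range] at hi
    rcases Nat.le_total (i + 1) k with h | h
    · exact (hmono _ _ h).2.2 i (hlen (i + 1))
    · exact ((hmono _ _ h).2.2 i hi).symm

end Timed

/-! ### Timed paths as sequences of laps -/

namespace Sys

variable {S S' : Sys} {v : ℕ → ℕ}

/-- The transitions of `S`. -/
def FStep (S : Sys) (v : ℕ → ℕ) (c : ℕ × ℤ) (t : ℕ) (c' : ℕ × ℤ) : Prop :=
  ∃ e ∈ S, e.src = c.1 ∧ e.cond.Holds v c.2 ∧ t = e.tick ∧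
    c' = (e.tgt, if e.reset then 0 else c.2 + e.tick)

/-- A transition without reset is absorbed into the beginning of the first lap. -/
theorem RPath.head_step {c d : ℕ × ℤ} {D : ℤ} {p : ℕ} (h : S.NStep v c d)
    (h' : S.RPath v d D p) : S.RPath v c (d.2 - c.2 + D) p := by
  cases h' with
  | @last _ y e hl =>
    have := RPath.last (c := c) (S := S) (v := v) ⟨hl.1, hl.2.1, .head h hl.2.2.1, hl.2.2.2⟩
    rwa [show d.2 - c.2 + (y - d.2 + e.tick) = y - c.2 + e.tick by ring]
  | @cons _ y e D _ hl hr =>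
    have := RPath.cons (c := c) (S := S) (v := v) ⟨hl.1, hl.2.1, .head h hl.2.2.1, hl.2.2.2⟩ hr
    rwa [show d.2 - c.2 + (y - d.2 + e.tick + D) = y - c.2 + e.tick + D by ring]

/-- The transitions are grouped into laps from the end backwards, with `e` closing the last lap. The
edge `e` may come from a larger system, so that it can be an added one. -/
theorem rpath_of_tpath (hS : S ⊆ S') {c c' : ℕ × ℤ} {D : ℕ} (h : TPath (S.FStep v) c D c')
    {e : REdge} (he : e ∈ S') (hr : e.reset = true) (hs : e.src = c'.1)
    (hc : e.cond.Holds v c'.2) : S'.RPath v c (D + e.tick) e.tgt := by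
  induction h with
  | refl c =>
    have := RPath.last (S := S') (v := v) (c := c) (y := c.2) ⟨he, hr, by rw [hs]; exact .refl, hc⟩
    simpa using this
  | @head c d c' t D h _ ih =>
    have ih := ih hs hc
    obtain ⟨k, hk, h₁, h₂, rfl, rfl⟩ := h
    by_cases hkr : k.reset = true
    · rw [if_pos hkr] at ih
      have := RPath.cons (S := S') (v := v) (c := c) (y := c.2)
        ⟨hS hk, hkr, by rw [h₁]; exact .refl, h₂⟩ ih
      rwa [show ((k.tick + D : ℕ) : ℤ) + e.tick = c.2 - c.2 + k.tick + (D + e.tick) by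
        push_cast; ring]
    · rw [if_neg hkr] at ih
      have := RPath.head_step ⟨k, hS hk, by simpa using hkr, h₁, h₂, rfl⟩ ih
      rwa [show ((k.tick + D : ℕ) : ℤ) + e.tick = c.2 + k.tick - c.2 + (D + e.tick) by
        push_cast; ring]

theorem NReach.tpath {c c' : ℕ × ℤ} (h : S.NReach v c c') :
    TPath (S.FStep v) c (c'.2 - c.2).toNat c' := by
  induction h with
  | refl => simpa using TPath.refl (r := S.FStep v) c
  | @tail b d hb h ih =>
    have h0 := NReach.le hb
    obtain ⟨e, he, hr, h₁, h₂, rfl⟩ := h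
    have := ih.trans (.single (t := e.tick) (d := (e.tgt, b.2 + e.tick))
      ⟨e, he, h₁, h₂, rfl, by simp [hr]⟩)
    rwa [show (b.2 + (e.tick : ℤ) - c.2).toNat = (b.2 - c.2).toNat + e.tick by omega]

theorem Lap.tpath {c : ℕ × ℤ} {y : ℤ} {e : REdge} (h : S.Lap v c y e) :
    TPath (S.FStep v) c (y - c.2 + e.tick).toNat (e.tgt, 0) := by
  have h0 := h.2.2.1.le
  have := h.2.2.1.tpath.trans (.single (t := e.tick) (d := (e.tgt, 0))
      ⟨e, h.1, rfl, h.2.2.2, rfl, by simp [h.2.1]⟩)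
  dsimp only at h0 this
  rwa [show (y - c.2 + (e.tick : ℤ)).toNat = (y - c.2).toNat + e.tick by omega]

theorem RPath.tpath {c : ℕ × ℤ} {D : ℤ} {p : ℕ} (h : S.RPath v c D p) :
    TPath (S.FStep v) c D.toNat (p, 0) := by
  induction h with
  | last h => exact h.tpath
  | @cons c y e D p h h' ih =>
    have h₁ := h'.nonneg
    have h₂ := (RPath.last h).nonneg
    rw [show (y - c.2 + (e.tick : ℤ) + D).toNat = (y - c.2 + e.tick).toNat + D.toNat by omega]
    exact h.tpath.trans ih

/-! ### Reachability of a target -/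

/-- A target: pairs of a state and a condition on the clock. -/
abbrev Target : Type := List (ℕ × DNF)

def Target.Holds (T : Target) (v : ℕ → ℕ) (c : ℕ × ℤ) : Prop :=
  ∃ t ∈ T, t.1 = c.1 ∧ t.2.Holds v c.2

/-- Add edges that lead from the target to the new state `s`. -/
def withSink (S : Sys) (T : Target) (s : ℕ) : Sys := S ++ T.map fun t => (t.1, false, t.2, true, s)

/-- A state that occurs neither in `S` nor in `T` and is different from `q`. -/
def fresh (S : Sys) (T : Target) (q : ℕ) : ℕ :=
  (S.foldr (fun e m => e.src + e.tgt + m) (T.foldr (fun t m => t.1 + m) q)) + 1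

theorem lt_fresh_target {T : Target} {q : ℕ} : q < fresh S T q ∧ (∀ t ∈ T, t.1 < fresh S T q) ∧
    ∀ e ∈ S, e.src < fresh S T q ∧ e.tgt < fresh S T q := by
  unfold fresh
  have h₁ : q ≤ T.foldr (fun t m => t.1 + m) q ∧
      ∀ t ∈ T, t.1 ≤ T.foldr (fun t m => t.1 + m) q := by
    induction T with
    | nil => simp
    | cons t T ih =>
      simp only [List.foldr_cons, List.mem_cons, forall_eq_or_imp]
      refine ⟨by omega, by omega, fun s hs => ?_⟩
      have := ih.2 s hs
      omega
  generalize T.foldr (fun t m => t.1 + m) q = m at h₁ ⊢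
  have h₂ : m ≤ S.foldr (fun e m => e.src + e.tgt + m) m ∧
      ∀ e ∈ S, e.src + e.tgt ≤ S.foldr (fun e m => e.src + e.tgt + m) m := by
    induction S with
    | nil => simp
    | cons t T ih =>
      simp only [List.foldr_cons, List.mem_cons, forall_eq_or_imp]
      refine ⟨by omega, by omega, fun s hs => ?_⟩
      have := ih.2 s hs
      omega
  refine ⟨by omega, fun t ht => ?_, fun e he => ?_⟩
  · have := h₁.2 t ht
    omega
  · have := h₂.2 e he
    omega

theorem nreach_withSink {T : Target} {s : ℕ} {c c' : ℕ × ℤ} (h : (S.withSink T s).NReach v c c') :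
    S.NReach v c c' := by
  refine Relation.ReflTransGen.mono ?_ _ _ h
  rintro a b ⟨e, he, hr, h'⟩
  rcases List.mem_append.1 he with he | he
  · exact ⟨e, he, hr, h'⟩
  · obtain ⟨t, -, rfl⟩ := List.mem_map.1 he
    simp [REdge.reset] at hr

/-- No edge leaves the sink, so only the last lap can end with an added edge; dropping that edge
leaves a path of the original system into the target. -/
theorem exists_tpath_of_rpath {T : Target} {s : ℕ} (hS : ∀ e ∈ S, e.src ≠ s ∧ e.tgt ≠ s)
    (hT : ∀ t ∈ T, t.1 ≠ s) {c : ℕ × ℤ} {D : ℤ} (h : (S.withSink T s).RPath v c D s) :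
    ∃ c', TPath (S.FStep v) c D.toNat c' ∧ T.Holds v c' := by
  have hlap : ∀ {c : ℕ × ℤ} {y : ℤ} {e : REdge}, (S.withSink T s).Lap v c y e →
      (e ∈ S ∧ S.Lap v c y e) ∨ (e.tgt = s ∧ e.tick = 0 ∧
        TPath (S.FStep v) c (y - c.2).toNat (e.src, y) ∧ T.Holds v (e.src, y)) := by
    rintro c y e ⟨he, hr, hn, hc⟩
    have hn := nreach_withSink hn
    rcases List.mem_append.1 he with he | he
    · exact Or.inl ⟨he, he, hr, hn, hc⟩
    · obtain ⟨t, ht, rfl⟩ := List.mem_map.1 he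
      exact Or.inr ⟨rfl, rfl, hn.tpath, t, ht, rfl, hc⟩
  have key : ∀ {y : ℤ} {k : REdge}, ¬ (S.withSink T s).Lap v (s, 0) y k := by
    rintro y k ⟨hk, -, hn, -⟩
    have hks : k.src = s := by
      rcases (nreach_withSink hn).cases_head with h | ⟨d, ⟨f, hf, -, hfs, -⟩, -⟩
      · simp only [Prod.mk.injEq] at h; exact h.1.symm
      · exact absurd hfs (hS f hf).1
    rcases List.mem_append.1 hk with hk | hk
    · exact (hS _ hk).1 hks
    · obtain ⟨t, ht, rfl⟩ := List.mem_map.1 hk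
      exact hT t ht hks
  generalize S.withSink T s = W at h hlap key
  generalize hp : s = p at h
  induction h with
  | last h =>
    rcases hlap h with ⟨he, -⟩ | ⟨-, h₀, h₁, h₂⟩
    · exact absurd hp.symm (hS _ he).2
    · exact ⟨_, by simpa [h₀] using h₁, h₂⟩
  | @cons c y e D p h h' ih =>
    subst hp
    rcases hlap h with ⟨he, h₁⟩ | ⟨ht, -⟩
    · obtain ⟨c', h₂, h₃⟩ := ih rfl
      have k₁ := h'.nonneg
      have k₂ := (RPath.last h).nonneg
      rw [show (y - c.2 + (e.tick : ℤ) + D).toNat = (y - c.2 + e.tick).toNat + D.toNat by omega]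
      exact ⟨c', h₁.tpath.trans h₂, h₃⟩
    · exfalso
      rw [ht] at h'
      cases h' with
      | last h => exact key h
      | cons h _ => exact key h

/-- The added edges take no time, so reaching a target and reaching the sink by a reset have the
same durations. -/
theorem exists_tpath_iff {T : Target} {q : ℕ} {x : ℤ} {P : ℤ → Prop} :
    (∃ D, (S.withSink T (S.fresh T q)).RPath v (q, x) D (S.fresh T q) ∧ P D) ↔
      ∃ (D : ℕ) (c' : ℕ × ℤ), TPath (S.FStep v) (q, x) D c' ∧ P D ∧ T.Holds v c' := by
  obtain ⟨-, h₁, h₂⟩ := lt_fresh_target (S := S) (T := T) (q := q)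
  constructor
  · rintro ⟨D, h, hD⟩
    obtain ⟨c', hc, hT⟩ := exists_tpath_of_rpath
      (fun e he => ⟨(h₂ e he).1.ne, (h₂ e he).2.ne⟩) (fun t ht => (h₁ t ht).ne) h
    exact ⟨D.toNat, c', hc, by rwa [Int.toNat_of_nonneg h.nonneg], hT⟩
  · rintro ⟨D, c', h, hD, t, ht, hs, hc⟩
    have := rpath_of_tpath (S' := S.withSink T (S.fresh T q)) (fun e he => List.mem_append_left _ he)
      h (e := (t.1, false, t.2, true, S.fresh T q))
      (List.mem_append_right _ (List.mem_map.2 ⟨t, ht, rfl⟩)) rfl hs hc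
    exact ⟨D, by simpa [REdge.tick, REdge.tgt] using this, hD⟩

end Sys

@[fun_prop] theorem primrec_withSink {ι : Type*} [Primcodable ι] {S : ι → Sys}
    {T : ι → Sys.Target} {s : ι → ℕ} (hS : Primrec S) (hT : Primrec T) (hs : Primrec s) :
    Primrec fun i => (S i).withSink (T i) (s i) := by unfold Sys.withSink; fun_prop

@[fun_prop] theorem primrec_fresh {ι : Type*} [Primcodable ι] {S : ι → Sys}
    {T : ι → Sys.Target} {q : ι → ℕ} (hS : Primrec S) (hT : Primrec T) (hq : Primrec q) :
    Primrec fun i => (S i).fresh (T i) (q i) := by unfold Sys.fresh; fun_prop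

namespace Eff

theorem tpath_lt : Eff fun (i : (Sys × Sys.Target) × ℕ × LT) x v => ∃ (D : ℕ) (c' : ℕ × ℤ),
    TPath (i.1.1.FStep v) (i.2.1, x) D c' ∧ (D : ℤ) < i.2.2.eval v ∧ i.1.2.Holds v c' :=
  (rpath_lt.comp (f := fun i : (Sys × Sys.Target) × ℕ × LT =>
    (i.1.1.withSink i.1.2 (i.1.1.fresh i.1.2 i.2.1), i.2.1, i.1.1.fresh i.1.2 i.2.1, i.2.2))
    (by fun_prop)).congr fun _ _ v => Sys.exists_tpath_iff (P := fun D => D < LT.eval v _)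

theorem tpath_ge : Eff fun (i : (Sys × Sys.Target) × ℕ × LT) x v => ∃ (D : ℕ) (c' : ℕ × ℤ),
    TPath (i.1.1.FStep v) (i.2.1, x) D c' ∧ i.2.2.eval v ≤ (D : ℤ) ∧ i.1.2.Holds v c' :=
  (rpath_ge.comp (f := fun i : (Sys × Sys.Target) × ℕ × LT =>
    (i.1.1.withSink i.1.2 (i.1.1.fresh i.1.2 i.2.1), i.2.1, i.1.1.fresh i.1.2 i.2.1, i.2.2))
    (by fun_prop)).congr fun _ _ v => Sys.exists_tpath_iff (P := fun D => LT.eval v _ ≤ D)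

end Eff

/-! ### Runs and recurrent configurations -/

namespace Sys

variable {S : Sys} {v : ℕ → ℕ}

/-- Configurations that are visited again and again by some divergent run: just after a reset, or
after the last reset and beyond all thresholds. -/
def Recurrent (S : Sys) (v : ℕ → ℕ) (c : ℕ × ℤ) : Prop :=
  (c.2 = 0 ∧ ∃ D, S.RPath v c D c.1 ∧ 1 ≤ D) ∨
    ((∀ t ∈ S.thresholds, t.eval v ≤ c.2) ∧
      ∃ j < S.length + 1, S.NReach v c (c.1, c.2 + ((j + 1) * S.period : ℕ)))

/-- In the first case the same configuration returns after positive time. In the second the clock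
has grown, but beyond all thresholds the path can be repeated, shifted by a multiple of the period.
-/
theorem Recurrent.run {c : ℕ × ℤ} (h : S.Recurrent v c) : TRun (S.FStep v) c := by
  obtain ⟨q, x⟩ := c
  rcases h with ⟨h0, D, h, hD⟩ | ⟨ht, j, -, h⟩
  · dsimp only at h0 h
    subst h0
    refine tRun_of_recurrent (W := {(q, 0)}) ?_ rfl
    rintro _ rfl
    exact ⟨D.toNat, by omega, _, rfl, h.tpath⟩
  · dsimp only at ht h
    refine tRun_of_recurrent (W := {c | c.1 = q ∧ (∀ t ∈ S.thresholds, t.eval v ≤ c.2) ∧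
      S.NReach v c (c.1, c.2 + ((j + 1) * S.period : ℕ))}) ?_ ⟨rfl, ht, h⟩
    rintro ⟨p, y⟩ ⟨rfl, ht, h⟩
    dsimp only at ht h ⊢
    have hpos : 0 < (j + 1) * S.period := Nat.mul_pos (Nat.succ_pos j) S.period_pos
    refine ⟨(j + 1) * S.period, hpos, (p, y + ((j + 1) * S.period : ℕ)), ⟨rfl, ?_, ?_⟩, ?_⟩
    · intro t ht'
      have := ht t ht'
      dsimp only
      omega
    · refine (nreach_shift (Dvd.intro_left _ rfl) fun t ht' h' => ?_).1 h
      have := ht t ht'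
      omega
    · have := h.tpath
      simp only [add_sub_cancel_left, Int.toNat_natCast] at this
      exact this

theorem le_foldr_max {l : List LT} : ∀ t ∈ l, t.eval v ≤ l.foldr (fun t m => max (t.eval v) m) 0 := by
  induction l with
  | nil => simp
  | cons s l ih =>
    intro t ht
    rw [List.foldr_cons]
    rcases List.mem_cons.1 ht with rfl | ht
    · exact le_max_left _ _
    · exact (ih t ht).trans (le_max_right _ _)

/-- Some state is entered by infinitely many resets, as there are finitely many targets. Two of
these resets between which time passes give a path of positive duration from that state, at clock
value zero, back to it. -/
theorem exists_recurrent_of_resets {ρ : ℕ → ℕ × ℤ} {τ : ℕ → ℕ}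
    (hs : ∀ i, S.FStep v (ρ i) (τ i) (ρ (i + 1)))
    (hd : Filter.Tendsto (fun n => ∑ i ∈ Finset.range n, τ i) Filter.atTop Filter.atTop)
    (hr : ∀ n, ∃ i ≥ n, ∃ e ∈ S, e.src = (ρ i).1 ∧ e.cond.Holds v (ρ i).2 ∧ τ i = e.tick ∧
      e.reset = true ∧ ρ (i + 1) = (e.tgt, 0)) :
    ∃ i, S.Recurrent v (ρ i) := by
  choose f hf e he h₁ h₂ h₃ h₄ h₅ using hr
  obtain ⟨p, -, hp⟩ : ∃ p ∈ S.targets.toFinset, ∀ m, ∃ n ≥ m, (e n).tgt = p := by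
    by_contra! hcon
    choose! m hm using hcon
    have hmem : ∀ n, (e n).tgt ∈ S.targets.toFinset := fun n =>
      List.mem_toFinset.2 (List.mem_map.2 ⟨e n, he n, rfl⟩)
    exact hm _ (hmem (S.targets.toFinset.sup m)) _ (Finset.le_sup (hmem _)) rfl
  obtain ⟨n₁, -, hn₁⟩ := hp 0
  -- From `N` on, at least one time unit has passed since the first chosen reset.
  obtain ⟨N, hN⟩ := (Filter.tendsto_atTop_atTop.1 hd)
    (∑ i ∈ Finset.range (f n₁ + 1), τ i + 1)
  obtain ⟨n₂, hn₂, hp₂⟩ := hp (max N (f n₁ + 1))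
  have hle : f n₁ + 1 ≤ f n₂ := (le_max_right _ _).trans (hn₂.trans (hf n₂))
  obtain ⟨D, hD, hpath⟩ := tpath_of_steps hs hle
  have hr := rpath_of_tpath (List.Subset.refl S) hpath (he n₂) (h₄ n₂) (h₁ n₂) (h₂ n₂)
  have hge := hN (f n₂) ((le_max_left _ _).trans (hn₂.trans (hf n₂)))
  refine ⟨f n₁ + 1, Or.inl ⟨by rw [h₅], (D : ℤ) + (e n₂).tick, ?_, ?_⟩⟩
  · rw [hp₂] at hr
    rwa [show (ρ (f n₁ + 1)).1 = p by rw [h₅]; exact hn₁]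
  · omega

/-- After the last reset the clock grows with the total duration, so it passes all thresholds and
then takes all values in steps of the period. Among sufficiently many of these moments two share the
state. -/
theorem exists_recurrent_of_no_resets {ρ : ℕ → ℕ × ℤ} {τ : ℕ → ℕ}
    (hd : Filter.Tendsto (fun n => ∑ i ∈ Finset.range n, τ i) Filter.atTop Filter.atTop) {n₀ : ℕ}
    (hs : ∀ i ≥ n₀, S.NStep v (ρ i) (ρ (i + 1)) ∧ (ρ (i + 1)).2 = (ρ i).2 + τ i) :
    ∃ i, S.Recurrent v (ρ i) := by
  have hreach : ∀ i ≥ n₀, ∀ j ≥ i, S.NReach v (ρ i) (ρ j) := by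
    intro i hi j hj
    induction j, hj using Nat.le_induction with
    | base => exact .refl
    | succ j hj ih => exact ih.tail (hs j (hi.le.trans hj)).1
  have hclock : ∀ i ≥ n₀, (ρ i).2 + ((∑ k ∈ Finset.range n₀, τ k : ℕ) : ℤ) =
      (ρ n₀).2 + ((∑ k ∈ Finset.range i, τ k : ℕ) : ℤ) := by
    intro i hi
    induction i, hi using Nat.le_induction with
    | base => rfl
    | succ i hi ih => rw [Finset.sum_range_succ, (hs i hi).2]; push_cast at ih ⊢; linarith
  have hunb : ∀ M : ℤ, ∃ i ≥ n₀, M ≤ (ρ i).2 := by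
    intro M
    obtain ⟨N, hN⟩ := (Filter.tendsto_atTop_atTop.1 hd)
      ((M - (ρ n₀).2).toNat + ∑ k ∈ Finset.range n₀, τ k)
    have h₁ := hN (max N n₀) (le_max_left _ _)
    have h₂ := hclock (max N n₀) (le_max_right _ _)
    exact ⟨max N n₀, le_max_right _ _, by omega⟩
  obtain ⟨n₁, hn₁, hM⟩ := hunb (S.thresholds.foldr (fun t m => max (t.eval v) m) 0)
  have hthr : ∀ t ∈ S.thresholds, t.eval v ≤ (ρ n₁).2 := fun t ht => (le_foldr_max t ht).trans hM
  have hex : ∀ k : ℕ, ∃ i ≥ n₁, (ρ i).2 = (ρ n₁).2 + (k * S.period : ℕ) := by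
    intro k
    -- At the first index where the clock is at least the wanted value it equals that value, since
    -- it increases by at most one at a time.
    have hex' : ∃ i, n₁ ≤ i ∧ (ρ n₁).2 + (k * S.period : ℕ) ≤ (ρ i).2 := by
      obtain ⟨i, hi, h⟩ := hunb ((ρ n₁).2 + (k * S.period : ℕ))
      rcases le_total n₁ i with h' | h'
      · exact ⟨i, h', h⟩
      · exact ⟨n₁, le_rfl, h.trans (hreach i hi n₁ h').le⟩
    classical
    obtain ⟨h₁, h₂⟩ := Nat.find_spec hex'
    have hmin := fun m => Nat.find_min hex' (m := m)
    generalize Nat.find hex' = i at h₁ h₂ hmin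
    refine ⟨i, h₁, le_antisymm ?_ h₂⟩
    rcases h₁.eq_or_lt with rfl | h₁
    · omega
    · obtain ⟨j, rfl⟩ : ∃ j, i = j + 1 := ⟨i - 1, by omega⟩
      have h₃ := hmin j (by omega)
      have h₄ := (hs j (by omega)).1.le
      rw [not_and, not_le] at h₃
      have := h₃ (by omega)
      omega
  choose g hg hgv using hex
  have hgm : ∀ k l, k < l → g k ≤ g l := by
    intro k l hkl
    by_contra hlt
    have h₁ := (hreach (g l) (hn₁.le.trans (hg l)) (g k) (by omega)).le
    rw [hgv, hgv] at h₁
    have : k * S.period < l * S.period := Nat.mul_lt_mul_of_pos_right hkl S.period_pos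
    omega
  -- There are `S.length + 2` moments but at most `S.length + 1` states: the present one and the
  -- targets of edges.
  obtain ⟨k, hk, l, hl, hkl, e⟩ := Finset.exists_ne_map_eq_of_card_lt_of_maps_to
    (s := Finset.range (S.length + 2)) (t := insert (ρ n₁).1 S.targets.toFinset)
    (f := fun k => (ρ (g k)).1) (by
      rw [Finset.card_range]
      refine Nat.lt_succ_of_le ((Finset.card_insert_le _ _).trans (Nat.succ_le_succ ?_))
      have := S.targets.toFinset_card_le
      simpa only [targets, List.length_map] using this)
    (fun k _ => by
      have := (hreach n₁ hn₁ (g k) (hg k)).fst_mem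
      simpa using this)
  wlog hlt : k < l generalizing k l
  · exact this l hl k hk hkl.symm e.symm (by omega)
  rw [Finset.mem_range] at hk hl
  refine ⟨g k, Or.inr ⟨fun t ht => ?_, l - k - 1, by omega, ?_⟩⟩
  · have := hthr t ht
    rw [hgv]
    omega
  · have h := hreach (g k) (hn₁.le.trans (hg k)) (g l) (hgm k l hlt)
    have e' : ρ (g l) = ((ρ (g k)).1, (ρ (g k)).2 + ((l - k - 1 + 1) * S.period : ℕ)) := by
      refine Prod.ext e.symm ?_
      obtain ⟨d, rfl⟩ := Nat.exists_eq_add_of_lt hlt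
      rw [hgv, hgv, show k + d + 1 - k - 1 + 1 = d + 1 by omega]
      push_cast
      ring
    rwa [e'] at h

/-- A run resets the clock infinitely often or never again from some position on, and both cases
lead to a recurrent configuration. -/
theorem tRun_iff {c : ℕ × ℤ} : TRun (S.FStep v) c ↔
    ∃ (D : ℕ) (c' : ℕ × ℤ), TPath (S.FStep v) c D c' ∧ S.Recurrent v c' := by
  constructor
  · rintro ⟨ρ, τ, rfl, hs, hd⟩
    obtain ⟨i, hi⟩ : ∃ i, S.Recurrent v (ρ i) := by
      by_cases hr : ∀ n, ∃ i ≥ n, ∃ e ∈ S, e.src = (ρ i).1 ∧ e.cond.Holds v (ρ i).2 ∧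
          τ i = e.tick ∧ e.reset = true ∧ ρ (i + 1) = (e.tgt, 0)
      · exact exists_recurrent_of_resets hs hd hr
      · push Not at hr
        obtain ⟨n₀, h⟩ := hr
        refine exists_recurrent_of_no_resets hd (n₀ := n₀) fun i hi => ?_
        obtain ⟨e, he, h₁, h₂, h₃, h₄⟩ := hs i
        have hre : e.reset = false := by
          by_contra hre
          rw [Bool.not_eq_false] at hre
          exact h i hi e he h₁ h₂ h₃ hre (by simpa [hre] using h₄)
        refine ⟨⟨e, he, hre, h₁, h₂, by simpa [hre] using h₄⟩, ?_⟩
        rw [h₄, h₃]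
        simp [hre]
    obtain ⟨D, -, h⟩ := tpath_of_steps hs (Nat.zero_le i)
    exact ⟨D, _, h, hi⟩
  · rintro ⟨D, c', h, h'⟩
    exact h.run h'.run

theorem tpath_fst_mem {c c' : ℕ × ℤ} {D : ℕ} (h : TPath (S.FStep v) c D c') :
    c'.1 ∈ c.1 :: S.targets := by
  induction h with
  | refl => simp
  | @head c d c' t D h _ ih =>
    obtain ⟨e, he, -, -, -, rfl⟩ := h
    rcases List.mem_cons.1 ih with ih | ih
    · rw [ih]
      exact List.mem_cons_of_mem _ (List.mem_map.2 ⟨e, he, rfl⟩)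
    · exact List.mem_cons_of_mem _ ih

end Sys

namespace Eff

theorem recurrent : Eff fun (i : Sys × ℕ) x v => i.1.Recurrent v (i.2, x) := by
  unfold Sys.Recurrent
  refine or (and ?_ ?_) (and ?_ (ex_lt (by fun_prop) ?_))
  · exact (posEq (Y := fun _ : Sys × ℕ => Pos.clock) (Z := fun _ => Sys.zeroPos) (by fun_prop)
      (by fun_prop)).congr fun i x v => by simp [Sys.zeroPos]
  · exact (rpath_ge.comp (f := fun i : Sys × ℕ => (i.1, i.2, i.2, LT.const 1))
      (by fun_prop)).congr fun i x v => by simp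
  · exact (all (l := fun i : Sys × ℕ => i.1.thresholds) (by fun_prop)
      (P := fun i t x v => (Pos.ofTerm t).eval v x ≤ Pos.clock.eval v x)
      (posLe (by fun_prop) (by fun_prop))).congr fun i x v => by simp
  · exact (nreach.comp (f := fun i : (Sys × ℕ) × ℕ => (i.1.1, (i.1.2, Pos.clock),
      (i.1.2, Pos.clock.shift ((i.2 + 1) * i.1.1.period : ℕ)))) (by fun_prop)).congr
      fun i x v => by simp

/-- Recurrence is definable state by state and serves as the target; the lower bound zero makes the
condition on the duration void. -/
theorem tRun : Eff fun (i : Sys × ℕ) x v => TRun (i.1.FStep v) (i.2, x) := by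
  obtain ⟨F, hF, hR⟩ := recurrent
  refine (tpath_ge.comp (f := fun i : Sys × ℕ =>
    ((i.1, (i.2 :: i.1.targets).map fun a => (a, F (i.1, a))), i.2, LT.const 0))
    (by fun_prop)).congr fun i x v => ?_
  rw [Sys.tRun_iff]
  refine exists_congr fun D => exists_congr fun c' => and_congr_right fun h => ?_
  have hmem := Sys.tpath_fst_mem h
  simp only [LT.eval_const, Nat.cast_nonneg, true_and, Sys.Target.Holds, List.mem_map,
    exists_exists_and_eq_and, hR]
  exact ⟨fun ⟨a, _, e, h'⟩ => by subst e; exact h', fun h' => ⟨_, hmem, rfl, h'⟩⟩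

end Eff

/-! ### Modalities over a timed transition relation -/

section Modal

variable {C : Type*}

/-- `ρ`, with the durations `τ`, is an infinite path of infinite duration. -/
def Divergent (r : C → ℕ → C → Prop) (c : C) (ρ : ℕ → C) (τ : ℕ → ℕ) : Prop :=
  ρ 0 = c ∧ (∀ i, r (ρ i) (τ i) (ρ (i + 1))) ∧
    Filter.Tendsto (fun n => ∑ i ∈ Finset.range n, τ i) Filter.atTop Filter.atTop

/-- The transitions from configurations in `P`. -/
def Guarded (r : C → ℕ → C → Prop) (P : C → Prop) (c : C) (t : ℕ) (c' : C) : Prop :=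
  P c ∧ r c t c'

variable {r : C → ℕ → C → Prop} {P Q : C → Prop}

theorem Divergent.cons {c d : C} {t : ℕ} (h : r c t d) {ρ : ℕ → C} {τ : ℕ → ℕ}
    (hd : Divergent r d ρ τ) :
    Divergent r c (fun i => Nat.casesOn i c ρ) (fun i => Nat.casesOn i t τ) := by
  obtain ⟨rfl, h₁, h₂⟩ := hd
  refine ⟨rfl, ?_, ?_⟩
  · rintro (_ | i)
    · exact h
    · exact h₁ i
  · rw [← Filter.tendsto_add_atTop_iff_nat 1]
    refine Filter.tendsto_atTop_mono (fun n => ?_) h₂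
    rw [Finset.sum_range_succ']
    exact Nat.le_add_right _ _

theorem Divergent.le_sum {c : C} {ρ : ℕ → C} {τ : ℕ → ℕ} (hd : Divergent r c ρ τ) (b : ℕ) :
    ∃ i, b ≤ ∑ j ∈ Finset.range i, τ j :=
  (Filter.tendsto_atTop.1 hd.2.2 b).exists

theorem exists_next_iff {c : C} : (∃ ρ τ, Divergent r c ρ τ ∧ P (ρ 1)) ↔
    ∃ t d, r c t d ∧ P d ∧ TRun r d := by
  constructor
  · rintro ⟨ρ, τ, ⟨rfl, h₁, h₂⟩, hP⟩
    exact ⟨_, _, h₁ 0, hP, TRun.suffix h₁ h₂ 1⟩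
  · rintro ⟨t, d, h, hP, ρ, τ, hd⟩
    refine ⟨_, _, Divergent.cons h hd, ?_⟩
    simpa [hd.1] using hP

/-- The part of the run before the witness becomes a path of guarded transitions. The guard is
tested at the source of each transition, so `P` is not required at the end, from where any run may
continue. -/
theorem exists_until_iff {K : ℕ → Prop} {c : C} :
    (∃ ρ τ, Divergent r c ρ τ ∧
      ∃ i, K (∑ j ∈ Finset.range i, τ j) ∧ Q (ρ i) ∧ ∀ j < i, P (ρ j)) ↔
    ∃ D d, TPath (Guarded r P) c D d ∧ K D ∧ Q d ∧ TRun r d := by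
  constructor
  · rintro ⟨ρ, τ, ⟨rfl, h₁, h₂⟩, i, hK, hQ, hP⟩
    exact ⟨_, _, tpath_iff.2 ⟨i, ρ, τ, rfl, rfl, fun j hj => ⟨hP j hj, h₁ j⟩, rfl⟩, hK, hQ,
      TRun.suffix h₁ h₂ i⟩
  · rintro ⟨D, d, hp, hK, hQ, hd⟩
    suffices h : ∃ ρ τ, Divergent r c ρ τ ∧ ∃ i, ∑ j ∈ Finset.range i, τ j = D ∧ ρ i = d ∧
        ∀ j < i, P (ρ j) by
      obtain ⟨ρ, τ, h, i, rfl, rfl, h'⟩ := h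
      exact ⟨ρ, τ, h, i, hK, hQ, h'⟩
    clear hK hQ
    induction hp with
    | refl c =>
      obtain ⟨ρ, τ, h⟩ := hd
      exact ⟨ρ, τ, h, 0, by simp, h.1, by simp⟩
    | @head c d c' t D h _ ih =>
      obtain ⟨ρ, τ, h', i, h₁, h₂, h₃⟩ := ih hd
      refine ⟨_, _, h'.cons h.2, i + 1, ?_, h₂, ?_⟩
      · rw [Finset.sum_range_succ', add_comm, ← h₁]
        rfl
      · rintro (_ | j) hj
        · exact h.1
        · exact h₃ j (by omega)

/-- A run violates an until if it reaches, before `Q` has held, a position where neither `P` nor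
`Q` holds or where `Q` is no longer of use. -/
theorem forall_until_iff {K : ℕ → Prop} (hK : ∀ a b, a ≤ b → K b → K a) (hb : ∃ b, ¬ K b)
    {c : C} : (∀ ρ τ, Divergent r c ρ τ →
      ∃ i, K (∑ j ∈ Finset.range i, τ j) ∧ Q (ρ i) ∧ ∀ j < i, P (ρ j)) ↔
    ¬ ((∃ D d, TPath (Guarded r fun c => ¬ Q c) c D d ∧ True ∧ (¬ P d ∧ ¬ Q d) ∧ TRun r d) ∨
      ∃ D d, TPath (Guarded r fun c => ¬ Q c) c D d ∧ ¬ K D ∧ True ∧ TRun r d) := by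
  rw [← exists_until_iff (K := fun _ => True), ← exists_until_iff (K := fun D => ¬ K D)]
  classical
  constructor
  · rintro h (⟨ρ, τ, hd, j, -, ⟨hP, hQ⟩, hj⟩ | ⟨ρ, τ, hd, j, hKj, -, hj⟩)
    · obtain ⟨i, -, hQi, hPi⟩ := h ρ τ hd
      rcases lt_trichotomy i j with h | rfl | h
      · exact hj i h hQi
      · exact hQ hQi
      · exact hP (hPi j h)
    · obtain ⟨i, hKi, hQi, -⟩ := h ρ τ hd
      rcases lt_or_ge i j with h | h
      · exact hj i h hQi
      · exact hKj (hK _ _ (Finset.sum_le_sum_of_subset (Finset.range_mono h)) hKi)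
  · intro h ρ τ hd
    by_contra! hcon
    refine h ?_
    obtain ⟨b, hb⟩ := hb
    obtain ⟨n, hn⟩ := hd.le_sum b
    -- From `n` on it is too late for `Q`. If `Q` holds in time at some earlier position, then `P`
    -- fails before the first such position, where `Q` has not held either. If not, `Q` fails until
    -- `K` does.
    by_cases hex : ∃ i < n, Q (ρ i) ∧ K (∑ j ∈ Finset.range i, τ j)
    · obtain ⟨h₁, h₂, h₃⟩ := Nat.find_spec hex
      have hmin := fun m => Nat.find_min hex (m := m)
      generalize Nat.find hex = i at h₁ h₂ h₃ hmin
      obtain ⟨j, hj, hPj⟩ := hcon i h₃ h₂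
      have hKj : ∀ k ≤ i, K (∑ j ∈ Finset.range k, τ j) := fun k hk =>
        hK _ _ (Finset.sum_le_sum_of_subset (Finset.range_mono hk)) h₃
      have hQ : ∀ k < i, ¬ Q (ρ k) := fun k hk hQ => hmin k hk ⟨by omega, hQ, hKj k hk.le⟩
      exact Or.inl ⟨ρ, τ, hd, j, trivial, ⟨hPj, hQ j hj⟩, fun k hk => hQ k (hk.trans hj)⟩
    · push Not at hex
      have hKn : ∃ i, ¬ K (∑ j ∈ Finset.range i, τ j) := ⟨n, fun h => hb (hK _ _ hn h)⟩
      have h₁ := Nat.find_spec hKn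
      have hle : Nat.find hKn ≤ n := Nat.find_min' hKn fun h => hb (hK _ _ hn h)
      have hmin := fun m => Nat.find_min hKn (m := m)
      generalize Nat.find hKn = i at h₁ hle hmin
      exact Or.inr ⟨ρ, τ, hd, i, h₁, trivial, fun k hk hQ =>
        hex k (hk.trans_le hle) hQ (not_not.1 (hmin k hk))⟩

/-- Without a bound there is no last useful position, so the second kind of violation is a whole run
along which `Q` never holds. -/
theorem forall_plain_until_iff {c : C} : (∀ ρ τ, Divergent r c ρ τ →
      ∃ i, Q (ρ i) ∧ ∀ j < i, P (ρ j)) ↔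
    ¬ ((∃ D d, TPath (Guarded r fun c => ¬ Q c) c D d ∧ True ∧ (¬ P d ∧ ¬ Q d) ∧ TRun r d) ∨
      TRun (Guarded r fun c => ¬ Q c) c) := by
  rw [← exists_until_iff (K := fun _ => True)]
  classical
  constructor
  · rintro h (⟨ρ, τ, hd, j, -, ⟨hP, hQ⟩, hj⟩ | ⟨ρ, τ, h₀, h₁, h₂⟩)
    · obtain ⟨i, hQi, hPi⟩ := h ρ τ hd
      rcases lt_trichotomy i j with h | rfl | h
      · exact hj i h hQi
      · exact hQ hQi
      · exact hP (hPi j h)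
    · obtain ⟨i, hQi, -⟩ := h ρ τ ⟨h₀, fun i => (h₁ i).2, h₂⟩
      exact (h₁ i).1 hQi
  · intro h ρ τ hd
    by_contra! hcon
    refine h ?_
    by_cases hex : ∃ i, Q (ρ i)
    · have h₁ := Nat.find_spec hex
      have hmin := fun m => Nat.find_min hex (m := m)
      generalize Nat.find hex = i at h₁ hmin
      obtain ⟨j, hj, hPj⟩ := hcon i h₁
      exact Or.inl ⟨ρ, τ, hd, j, trivial, ⟨hPj, hmin j hj⟩, fun k hk => hmin k (hk.trans hj)⟩
    · push Not at hex
      exact Or.inr ⟨ρ, τ, hd.1, fun i => ⟨hex _, hd.2.1 i⟩, hd.2.2⟩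

/-! ### Change of configurations -/

variable {C' : Type*} {r' : C' → ℕ → C' → Prop} {f : C → C'}

/-- By hypothesis a transition from the image of `f` stays there and lifts, so paths can be lifted
one transition at a time. -/
theorem tpath_map_iff (h : ∀ c t d', r' (f c) t d' ↔ ∃ d, d' = f d ∧ r c t d) {c : C} {D : ℕ}
    {d' : C'} : TPath r' (f c) D d' ↔ ∃ d, d' = f d ∧ TPath r c D d := by
  constructor
  · intro hp
    generalize hc : f c = c' at hp
    induction hp generalizing c with
    | refl => exact ⟨c, hc.symm, .refl c⟩
    | head h₁ _ ih =>
      subst hc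
      obtain ⟨e, rfl, he⟩ := (h _ _ _).1 h₁
      obtain ⟨d, hd, hp⟩ := ih rfl
      exact ⟨d, hd, .head he hp⟩
  · rintro ⟨d, rfl, hp⟩
    induction hp with
    | refl => exact .refl _
    | head h₁ _ ih => exact .head ((h _ _ _).2 ⟨_, rfl, h₁⟩) ih

theorem tRun_map_iff (hf : Function.Injective f)
    (h : ∀ c t d', r' (f c) t d' ↔ ∃ d, d' = f d ∧ r c t d) {c : C} :
    TRun r' (f c) ↔ TRun r c := by
  constructor
  · rintro ⟨ρ, τ, h₀, h₁, h₂⟩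
    have hr : ∀ i, ∃ d, f d = ρ i := by
      intro i
      induction i with
      | zero => exact ⟨c, h₀.symm⟩
      | succ i ih =>
        obtain ⟨d, hd⟩ := ih
        have := h₁ i
        rw [← hd, h] at this
        obtain ⟨e, he, -⟩ := this
        exact ⟨e, he.symm⟩
    choose σ hσ using hr
    refine ⟨σ, τ, hf (by rw [hσ, h₀]), fun i => ?_, h₂⟩
    have := h₁ i
    rw [← hσ, ← hσ, h] at this
    obtain ⟨e, he, h'⟩ := this
    rwa [hf he]
  · rintro ⟨ρ, τ, rfl, h₁, h₂⟩
    exact ⟨fun i => f (ρ i), τ, rfl, fun i => (h _ _ _).2 ⟨_, rfl, h₁ i⟩, h₂⟩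

end Modal

/-! ### Guards in disjunctive normal form -/

/-- The coefficients and the constant of a linear term. -/
def LinTerm.toLT (α : LinTerm) : LT := (α.coeffs, α.const)

theorem LinTerm.eval_toLT (v : ℕ → ℕ) (α : LinTerm) : α.toLT.eval v = α.eval v := rfl

/-- The linear term with a given code. -/
def parseLT (n : ℕ) : LT := (Encodable.decode n : Option LT).getD (LT.const 0)

theorem parseLT_code (α : LinTerm) : parseLT α.code = α.toLT := by
  unfold parseLT LinTerm.code
  rw [Encodable.encodek]
  rfl

@[fun_prop] theorem primrec_parseLT {ι : Type*} [Primcodable ι] {f : ι → ℕ} (hf : Primrec f) :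
    Primrec fun i => parseLT (f i) := by unfold parseLT; fun_prop

/-- The literal `Y ≤ Z + n`. -/
def leLit (Y Z : Pos) (n : ℤ) : Lit :=
  (true, 0, Eff.diffCoeff Y Z, LT.add (LT.add Z.2 (LT.neg Y.2)) (LT.const n))

theorem holds_leLit (v : ℕ → ℕ) (x : ℤ) (Y Z : Pos) (n : ℤ) :
    (leLit Y Z n).Holds v x ↔ Y.eval v x ≤ Z.eval v x + n := by
  have := Eff.diffCoeff_eval Y Z v x
  simp only [leLit, Lit.Holds, Lit.Atom, Lit.val, LT.eval_add, LT.eval_const, if_pos, true_iff]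
    at this ⊢
  constructor <;> intro h <;> linarith

/-- The literal `Y ≡ Z` modulo `m`. -/
def congLit (m : ℕ) (Y Z : Pos) : Lit :=
  (true, m, Eff.diffCoeff Y Z, LT.add Z.2 (LT.neg Y.2))

theorem holds_congLit (v : ℕ → ℕ) (x : ℤ) {m : ℕ} (hm : 0 < m) (Y Z : Pos) :
    (congLit m Y Z).Holds v x ↔ Y.eval v x ≡ Z.eval v x [ZMOD m] := by
  have h : ∀ z, Lit.Atom m z ↔ (m : ℤ) ∣ z := fun z => by rw [Lit.Atom, if_neg hm.ne']
  simp only [congLit, Lit.Holds, Lit.val, true_iff, h]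
  rw [Eff.diffCoeff_eval, Int.modEq_iff_dvd]

theorem DNF.holds_unit (v : ℕ → ℕ) (x : ℤ) (l : Lit) : Holds v x [[l]] ↔ l.Holds v x := by
  rw [Holds]; simp only [List.mem_singleton, exists_eq_left, forall_eq]

theorem DNF.holds_pair (v : ℕ → ℕ) (x : ℤ) (l m : Lit) :
    Holds v x [[l, m]] ↔ l.Holds v x ∧ m.Holds v x := by
  rw [Holds]
  simp only [exists_eq_left, List.mem_cons, forall_eq_or_imp, List.not_mem_nil,
    or_false, forall_eq]

/-- The comparison of `Y` and `Z` by the symbol with code `k`. -/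
def cmpDNF (k : ℕ) (Y Z : Pos) : DNF :=
  ([[[leLit Y Z 0, leLit Z Y 0]], [[leLit Y Z (-1)]], [[leLit Y Z 0]], [[leLit Z Y (-1)]],
    [[leLit Z Y 0]]] : List DNF).getD k []

theorem holds_cmpDNF (v : ℕ → ℕ) (x : ℤ) (c : Cmp) (Y Z : Pos) :
    (cmpDNF c.code Y Z).Holds v x ↔ c.Holds (Y.eval v x) (Z.eval v x) := by
  cases c <;> simp [cmpDNF, Cmp.code, DNF.holds_unit, DNF.holds_pair, holds_leLit, Cmp.Holds]; omega

/-- The comparison of `Y` and `Z` by the guard symbol with code `k`. -/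
def gcmpDNF (k : ℕ) (Y Z : Pos) : DNF :=
  ([cmpDNF k.unpair.2 Y Z, [[congLit k.unpair.2 Y Z, leLit Y Z 0]],
    [[congLit k.unpair.2 Y Z, leLit Z Y 0]]] : List DNF).getD k.unpair.1 []

theorem holds_gcmpDNF (v : ℕ → ℕ) (x : ℤ) (c : GCmp) (Y Z : Pos) :
    (gcmpDNF c.code Y Z).Holds v x ↔ c.Holds (Y.eval v x) (Z.eval v x) := by
  cases c with
  | base c => simpa [gcmpDNF, GCmp.code, GCmp.Holds] using holds_cmpDNF v x c Y Z
  | congLe a =>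
    simp [gcmpDNF, GCmp.code, DNF.holds_pair, holds_leLit, holds_congLit _ _ a.pos, GCmp.Holds]
  | congGe a =>
    simp [gcmpDNF, GCmp.code, DNF.holds_pair, holds_leLit, holds_congLit _ _ a.pos, GCmp.Holds]

section

variable {ι : Type*} [Primcodable ι]

@[fun_prop] theorem primrec_leLit {Y Z : ι → Pos} {n : ι → ℤ} (hY : Primrec Y) (hZ : Primrec Z)
    (hn : Primrec n) : Primrec fun i => leLit (Y i) (Z i) (n i) := by
  unfold leLit Eff.diffCoeff; fun_prop

@[fun_prop] theorem primrec_congLit {Y Z : ι → Pos} {m : ι → ℕ} (hY : Primrec Y) (hZ : Primrec Z)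
    (hm : Primrec m) : Primrec fun i => congLit (m i) (Y i) (Z i) := by
  unfold congLit Eff.diffCoeff; fun_prop

@[fun_prop] theorem primrec_cmpDNF {Y Z : ι → Pos} {k : ι → ℕ} (hY : Primrec Y) (hZ : Primrec Z)
    (hk : Primrec k) : Primrec fun i => cmpDNF (k i) (Y i) (Z i) := by
  unfold cmpDNF; fun_prop

@[fun_prop] theorem primrec_gcmpDNF {Y Z : ι → Pos} {k : ι → ℕ} (hY : Primrec Y)
    (hZ : Primrec Z) (hk : Primrec k) : Primrec fun i => gcmpDNF (k i) (Y i) (Z i) := by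
  unfold gcmpDNF; fun_prop

end

def Guard.toDNF : Guard → DNF
  | .clock c α => gcmpDNF c.code Pos.clock (Pos.ofTerm α.toLT)
  | .param c α β => gcmpDNF c.code (Pos.ofTerm α.toLT) (Pos.ofTerm β.toLT)
  | .not g => g.toDNF.neg
  | .and g h => g.toDNF.conj h.toDNF
  | .or g h => g.toDNF ++ h.toDNF

theorem Guard.holds_toDNF (v : ℕ → ℕ) (x : ℕ) (g : Guard) :
    g.toDNF.Holds v x ↔ g.Holds v x := by
  induction g with
  | clock c α => simp [toDNF, Guard.Holds, holds_gcmpDNF, LinTerm.eval_toLT]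
  | param c α β => simp [toDNF, Guard.Holds, holds_gcmpDNF, LinTerm.eval_toLT]
  | not g ih => simp [toDNF, Guard.Holds, DNF.holds_neg, ih]
  | and g h ih ih' => simp [toDNF, Guard.Holds, DNF.holds_conj, ih, ih']
  | or g h ih ih' => simp [toDNF, Guard.Holds, DNF.holds_append, ih, ih']

/-- The normal form of the guard whose code is the length of `tbl`, when `tbl` lists the normal
forms for the smaller codes. -/
def guardStep (tbl : List DNF) : DNF :=
  ([gcmpDNF tbl.length.unpair.2.unpair.1 Pos.clock
      (Pos.ofTerm (parseLT tbl.length.unpair.2.unpair.2)),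
    gcmpDNF tbl.length.unpair.2.unpair.1
      (Pos.ofTerm (parseLT tbl.length.unpair.2.unpair.2.unpair.1))
      (Pos.ofTerm (parseLT tbl.length.unpair.2.unpair.2.unpair.2)),
    (tbl.getD tbl.length.unpair.2 []).neg,
    (tbl.getD tbl.length.unpair.2.unpair.1 []).conj (tbl.getD tbl.length.unpair.2.unpair.2 []),
    tbl.getD tbl.length.unpair.2.unpair.1 [] ++ tbl.getD tbl.length.unpair.2.unpair.2 []] :
    List DNF).getD tbl.length.unpair.1 []

def parseGuard (n : ℕ) : DNF := courseRec (fun (_ : Unit) tbl => guardStep tbl) () n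

/-- The tags of the recursive constructors are at least two, so the components have smaller codes,
as course-of-values recursion requires. -/
theorem lt_pair_pos_left {a b : ℕ} (ha : 2 ≤ a) : b < Nat.pair a b := by
  have h₁ := Nat.add_le_pair a b
  omega

theorem parseGuard_code (g : Guard) : parseGuard g.code = g.toDNF := by
  have left := fun a b : ℕ => Nat.left_le_pair a b
  have right := fun a b : ℕ => Nat.right_le_pair a b
  have key : ∀ n, parseGuard n = guardStep (table (fun (_ : Unit) tbl => guardStep tbl) () n) :=
    fun n => rfl
  have get : ∀ {m n}, m < n → (table (fun (_ : Unit) tbl => guardStep tbl) () n).getD m [] =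
      parseGuard m := fun h => table_getD _ _ _ h
  induction g with
  | clock c α => rw [key]; simp [guardStep, table_length, Guard.code, parseLT_code, Guard.toDNF]
  | param c α β => rw [key]; simp [guardStep, table_length, Guard.code, parseLT_code, Guard.toDNF]
  | not g ih =>
    rw [key, guardStep, table_length, Guard.code, Nat.unpair_pair]
    dsimp only
    rw [get (lt_pair_pos_left le_rfl), ih]
    rfl
  | and g h ih ih' =>
    rw [key, guardStep, table_length, Guard.code, Nat.unpair_pair]
    dsimp only
    rw [Nat.unpair_pair]
    dsimp only
    rw [get ((left _ _).trans_lt (lt_pair_pos_left (by omega))),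
      get ((right _ _).trans_lt (lt_pair_pos_left (by omega))), ih, ih']
    rfl
  | or g h ih ih' =>
    rw [key, guardStep, table_length, Guard.code, Nat.unpair_pair]
    dsimp only
    rw [Nat.unpair_pair]
    dsimp only
    rw [get ((left _ _).trans_lt (lt_pair_pos_left (by omega))),
      get ((right _ _).trans_lt (lt_pair_pos_left (by omega))), ih, ih']
    rfl

theorem primrec_guardStep : Primrec guardStep := by unfold guardStep; fun_prop

@[fun_prop] theorem primrec_parseGuard {ι : Type*} [Primcodable ι] {f : ι → ℕ}
    (hf : Primrec f) : Primrec fun i => parseGuard (f i) :=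
  primrec_courseRec (primrec_guardStep.comp Primrec.snd) (by fun_prop) hf

/-! ### Automata with states in `ℕ` -/

/-- Edges, with guards on the clock after the time step, labels, and invariants. -/
abbrev TA : Type := Sys × List (List ℕ) × List DNF

def Automaton.toTA (A : Automaton) : TA :=
  (A.edges.map fun e => ((e.src : ℕ), decide ((e.tick : ℕ) = 1), e.guard.toDNF, e.reset,
    (e.tgt : ℕ)), List.ofFn A.label, List.ofFn fun q => (A.inv q).toDNF)

def parseTA (n : ℕ) : TA :=
  let a := (Encodable.decode n : Option (ℕ × List ℕ × List (List ℕ) × List ℕ)).getD (0, [], [], [])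
  (a.2.1.map fun n =>
    let e := (Encodable.decode n : Option (ℕ × ℕ × ℕ × Bool × ℕ)).getD (0, 0, 0, false, 0)
    (e.1, decide (e.2.1 = 1), parseGuard e.2.2.1, e.2.2.2.1, e.2.2.2.2),
    a.2.2.1, a.2.2.2.map parseGuard)

theorem parseTA_code (A : Automaton) : parseTA A.code = A.toTA := by
  unfold parseTA Automaton.code
  rw [Encodable.encodek]
  simp only [Option.getD_some, List.map_map, Automaton.toTA, List.map_ofFn, Function.comp_def,
    parseGuard_code, Edge.code, Encodable.encodek]

@[fun_prop] theorem primrec_parseTA {ι : Type*} [Primcodable ι] {f : ι → ℕ} (hf : Primrec f) :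
    Primrec fun i => parseTA (f i) := by unfold parseTA; fun_prop

/-! ### Satisfaction sets of formulas, as one normal form per state -/

/-- Of these normal forms only their correctness and the primitive recursiveness of the function
matter. Choosing the function does not impair effectiveness. -/
noncomputable def runDNF : Sys × ℕ → DNF := Eff.tRun.choose

noncomputable def pathLtDNF : (Sys × Sys.Target) × ℕ × LT → DNF := Eff.tpath_lt.choose

noncomputable def pathGeDNF : (Sys × Sys.Target) × ℕ × LT → DNF := Eff.tpath_ge.choose

theorem holds_runDNF (v : ℕ → ℕ) (x : ℤ) (i : Sys × ℕ) :
    (runDNF i).Holds v x ↔ TRun (i.1.FStep v) (i.2, x) := Eff.tRun.choose_spec.2 i x v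

theorem holds_pathLtDNF (v : ℕ → ℕ) (x : ℤ) (i : (Sys × Sys.Target) × ℕ × LT) :
    (pathLtDNF i).Holds v x ↔ ∃ (D : ℕ) (c' : ℕ × ℤ), TPath (i.1.1.FStep v) (i.2.1, x) D c' ∧
      (D : ℤ) < i.2.2.eval v ∧ i.1.2.Holds v c' := Eff.tpath_lt.choose_spec.2 i x v

theorem holds_pathGeDNF (v : ℕ → ℕ) (x : ℤ) (i : (Sys × Sys.Target) × ℕ × LT) :
    (pathGeDNF i).Holds v x ↔ ∃ (D : ℕ) (c' : ℕ × ℤ), TPath (i.1.1.FStep v) (i.2.1, x) D c' ∧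
      i.2.2.eval v ≤ (D : ℤ) ∧ i.1.2.Holds v c' := Eff.tpath_ge.choose_spec.2 i x v

namespace TA

/-- One normal form per state. -/
def perState (p : TA) (f : ℕ → DNF) : List DNF := (List.range p.2.2.length).map f

/-- The transitions from configurations that satisfy `Φ`. -/
def sys (p : TA) (Φ : List DNF) : Sys := p.1.map fun e =>
  -- The guard is tested after the time step and the invariant of the target after a possible reset.
  -- Both are pulled back to the clock value before the transition by substitution.
  (e.src, e.2.1, (Φ.getD e.src []).conj ((p.2.2.getD e.src []).conj
    ((e.cond.subst (Pos.clock.shift e.tick)).conj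
      ((p.2.2.getD e.tgt []).subst (bif e.reset then Sys.zeroPos else Pos.clock.shift e.tick)))),
    e.reset, e.tgt)

def top (p : TA) : List DNF := p.perState fun _ => [[]]

/-- The configurations where a run starts. -/
noncomputable def live (p : TA) : List DNF := p.perState fun q => runDNF (p.sys p.top, q)

def neg (p : TA) (Φ : List DNF) : List DNF := p.perState fun q => (Φ.getD q []).neg

def and (p : TA) (Φ Ψ : List DNF) : List DNF := p.perState fun q => (Φ.getD q []).conj (Ψ.getD q [])

def or (p : TA) (Φ Ψ : List DNF) : List DNF := p.perState fun q => Φ.getD q [] ++ Ψ.getD q []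

/-- Where the atomic proposition `s` holds. -/
def atomic (p : TA) (s : ℕ) : List DNF := p.perState fun q =>
  (p.2.1.getD q []).flatMap fun t => bif decide (t = s) then [[]] else []

def constant (p : TA) (D : DNF) : List DNF := p.perState fun _ => D

/-- This describes a single transition; that a run continues from its end has to be part of `Φ`. -/
def next (p : TA) (Φ : List DNF) : List DNF := p.perState fun q => (p.sys p.top).flatMap fun e =>
  bif decide (e.src = q) then e.cond.conj
    ((Φ.getD e.tgt []).subst (bif e.reset then Sys.zeroPos else Pos.clock.shift e.tick)) else []

def target (p : TA) (Φ : List DNF) : Sys.Target :=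
  (List.range p.2.2.length).map fun q => (q, Φ.getD q [])

noncomputable def untilLt (p : TA) (Φ Ψ : List DNF) (α : LT) : List DNF := p.perState fun q =>
  pathLtDNF ((p.sys Φ, p.target Ψ), q, α)

noncomputable def untilGe (p : TA) (Φ Ψ : List DNF) (α : LT) : List DNF := p.perState fun q =>
  pathGeDNF ((p.sys Φ, p.target Ψ), q, α)

/-- Every transition is guarded by `Φ`, so a run of the guarded system is a run along which `Φ`
always holds. -/
noncomputable def always (p : TA) (Φ : List DNF) : List DNF := p.perState fun q =>
  runDNF (p.sys Φ, q)

end TA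

section

variable {ι : Type*} [Primcodable ι]

@[fun_prop] theorem primrec_runDNF {f : ι → Sys × ℕ} (hf : Primrec f) :
    Primrec fun i => runDNF (f i) := Eff.tRun.choose_spec.1.comp hf

@[fun_prop] theorem primrec_pathLtDNF {f : ι → (Sys × Sys.Target) × ℕ × LT} (hf : Primrec f) :
    Primrec fun i => pathLtDNF (f i) := Eff.tpath_lt.choose_spec.1.comp hf

@[fun_prop] theorem primrec_pathGeDNF {f : ι → (Sys × Sys.Target) × ℕ × LT} (hf : Primrec f) :
    Primrec fun i => pathGeDNF (f i) := Eff.tpath_ge.choose_spec.1.comp hf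

variable {p : ι → TA} {Φ Ψ : ι → List DNF} {α : ι → LT}

theorem primrec_perState (hp : Primrec p) {f : ι → ℕ → DNF}
    (hf : Primrec fun i : ι × ℕ => f i.1 i.2) : Primrec fun i => (p i).perState (f i) := by
  unfold TA.perState; fun_prop

@[fun_prop] theorem primrec_sys (hp : Primrec p) (hΦ : Primrec Φ) :
    Primrec fun i => (p i).sys (Φ i) := by unfold TA.sys; fun_prop

@[fun_prop] theorem primrec_top (hp : Primrec p) : Primrec fun i => (p i).top :=
  primrec_perState hp (by fun_prop)

@[fun_prop] theorem primrec_live (hp : Primrec p) : Primrec fun i => (p i).live :=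
  primrec_perState hp (by fun_prop)

@[fun_prop] theorem primrec_taNeg (hp : Primrec p) (hΦ : Primrec Φ) :
    Primrec fun i => (p i).neg (Φ i) := primrec_perState hp (by fun_prop)

@[fun_prop] theorem primrec_taAnd (hp : Primrec p) (hΦ : Primrec Φ) (hΨ : Primrec Ψ) :
    Primrec fun i => (p i).and (Φ i) (Ψ i) := primrec_perState hp (by fun_prop)

@[fun_prop] theorem primrec_taOr (hp : Primrec p) (hΦ : Primrec Φ) (hΨ : Primrec Ψ) :
    Primrec fun i => (p i).or (Φ i) (Ψ i) := primrec_perState hp (by fun_prop)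

@[fun_prop] theorem primrec_atomic (hp : Primrec p) {s : ι → ℕ} (hs : Primrec s) :
    Primrec fun i => (p i).atomic (s i) := primrec_perState hp (by fun_prop)

@[fun_prop] theorem primrec_constant (hp : Primrec p) {D : ι → DNF} (hD : Primrec D) :
    Primrec fun i => (p i).constant (D i) := primrec_perState hp (by fun_prop)

@[fun_prop] theorem primrec_next (hp : Primrec p) (hΦ : Primrec Φ) :
    Primrec fun i => (p i).next (Φ i) := primrec_perState hp (by fun_prop)

@[fun_prop] theorem primrec_target (hp : Primrec p) (hΦ : Primrec Φ) :
    Primrec fun i => (p i).target (Φ i) := by unfold TA.target; fun_prop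

@[fun_prop] theorem primrec_untilLt (hp : Primrec p) (hΦ : Primrec Φ) (hΨ : Primrec Ψ)
    (hα : Primrec α) : Primrec fun i => (p i).untilLt (Φ i) (Ψ i) (α i) :=
  primrec_perState hp (by fun_prop)

@[fun_prop] theorem primrec_untilGe (hp : Primrec p) (hΦ : Primrec Φ) (hΨ : Primrec Ψ)
    (hα : Primrec α) : Primrec fun i => (p i).untilGe (Φ i) (Ψ i) (α i) :=
  primrec_perState hp (by fun_prop)

@[fun_prop] theorem primrec_always (hp : Primrec p) (hΦ : Primrec Φ) :
    Primrec fun i => (p i).always (Φ i) := primrec_perState hp (by fun_prop)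

end

/-! ### Correctness -/

/-- The transitions of an automaton, with durations in `ℕ`. -/
def Automaton.Trans (A : Automaton) (v : ℕ → ℕ) (s : Config A) (t : ℕ) (s' : Config A) : Prop :=
  ∃ τ : Fin 2, (τ : ℕ) = t ∧ Step A v s τ s'

variable {A : Automaton} {v : ℕ → ℕ}

/-- The time increments of an automaton lie in `Fin 2`; here they are identified with their values
in `ℕ`, where the general results on timed relations apply. -/
theorem exists_isRun_iff {s : Config A} {K : (ℕ → Config A) → (ℕ → ℕ) → Prop} :
    (∃ ρ τ, IsRun A v s ρ τ ∧ K ρ fun i => (τ i : ℕ)) ↔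
      ∃ ρ τ, Divergent (A.Trans v) s ρ τ ∧ K ρ τ := by
  constructor
  · rintro ⟨ρ, τ, ⟨h₀, h₁, h₂⟩, h⟩
    exact ⟨ρ, _, ⟨h₀, fun i => ⟨_, rfl, h₁ i⟩, h₂⟩, h⟩
  · rintro ⟨ρ, τ, ⟨h₀, h₁, h₂⟩, h⟩
    choose σ hσ h₁ using h₁
    obtain rfl : τ = fun i => (σ i : ℕ) := (funext hσ).symm
    exact ⟨ρ, σ, ⟨h₀, h₁, h₂⟩, h⟩

theorem forall_isRun_iff {s : Config A} {K : (ℕ → Config A) → (ℕ → ℕ) → Prop} :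
    (∀ ρ τ, IsRun A v s ρ τ → K ρ fun i => (τ i : ℕ)) ↔
      ∀ ρ τ, Divergent (A.Trans v) s ρ τ → K ρ τ := by
  have := not_congr (exists_isRun_iff (s := s) (v := v) (K := fun ρ τ => ¬ K ρ τ))
  push Not at this
  exact this

theorem exists_run_iff {s : Config A} :
    (∃ ρ τ, IsRun A v s ρ τ) ↔ TRun (A.Trans v) s := by
  simpa [TRun, Divergent] using exists_isRun_iff (s := s) (v := v) (K := fun _ _ => True)

/-- `Φ` defines the set `P` of configurations, for every valuation. -/
def Defines (A : Automaton) (Φ : List DNF) (P : (ℕ → ℕ) → Config A → Prop) : Prop :=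
  ∀ (q : Fin A.numStates) (x : ℕ) v, (Φ.getD q []).Holds v x ↔ P v (q, x)

theorem Edge.cond_tick {n : ℕ} (e : Edge n) :
    (bif decide ((e.tick : ℕ) = 1) then 1 else 0) = (e.tick : ℕ) := by
  have := e.tick.isLt
  by_cases h : (e.tick : ℕ) = 1
  · simp [h]
  · have : (e.tick : ℕ) = 0 := by omega
    simp [this]

namespace Automaton

theorem getD_perState (A : Automaton) (f : ℕ → DNF) (q : Fin A.numStates) :
    (A.toTA.perState f).getD q [] = f q := by
  simp [TA.perState, toTA]

theorem getD_inv (A : Automaton) (q : Fin A.numStates) :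
    A.toTA.2.2.getD q [] = (A.inv q).toDNF := by
  simp [toTA]

/-- A configuration of an automaton as a configuration of a symbolic transition system. -/
def embed (A : Automaton) (s : Config A) : ℕ × ℤ := (s.1, s.2)

theorem embed_injective : Function.Injective A.embed := by
  rintro ⟨q, x⟩ ⟨q', x'⟩ h
  simp only [embed, Prod.mk.injEq, Nat.cast_inj] at h
  exact Prod.ext (Fin.ext h.1) h.2

variable {Φ Ψ : List DNF} {P Q : (ℕ → ℕ) → Config A → Prop}

theorem mem_sys_iff {e' : REdge} : e' ∈ A.toTA.sys Φ ↔ ∃ e ∈ A.edges, e' =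
    ((e.src : ℕ), decide ((e.tick : ℕ) = 1), (Φ.getD e.src []).conj ((A.inv e.src).toDNF.conj
      ((e.guard.toDNF.subst (Pos.clock.shift (e.tick : ℕ))).conj ((A.inv e.tgt).toDNF.subst
        (bif e.reset then Sys.zeroPos else Pos.clock.shift (e.tick : ℕ))))), e.reset,
      (e.tgt : ℕ)) := by
  have h : A.toTA.1 = A.edges.map fun e => ((e.src : ℕ), decide ((e.tick : ℕ) = 1),
    e.guard.toDNF, e.reset, (e.tgt : ℕ)) := rfl
  rw [TA.sys, h, List.map_map, List.mem_map]
  simp only [Function.comp_apply, REdge.src, REdge.tick, REdge.cond, REdge.reset, REdge.tgt,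
    Edge.cond_tick, getD_inv, eq_comm]

theorem eval_reset (v : ℕ → ℕ) (x : ℕ) (b : Bool) (n : ℕ) :
    (bif b then Sys.zeroPos else Pos.clock.shift n).eval v (x : ℤ) =
      ((if b then 0 else x + n : ℕ) : ℤ) := by
  cases b <;> simp [Sys.zeroPos]

/-- Although the symbolic system has clock values in `ℤ`, its transitions from embedded
configurations lead to embedded ones. Hence paths and runs carry over in both directions. -/
theorem fStep_sys_iff (hΦ : Defines A Φ P) (s : Config A) (t : ℕ) (d' : ℕ × ℤ) :
    (A.toTA.sys Φ).FStep v (A.embed s) t d' ↔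
      ∃ d, d' = A.embed d ∧ Guarded (A.Trans v) (P v) s t d := by
  obtain ⟨q, x⟩ := s
  have ht : ∀ (e : Edge A.numStates) (s : ℕ) (D : DNF) (b : Bool) (t : ℕ),
      REdge.tick (s, decide ((e.tick : ℕ) = 1), D, b, t) = e.tick := fun e _ _ _ _ => e.cond_tick
  have hcond : ∀ e : Edge A.numStates, e.src = q → (((Φ.getD e.src []).conj
      ((A.inv e.src).toDNF.conj ((e.guard.toDNF.subst (Pos.clock.shift (e.tick : ℕ))).conj
      ((A.inv e.tgt).toDNF.subst
        (bif e.reset then Sys.zeroPos else Pos.clock.shift (e.tick : ℕ)))))).Holds v x ↔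
      P v (q, x) ∧ (A.inv q).Holds v x ∧ e.guard.Holds v (x + (e.tick : ℕ)) ∧
        (A.inv e.tgt).Holds v (if e.reset then 0 else x + (e.tick : ℕ))) := by
    rintro e rfl
    rw [DNF.holds_conj, DNF.holds_conj, DNF.holds_conj, DNF.holds_subst, DNF.holds_subst, hΦ,
      eval_reset, Guard.holds_toDNF, Guard.holds_toDNF, Pos.eval_shift, Pos.eval_clock,
      ← Nat.cast_add, Guard.holds_toDNF]
  constructor
  · rintro ⟨e', he', h₁, h₂, rfl, rfl⟩
    obtain ⟨e, he, rfl⟩ := mem_sys_iff.1 he'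
    have hq : e.src = q := Fin.ext h₁
    obtain ⟨k₁, k₂, k₃, k₄⟩ := (hcond e hq).1 h₂
    rw [ht]
    refine ⟨(e.tgt, if e.reset then 0 else x + (e.tick : ℕ)), ?_, k₁, e.tick, rfl, k₂, k₄, e, he,
      hq, rfl, rfl, k₃, rfl⟩
    simp only [embed, REdge.reset, REdge.tgt]
    cases e.reset <;> simp
  · rintro ⟨⟨q', x'⟩, rfl, hP, τ, rfl, k₁, k₂, e, he, hq, rfl, rfl, k₃, rfl⟩
    refine ⟨_, mem_sys_iff.2 ⟨e, he, rfl⟩, congrArg Fin.val hq, (hcond e hq).2 ⟨hP, k₁, k₃, k₂⟩,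
      (ht ..).symm, ?_⟩
    rw [ht]
    simp only [embed, REdge.reset, REdge.tgt]
    cases e.reset <;> simp

theorem defines_perState {f : ℕ → DNF}
    (h : ∀ (q : Fin A.numStates) (x : ℕ) v, (f q).Holds v x ↔ P v (q, x)) :
    Defines A (A.toTA.perState f) P := fun q x v => by rw [getD_perState, h]

theorem holds_target_iff (hΨ : Defines A Ψ Q) (s : Config A) :
    (A.toTA.target Ψ).Holds v (A.embed s) ↔ Q v s := by
  have hlen : A.toTA.2.2.length = A.numStates := by simp [toTA]
  simp only [Sys.Target.Holds, TA.target, List.mem_map, List.mem_range, hlen,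
    exists_exists_and_eq_and, embed]
  constructor
  · rintro ⟨q, hq, rfl, h⟩
    exact (hΨ _ _ _).1 h
  · exact fun h => ⟨_, s.1.isLt, rfl, (hΨ _ _ _).2 h⟩

theorem defines_top : Defines A A.toTA.top fun _ _ => True :=
  defines_perState fun q x v => by simp [DNF.Holds]

theorem defines_always (hΦ : Defines A Φ P) :
    Defines A (A.toTA.always Φ) fun v s => TRun (Guarded (A.Trans v) (P v)) s :=
  defines_perState fun q x v => by
    rw [holds_runDNF, ← tRun_map_iff A.embed_injective (A.fStep_sys_iff hΦ)]
    rfl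

theorem guarded_true {C : Type*} (r : C → ℕ → C → Prop) : Guarded r (fun _ => True) = r := by
  funext c t d
  simp [Guarded]

theorem defines_live : Defines A A.toTA.live fun v s => TRun (A.Trans v) s := by
  have := defines_always (A := A) defines_top
  simp only [guarded_true] at this
  exact this

theorem defines_neg (hΦ : Defines A Φ P) : Defines A (A.toTA.neg Φ) fun v s => ¬ P v s :=
  defines_perState fun q x v => by rw [DNF.holds_neg, hΦ]

theorem defines_and (hΦ : Defines A Φ P) (hΨ : Defines A Ψ Q) :
    Defines A (A.toTA.and Φ Ψ) fun v s => P v s ∧ Q v s :=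
  defines_perState fun q x v => by rw [DNF.holds_conj, hΦ, hΨ]

theorem defines_or (hΦ : Defines A Φ P) (hΨ : Defines A Ψ Q) :
    Defines A (A.toTA.or Φ Ψ) fun v s => P v s ∨ Q v s :=
  defines_perState fun q x v => by rw [DNF.holds_append, hΦ, hΨ]

theorem defines_atomic (σ : ℕ) : Defines A (A.toTA.atomic σ) fun _ s => σ ∈ A.label s.1 :=
  defines_perState fun q x v => by
    have : A.toTA.2.1.getD q [] = A.label q := by simp [toTA]
    rw [DNF.holds_flatMap, this]
    constructor
    · rintro ⟨t, ht, h⟩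
      by_cases e : t = σ
      · exact e ▸ ht
      · simp [e, DNF.Holds] at h
    · exact fun h => ⟨σ, h, by simp [DNF.Holds]⟩

theorem defines_constant {D : DNF} {p : (ℕ → ℕ) → Prop} (h : ∀ (x : ℤ) v, D.Holds v x ↔ p v) :
    Defines A (A.toTA.constant D) fun v _ => p v := defines_perState fun _ x v => h x v

theorem defines_untilLt (hΦ : Defines A Φ P) (hΨ : Defines A Ψ Q) (α : LT) :
    Defines A (A.toTA.untilLt Φ Ψ α) fun v s =>
      ∃ D d, TPath (Guarded (A.Trans v) (P v)) s D d ∧ ((D : ℕ) : ℤ) < α.eval v ∧ Q v d :=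
  defines_perState fun q x v => by
    rw [holds_pathLtDNF]
    refine exists_congr fun D => ⟨?_, ?_⟩
    · rintro ⟨c', h, hD, hT⟩
      obtain ⟨d, rfl, h'⟩ := (tpath_map_iff (A.fStep_sys_iff hΦ) (c := (q, (x : ℕ)))).1 h
      exact ⟨d, h', hD, (A.holds_target_iff hΨ d).1 hT⟩
    · rintro ⟨d, h, hD, hT⟩
      exact ⟨_, (tpath_map_iff (A.fStep_sys_iff hΦ)).2 ⟨d, rfl, h⟩, hD,
        (A.holds_target_iff hΨ d).2 hT⟩

theorem defines_untilGe (hΦ : Defines A Φ P) (hΨ : Defines A Ψ Q) (α : LT) :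
    Defines A (A.toTA.untilGe Φ Ψ α) fun v s =>
      ∃ D d, TPath (Guarded (A.Trans v) (P v)) s D d ∧ α.eval v ≤ ((D : ℕ) : ℤ) ∧ Q v d :=
  defines_perState fun q x v => by
    rw [holds_pathGeDNF]
    refine exists_congr fun D => ⟨?_, ?_⟩
    · rintro ⟨c', h, hD, hT⟩
      obtain ⟨d, rfl, h'⟩ := (tpath_map_iff (A.fStep_sys_iff hΦ) (c := (q, (x : ℕ)))).1 h
      exact ⟨d, h', hD, (A.holds_target_iff hΨ d).1 hT⟩
    · rintro ⟨d, h, hD, hT⟩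
      exact ⟨_, (tpath_map_iff (A.fStep_sys_iff hΦ)).2 ⟨d, rfl, h⟩, hD,
        (A.holds_target_iff hΨ d).2 hT⟩

theorem defines_next (hΦ : Defines A Φ P) :
    Defines A (A.toTA.next Φ) fun v s => ∃ t d, A.Trans v s t d ∧ P v d :=
  defines_perState fun q x v => by
    have hstep := fun t d' => A.fStep_sys_iff (v := v) defines_top (q, x) t d'
    simp only [guarded_true] at hstep
    have key : ∀ e ∈ A.toTA.sys A.toTA.top, (Pos.eval v (x : ℤ)
        (bif e.reset then Sys.zeroPos else Pos.clock.shift e.tick)) =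
        if e.reset then 0 else (x : ℤ) + e.tick := by
      intro e _
      cases e.reset <;> simp [Sys.zeroPos]
    rw [DNF.holds_flatMap]
    constructor
    · rintro ⟨e, he, h⟩
      by_cases hq : e.src = q
      · simp only [hq, decide_true, cond_true, DNF.holds_conj, DNF.holds_subst, key e he] at h
        obtain ⟨d, hd, ht⟩ := (hstep e.tick _).1 ⟨e, he, hq, h.1, rfl, rfl⟩
        refine ⟨_, d, ht, (hΦ _ _ _).1 ?_⟩
        have h₁ : e.tgt = d.1 := congrArg Prod.fst hd
        have h₂ : (if e.reset then 0 else (x : ℤ) + e.tick) = d.2 := congrArg Prod.snd hd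
        rw [← h₁, ← h₂]
        exact h.2
      · simp [hq, DNF.Holds] at h
    · rintro ⟨t, d, ht, hP⟩
      obtain ⟨e, he, hq, hc, rfl, hd⟩ := (hstep t (A.embed d)).2 ⟨d, rfl, ht⟩
      have hq : e.src = q := hq
      refine ⟨e, he, ?_⟩
      simp only [hq, decide_true, cond_true, DNF.holds_conj, DNF.holds_subst, key e he]
      have h₁ : e.tgt = d.1 := (congrArg Prod.fst hd).symm
      have h₂ : (if e.reset then 0 else (x : ℤ) + e.tick) = d.2 := (congrArg Prod.snd hd).symm
      refine ⟨hc, ?_⟩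
      rw [h₁, h₂]
      exact (hΦ _ _ _).2 hP

end Automaton

/-! ### The until operators on normal forms -/

namespace TA

/-- The existential until with the comparison symbol of code `k`. -/
noncomputable def exUntil (p : TA) (Φ : List DNF) (k : ℕ) (α : LT) (Ψ : List DNF) : List DNF :=
  -- The entries are indexed by the codes of `=, <, ≤, >, ≥`. The first is a dummy as `=` is
  -- excluded, and over the integers `≤ α` and `> α` become `< α + 1` and `≥ α + 1`.
  ([[], p.untilLt Φ (p.and Ψ p.live) α, p.untilLt Φ (p.and Ψ p.live) (LT.add α (LT.const 1)),
    p.untilGe Φ (p.and Ψ p.live) (LT.add α (LT.const 1)), p.untilGe Φ (p.and Ψ p.live) α] :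
    List (List DNF)).getD k []

/-- Where some run reaches, before `Ψ` has held, a position outside `Φ` and `Ψ`. -/
noncomputable def spoil (p : TA) (Φ Ψ : List DNF) : List DNF :=
  p.untilGe (p.neg Ψ) (p.and (p.and (p.neg Φ) (p.neg Ψ)) p.live) (LT.const 0)

/-- The universal until with the comparison symbol of code `k`. -/
noncomputable def allUntil (p : TA) (Φ : List DNF) (k : ℕ) (α : LT) (Ψ : List DNF) : List DNF :=
  -- The entries for `=` and `>` are dummies. The one for `≥` is correct for the bound zero, where
  -- the other kind of violation is that `Ψ` never holds along some run.
  p.neg (p.or (p.spoil Φ Ψ) (([[], p.untilGe (p.neg Ψ) p.live α,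
    p.untilGe (p.neg Ψ) p.live (LT.add α (LT.const 1)), [], p.always (p.neg Ψ)] :
    List (List DNF)).getD k []))

end TA

section

variable {ι : Type*} [Primcodable ι] {p : ι → TA} {Φ Ψ : ι → List DNF} {α : ι → LT} {k : ι → ℕ}

@[fun_prop] theorem primrec_exUntil (hp : Primrec p) (hΦ : Primrec Φ) (hk : Primrec k)
    (hα : Primrec α) (hΨ : Primrec Ψ) :
    Primrec fun i => (p i).exUntil (Φ i) (k i) (α i) (Ψ i) := by unfold TA.exUntil; fun_prop

@[fun_prop] theorem primrec_spoil (hp : Primrec p) (hΦ : Primrec Φ) (hΨ : Primrec Ψ) :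
    Primrec fun i => (p i).spoil (Φ i) (Ψ i) := by unfold TA.spoil; fun_prop

@[fun_prop] theorem primrec_allUntil (hp : Primrec p) (hΦ : Primrec Φ) (hk : Primrec k)
    (hα : Primrec α) (hΨ : Primrec Ψ) :
    Primrec fun i => (p i).allUntil (Φ i) (k i) (α i) (Ψ i) := by unfold TA.allUntil; fun_prop

end

variable {A : Automaton} {Φ Ψ : List DNF} {P Q : (ℕ → ℕ) → Config A → Prop}

theorem Defines.congr (h : Defines A Φ P) (e : ∀ v s, P v s ↔ Q v s) : Defines A Φ Q :=
  fun q x v => (h q x v).trans (e _ _)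

namespace Automaton

theorem defines_exUntil (hΦ : Defines A Φ P) (hΨ : Defines A Ψ Q) {c : Cmp} (hc : c ≠ .eq)
    (α : LinTerm) : Defines A (A.toTA.exUntil Φ c.code α.toLT Ψ) fun v s =>
      ∃ ρ τ, IsRun A v s ρ τ ∧ ∃ i, c.Holds (duration τ i : ℤ) (α.eval v) ∧ Q v (ρ i) ∧
        ∀ j < i, P v (ρ j) := by
  have key : ∀ v s, (∃ ρ τ, IsRun A v s ρ τ ∧ ∃ i, c.Holds (duration τ i : ℤ) (α.eval v) ∧
      Q v (ρ i) ∧ ∀ j < i, P v (ρ j)) ↔ ∃ (D : ℕ) (d : Config A),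
      TPath (Guarded (A.Trans v) (P v)) s D d ∧ c.Holds (D : ℤ) (α.eval v) ∧ Q v d ∧
        TRun (A.Trans v) d := fun v s =>
    (exists_isRun_iff (K := fun ρ τ => ∃ i, c.Holds ((∑ j ∈ Finset.range i, τ j : ℕ) : ℤ)
      (α.eval v) ∧ Q v (ρ i) ∧ ∀ j < i, P v (ρ j))).trans
      (exists_until_iff (K := fun D => c.Holds (D : ℤ) (α.eval v)))
  have hQ := A.defines_and hΨ A.defines_live
  cases c with
  | eq => exact absurd rfl hc
  | lt => exact (A.defines_untilLt hΦ hQ α.toLT).congr fun v s => (key v s).symm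
  | le =>
    exact (A.defines_untilLt hΦ hQ (LT.add α.toLT (LT.const 1))).congr fun v s => by
      rw [key]
      simp only [LT.eval_add, LT.eval_const, Int.lt_add_one_iff, LinTerm.eval_toLT,
        Cmp.Holds]
  | gt =>
    exact (A.defines_untilGe hΦ hQ (LT.add α.toLT (LT.const 1))).congr fun v s => by
      rw [key]
      simp only [LT.eval_add, LT.eval_const, Int.add_one_le_iff, LinTerm.eval_toLT,
        Cmp.Holds, gt_iff_lt]
  | ge => exact (A.defines_untilGe hΦ hQ α.toLT).congr fun v s => (key v s).symm

theorem defines_spoil (hΦ : Defines A Φ P) (hΨ : Defines A Ψ Q) :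
    Defines A (A.toTA.spoil Φ Ψ) fun v s => ∃ D d,
      TPath (Guarded (A.Trans v) fun s => ¬ Q v s) s D d ∧ True ∧ (¬ P v d ∧ ¬ Q v d) ∧
        TRun (A.Trans v) d :=
  (A.defines_untilGe (A.defines_neg hΨ) (A.defines_and (A.defines_and (A.defines_neg hΦ)
    (A.defines_neg hΨ)) A.defines_live) (LT.const 0)).congr fun v s => by
      simp only [LT.eval_const, Nat.cast_nonneg]

theorem defines_allUntil (hΦ : Defines A Φ P) (hΨ : Defines A Ψ Q) {c : Cmp} {α : LinTerm}
    (hc : c = .lt ∨ c = .le ∨ c = .ge ∧ α = LinTerm.zero) :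
    Defines A (A.toTA.allUntil Φ c.code α.toLT Ψ) fun v s =>
      ∀ ρ τ, IsRun A v s ρ τ → ∃ i, c.Holds (duration τ i : ℤ) (α.eval v) ∧ Q v (ρ i) ∧
        ∀ j < i, P v (ρ j) := by
  have hs := A.defines_spoil hΦ hΨ
  have hn := A.defines_neg hΨ
  have key : ∀ v s, (∀ ρ τ, IsRun A v s ρ τ → ∃ i, c.Holds (duration τ i : ℤ) (α.eval v) ∧
      Q v (ρ i) ∧ ∀ j < i, P v (ρ j)) ↔ ∀ ρ τ, Divergent (A.Trans v) s ρ τ →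
      ∃ i, c.Holds ((∑ j ∈ Finset.range i, τ j : ℕ) : ℤ) (α.eval v) ∧ Q v (ρ i) ∧
        ∀ j < i, P v (ρ j) := fun v s => forall_isRun_iff (K := fun ρ τ => ∃ i,
      c.Holds ((∑ j ∈ Finset.range i, τ j : ℕ) : ℤ) (α.eval v) ∧ Q v (ρ i) ∧ ∀ j < i, P v (ρ j))
  rcases hc with rfl | rfl | ⟨rfl, rfl⟩
  · refine (A.defines_neg (A.defines_or hs (A.defines_untilGe hn A.defines_live α.toLT))).congr
      fun v s => ?_
    rw [key]
    refine Iff.trans ?_ (forall_until_iff (K := fun D => (D : ℤ) < α.eval v)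
      (fun a b h h' => by omega) ⟨(α.eval v).toNat, by omega⟩).symm
    simp only [not_lt, LinTerm.eval_toLT, true_and]
  · refine (A.defines_neg (A.defines_or hs (A.defines_untilGe hn A.defines_live
      (LT.add α.toLT (LT.const 1))))).congr fun v s => ?_
    rw [key]
    refine Iff.trans ?_ (forall_until_iff (K := fun D => (D : ℤ) ≤ α.eval v)
      (fun a b h h' => by omega) ⟨(α.eval v).toNat + 1, by omega⟩).symm
    simp only [not_le, LinTerm.eval_toLT, true_and, LT.eval_add, LT.eval_const,
      Int.add_one_le_iff]
  · refine (A.defines_neg (A.defines_or hs (A.defines_always hn))).congr fun v s => ?_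
    rw [key]
    refine forall_plain_until_iff.symm.trans ?_
    have h0 : LinTerm.zero.eval v = 0 := by simp [LinTerm.eval, LinTerm.zero]
    simp only [Cmp.Holds, h0, ge_iff_le, Nat.cast_nonneg, true_and]

end Automaton

/-! ### The recursion over codes of formulas -/

/-- The satisfaction set of the formula whose code is the length of `tbl`, when `tbl` lists the
satisfaction sets for the smaller codes. -/
noncomputable def qfStep (p : TA) (tbl : List (List DNF)) : List DNF :=
  let b := tbl.length.unpair.2
  ([p.and p.live (p.atomic b),
    p.and p.live (p.constant (cmpDNF b.unpair.2.unpair.1 (Pos.ofTerm (parseLT b.unpair.1))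
      (Pos.ofTerm (parseLT b.unpair.2.unpair.2)))),
    p.neg (tbl.getD b []),
    p.or (tbl.getD b.unpair.1 []) (tbl.getD b.unpair.2 []),
    p.next (p.and (tbl.getD b []) p.live),
    p.exUntil (tbl.getD b.unpair.1 []) b.unpair.2.unpair.1 (parseLT b.unpair.2.unpair.2.unpair.1)
      (tbl.getD b.unpair.2.unpair.2.unpair.2 []),
    p.allUntil (tbl.getD b.unpair.1 []) b.unpair.2.unpair.1 (parseLT b.unpair.2.unpair.2.unpair.1)
      (tbl.getD b.unpair.2.unpair.2.unpair.2 [])] :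
    List (List DNF)).getD tbl.length.unpair.1 []

noncomputable def satSet (p : TA) (n : ℕ) : List DNF := courseRec qfStep p n

theorem primrec_qfStep : Primrec fun i : TA × List (List DNF) => qfStep i.1 i.2 := by
  unfold qfStep; fun_prop

@[fun_prop] theorem primrec_satSet {ι : Type*} [Primcodable ι] {p : ι → TA} {n : ι → ℕ}
    (hp : Primrec p) (hn : Primrec n) : Primrec fun i => satSet (p i) (n i) :=
  primrec_courseRec primrec_qfStep hp hn

/-- Induction on the formula unfolds one step of the recursion on codes at a time; the components
have smaller codes, so the table contains their satisfaction sets. -/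
theorem defines_satSet (A : Automaton) (φ : QF) (hφ : φ.IsF) :
    Defines A (satSet A.toTA φ.code) fun v s => φ.Sat A v s := by
  have left := fun a b : ℕ => Nat.left_le_pair a b
  have right := fun a b : ℕ => Nat.right_le_pair a b
  have key : ∀ n, satSet A.toTA n = qfStep A.toTA (table qfStep A.toTA n) := fun n => rfl
  have get : ∀ {m n}, m < n → (table qfStep A.toTA n).getD m [] = satSet A.toTA m :=
    fun h => table_getD _ _ _ h
  induction φ with
  | prop σ =>
    refine Defines.congr ?_ fun v s => and_congr_left' exists_run_iff.symm
    rw [key, qfStep, table_length, QF.code, Nat.unpair_pair]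
    exact A.defines_and A.defines_live (A.defines_atomic σ)
  | cmp α c β =>
    refine Defines.congr ?_ fun v s => and_congr_left' exists_run_iff.symm
    rw [key, qfStep, table_length, QF.code, Nat.unpair_pair]
    dsimp only
    rw [Nat.unpair_pair]
    dsimp only
    rw [Nat.unpair_pair]
    dsimp only
    rw [parseLT_code, parseLT_code]
    exact A.defines_and A.defines_live (A.defines_constant fun x v => by
      rw [holds_cmpDNF, Pos.eval_ofTerm, Pos.eval_ofTerm]; rfl)
  | not φ ih =>
    rw [key, qfStep, table_length, QF.code, Nat.unpair_pair]
    dsimp only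
    rw [get (lt_pair_pos_left le_rfl)]
    exact A.defines_neg (ih hφ)
  | or φ ψ ih ih' =>
    rw [key, qfStep, table_length, QF.code, Nat.unpair_pair]
    dsimp only
    rw [Nat.unpair_pair]
    dsimp only
    rw [get ((left _ _).trans_lt (lt_pair_pos_left (by omega))),
      get ((right _ _).trans_lt (lt_pair_pos_left (by omega)))]
    exact A.defines_or (ih hφ.1) (ih' hφ.2)
  | exNext φ ih =>
    rw [key, qfStep, table_length, QF.code, Nat.unpair_pair]
    dsimp only
    rw [get (lt_pair_pos_left (by omega))]
    refine (A.defines_next (A.defines_and (ih hφ) A.defines_live)).congr fun v s => ?_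
    exact exists_next_iff.symm.trans
      (exists_isRun_iff (K := fun ρ _ => φ.Sat A v (ρ 1))).symm
  | exUntil φ c α ψ ih ih' =>
    rw [key, qfStep, table_length, QF.code, Nat.unpair_pair]
    dsimp only
    rw [Nat.unpair_pair]
    dsimp only
    rw [Nat.unpair_pair]
    dsimp only
    rw [Nat.unpair_pair]
    dsimp only
    rw [get ((left _ _).trans_lt (lt_pair_pos_left (by omega))),
      get (((right _ _).trans ((right _ _).trans (right _ _))).trans_lt
        (lt_pair_pos_left (by omega))), parseLT_code]
    exact A.defines_exUntil (ih hφ.2.1) (ih' hφ.2.2) hφ.1 α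
  | allUntil φ c α ψ ih ih' =>
    rw [key, qfStep, table_length, QF.code, Nat.unpair_pair]
    dsimp only
    rw [Nat.unpair_pair]
    dsimp only
    rw [Nat.unpair_pair]
    dsimp only
    rw [Nat.unpair_pair]
    dsimp only
    rw [get ((left _ _).trans_lt (lt_pair_pos_left (by omega))),
      get (((right _ _).trans ((right _ _).trans (right _ _))).trans_lt
        (lt_pair_pos_left (by omega))), parseLT_code]
    exact A.defines_allUntil (ih hφ.2.1) (ih' hφ.2.2) hφ.1

/-! ### Restriction to a list of parameters -/

@[fun_prop] theorem primrec_decide_mem {ι β : Type*} [Primcodable ι] [Primcodable β]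
    [DecidableEq β] {f : ι → β} {l : ι → List β} (hf : Primrec f) (hl : Primrec l) :
    Primrec fun i => decide (f i ∈ l i) := by
  have h : Primrec fun i => (l i).foldr (fun a b => bif decide (f i = a) then true else b)
    false := by fun_prop
  refine h.of_eq fun i => ?_
  induction l i with
  | nil => simp
  | cons a l ih =>
    rw [List.foldr_cons, ih]
    by_cases e : f i = a <;> simp [e]

/-- The valuation that agrees with `v` on `L` and is zero elsewhere. -/
def restrictVal (L : List ℕ) (v : ℕ → ℕ) (i : ℕ) : ℕ := if i ∈ L then v i else 0

/-- The normal forms involve chosen functions, so the parameters that occur in them are not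
controlled. Deleting all monomials outside `L` evaluates these parameters at zero and leaves only
parameters in `L`. -/
def LT.restrict (L : List ℕ) (α : LT) : LT :=
  (α.1.flatMap fun p => bif decide (p.1 ∈ L) then [p] else [], α.2)

theorem LT.eval_restrict (L : List ℕ) (v : ℕ → ℕ) (α : LT) :
    (α.restrict L).eval v = α.eval (restrictVal L v) := by
  obtain ⟨l, c⟩ := α
  simp only [restrict, eval]
  congr 1
  induction l with
  | nil => rfl
  | cons p l ih => by_cases h : p.1 ∈ L <;> simp [restrictVal, h] at ih ⊢ <;> exact ih

def Lit.restrict (L : List ℕ) (l : Lit) : Lit := (l.1, l.2.1, l.2.2.1, l.2.2.2.restrict L)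

def DNF.restrict (L : List ℕ) (D : DNF) : DNF := D.map fun c => c.map fun l => l.restrict L

theorem DNF.holds_restrict (L : List ℕ) (v : ℕ → ℕ) (x : ℤ) (D : DNF) :
    (D.restrict L).Holds v x ↔ D.Holds (restrictVal L v) x := by
  simp only [Holds, restrict, List.mem_map, exists_exists_and_eq_and, forall_exists_index, and_imp,
    forall_apply_eq_imp_iff₂, Lit.Holds, Lit.restrict, Lit.val, LT.eval_restrict]

/-! ### Normal forms as guards -/

def LT.toLin (α : LT) : LinTerm := ⟨α.1, α.2⟩

theorem LT.eval_toLin (v : ℕ → ℕ) (α : LT) : α.toLin.eval v = α.eval v := rfl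

/-- The atom that compares `x` or `0` with `±α`, according to the sign of `e`. -/
def atomGuard (e : ℤ) (α : LT) (c d : GCmp) : Guard :=
  if e.sign = 1 then .clock c (LT.neg α).toLin else
    if e.sign = -1 then .clock d α.toLin else .param d (LT.const 0).toLin α.toLin

/-- Guards have only one-sided congruences, so a two-sided one is the disjunction of both. -/
def Lit.toGuard (l : Lit) : Guard :=
  let g := if l.2.1 = 0 then atomGuard l.2.2.1 l.2.2.2 (.base .ge) (.base .le) else
    .or (atomGuard l.2.2.1 l.2.2.2 (.congLe l.2.1.toPNat') (.congLe l.2.1.toPNat'))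
      (atomGuard l.2.2.1 l.2.2.2 (.congGe l.2.1.toPNat') (.congGe l.2.1.toPNat'))
  bif l.1 then g else .not g

def trueGuard : Guard := .param (.base .eq) (LT.const 0).toLin (LT.const 0).toLin

def DNF.toGuard (D : DNF) : Guard :=
  D.foldr (fun c g => .or (c.foldr (fun l g => .and l.toGuard g) trueGuard) g) (.not trueGuard)

theorem holds_atomGuard_le (v : ℕ → ℕ) (x : ℕ) (e : ℤ) (α : LT) :
    (atomGuard e α (.base .ge) (.base .le)).Holds v x ↔ 0 ≤ e.sign * x + α.eval v := by
  unfold atomGuard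
  rcases lt_trichotomy e 0 with h | h | h
  · simp [Int.sign_eq_neg_one_of_neg h, Guard.Holds, GCmp.Holds, Cmp.Holds, LT.eval_toLin]
  · simp [h, Guard.Holds, GCmp.Holds, Cmp.Holds, LT.eval_toLin]
  · simp [Int.sign_eq_one_of_pos h, Guard.Holds, GCmp.Holds, Cmp.Holds, LT.eval_toLin]
    omega

theorem holds_atomGuard_cong (v : ℕ → ℕ) (x : ℕ) (e : ℤ) (α : LT) (m : ℕ+) :
    (atomGuard e α (.congLe m) (.congLe m)).Holds v x ∨
      (atomGuard e α (.congGe m) (.congGe m)).Holds v x ↔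
      ((m : ℕ) : ℤ) ∣ e.sign * x + α.eval v := by
  have key : ∀ y z : ℤ, y ≡ z [ZMOD (m : ℕ)] ∧ y ≤ z ∨ y ≡ z [ZMOD (m : ℕ)] ∧ y ≥ z ↔
      ((m : ℕ) : ℤ) ∣ z - y := fun y z => by
    rw [← and_or_left, Int.modEq_iff_dvd]
    exact and_iff_left (le_total y z)
  unfold atomGuard
  rcases lt_trichotomy e 0 with h | h | h
  · simp only [Int.sign_eq_neg_one_of_neg h, Guard.Holds, GCmp.Holds, LT.eval_toLin, if_neg
      (show ¬ (-1 : ℤ) = 1 by decide), if_pos, key]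
    rw [neg_one_mul, neg_add_eq_sub]
  · simp only [h, Int.sign_zero, Guard.Holds, GCmp.Holds, LT.eval_toLin, if_neg
      (show ¬ (0 : ℤ) = 1 by decide), if_neg (show ¬ (0 : ℤ) = -1 by decide), key,
      LT.eval_const, sub_zero, zero_mul, zero_add]
  · simp only [Int.sign_eq_one_of_pos h, Guard.Holds, GCmp.Holds, LT.eval_toLin, if_pos, key,
      LT.eval_neg, one_mul]
    rw [← dvd_neg, neg_sub, sub_neg_eq_add]

theorem Lit.holds_toGuard (v : ℕ → ℕ) (x : ℕ) (l : Lit) :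
    l.toGuard.Holds v x ↔ l.Holds v x := by
  obtain ⟨s, m, e, α⟩ := l
  have key : (if m = 0 then atomGuard e α (.base .ge) (.base .le) else
      .or (atomGuard e α (.congLe m.toPNat') (.congLe m.toPNat'))
      (atomGuard e α (.congGe m.toPNat') (.congGe m.toPNat'))).Holds v x ↔
      Atom m (e.sign * x + α.eval v) := by
    unfold Atom
    split_ifs with h
    · exact holds_atomGuard_le v x e α
    · refine (holds_atomGuard_cong v x e α _).trans ?_
      rw [Nat.toPNat'_coe, if_pos (Nat.pos_of_ne_zero h)]
  cases s
  · simp only [toGuard, cond_false, Guard.Holds, Holds, val, key, Bool.false_eq_true, false_iff]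
  · simp only [toGuard, cond_true, Holds, val, key, true_iff]

theorem holds_trueGuard (v : ℕ → ℕ) (x : ℕ) : trueGuard.Holds v x := by
  simp [trueGuard, Guard.Holds, GCmp.Holds, Cmp.Holds]

theorem DNF.holds_toGuard (v : ℕ → ℕ) (x : ℕ) (D : DNF) :
    D.toGuard.Holds v x ↔ D.Holds v x := by
  have hconj : ∀ c : List Lit, (c.foldr (fun l g => Guard.and l.toGuard g) trueGuard).Holds v x ↔
      ∀ l ∈ c, l.Holds v x := by
    intro c
    induction c with
    | nil => simp [holds_trueGuard]
    | cons l c ih => simp only [List.foldr_cons, Guard.Holds, ih, Lit.holds_toGuard,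
        List.mem_cons, forall_eq_or_imp]
  induction D with
  | nil => simp [toGuard, Holds, Guard.Holds, holds_trueGuard]
  | cons c D ih =>
    unfold toGuard Holds at *
    simp only [List.foldr_cons, Guard.Holds, ih, hconj, List.mem_cons, exists_eq_or_imp]

theorem atomGuard_params (e : ℤ) (α : LT) (c d : GCmp) {i : ℕ}
    (h : i ∈ (atomGuard e α c d).params) : i ∈ α.1.map Prod.fst := by
  unfold atomGuard at h
  split_ifs at h <;> simpa [Guard.params, LinTerm.params, LT.toLin, LT.neg, LT.const] using h

theorem Lit.toGuard_params (L : List ℕ) (l : Lit) {i : ℕ}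
    (h : i ∈ (l.restrict L).toGuard.params) : i ∈ L := by
  have hL : ∀ {i}, i ∈ (l.2.2.2.restrict L).1.map Prod.fst → i ∈ L := by
    intro i hi
    simp only [LT.restrict, List.mem_map, List.mem_flatMap] at hi
    obtain ⟨a, ⟨p, -, hp⟩, rfl⟩ := hi
    by_cases hp' : p.1 ∈ L
    · simp only [hp', decide_true, cond_true, List.mem_singleton] at hp
      exact hp ▸ hp'
    · simp [hp'] at hp
  refine hL ?_
  generalize hk : l.restrict L = k at h
  have hk : l.2.2.2.restrict L = k.2.2.2 := by rw [← hk]; rfl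
  rw [hk]
  have key : ∀ (b : Bool) (g : Guard), (bif b then g else .not g).params = g.params := by
    intro b g; cases b <;> rfl
  rw [toGuard, key] at h
  split_ifs at h
  · exact atomGuard_params _ _ _ _ h
  · rcases Finset.mem_union.1 h with h | h
    · exact atomGuard_params _ _ _ _ h
    · exact atomGuard_params _ _ _ _ h

theorem DNF.toGuard_params (L : List ℕ) (D : DNF) {i : ℕ}
    (h : i ∈ (D.restrict L).toGuard.params) : i ∈ L := by
  have htrue : i ∉ trueGuard.params := by
    simp [trueGuard, Guard.params, LinTerm.params, LT.toLin, LT.const]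
  have hconj : ∀ c : List Lit, i ∈ ((c.map fun l => l.restrict L).foldr
      (fun l g => Guard.and l.toGuard g) trueGuard).params → i ∈ L := by
    intro c hc
    induction c with
    | nil => exact absurd hc htrue
    | cons l c ih => exact (Finset.mem_union.1 hc).elim (Lit.toGuard_params L l) ih
  induction D with
  | nil => exact absurd h htrue
  | cons c D ih => exact (Finset.mem_union.1 h).elim (hconj c) ih

/-! ### Codes of guards -/

/-- The code of `atomGuard`, for comparison symbols with given codes. -/
def atomCode (e : ℤ) (α : LT) (c d : ℕ) : ℕ :=
  if e.sign = 1 then Nat.pair 0 (Nat.pair c (Encodable.encode (LT.neg α))) else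
    if e.sign = -1 then Nat.pair 0 (Nat.pair d (Encodable.encode α)) else
      Nat.pair 1 (Nat.pair d (Nat.pair (Encodable.encode (LT.const 0)) (Encodable.encode α)))

theorem code_atomGuard (e : ℤ) (α : LT) (c d : GCmp) :
    (atomGuard e α c d).code = atomCode e α c.code d.code := by
  unfold atomGuard atomCode
  split_ifs <;> rfl

/-- Effectiveness is stated for codes, so the construction of the guard is repeated there, where it
is visibly primitive recursive. -/
def Lit.guardCode (l : Lit) : ℕ :=
  let g := if l.2.1 = 0 then atomCode l.2.2.1 l.2.2.2 (Nat.pair 0 4) (Nat.pair 0 2) else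
    Nat.pair 4 (Nat.pair (atomCode l.2.2.1 l.2.2.2 (Nat.pair 1 l.2.1) (Nat.pair 1 l.2.1))
      (atomCode l.2.2.1 l.2.2.2 (Nat.pair 2 l.2.1) (Nat.pair 2 l.2.1)))
  bif l.1 then g else Nat.pair 2 g

theorem Lit.code_toGuard (l : Lit) : l.toGuard.code = l.guardCode := by
  obtain ⟨s, m, e, α⟩ := l
  unfold toGuard guardCode
  dsimp only
  by_cases h : m = 0
  · rw [if_pos h, if_pos h]
    cases s <;> simp only [cond_true, cond_false, Guard.code, code_atomGuard] <;> rfl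
  · have hm : (m.toPNat' : ℕ) = m := by
      rw [Nat.toPNat'_coe, if_pos (Nat.pos_of_ne_zero h)]
    rw [if_neg h, if_neg h]
    cases s <;> simp only [cond_true, cond_false, Guard.code, code_atomGuard, GCmp.code, hm]

def DNF.guardCode (D : DNF) : ℕ :=
  D.foldr (fun c g => Nat.pair 4 (Nat.pair
    (c.foldr (fun l g => Nat.pair 3 (Nat.pair l.guardCode g)) trueGuard.code) g))
    (Nat.pair 2 trueGuard.code)

theorem DNF.code_toGuard (D : DNF) : D.toGuard.code = D.guardCode := by
  have hconj : ∀ c : List Lit, (c.foldr (fun l g => Guard.and l.toGuard g) trueGuard).code =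
      c.foldr (fun l g => Nat.pair 3 (Nat.pair l.guardCode g)) trueGuard.code := by
    intro c
    induction c with
    | nil => rfl
    | cons l c ih => simp only [List.foldr_cons, Guard.code, ih, Lit.code_toGuard]
  induction D with
  | nil => rfl
  | cons c D ih =>
    unfold toGuard guardCode at *
    simp only [List.foldr_cons, Guard.code, ih, hconj]

section

variable {ι : Type*} [Primcodable ι]

@[fun_prop] theorem primrec_atomCode {e : ι → ℤ} {α : ι → LT} {c d : ι → ℕ} (he : Primrec e)
    (hα : Primrec α) (hc : Primrec c) (hd : Primrec d) :
    Primrec fun i => atomCode (e i) (α i) (c i) (d i) := by unfold atomCode; fun_prop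

@[fun_prop] theorem primrec_litGuardCode {l : ι → Lit} (hl : Primrec l) :
    Primrec fun i => (l i).guardCode := by unfold Lit.guardCode; fun_prop

@[fun_prop] theorem primrec_guardCode {D : ι → DNF} (hD : Primrec D) :
    Primrec fun i => (D i).guardCode := by unfold DNF.guardCode; fun_prop

@[fun_prop] theorem primrec_ltRestrict {L : ι → List ℕ} {α : ι → LT} (hL : Primrec L)
    (hα : Primrec α) : Primrec fun i => (α i).restrict (L i) := by unfold LT.restrict; fun_prop

@[fun_prop] theorem primrec_restrict {L : ι → List ℕ} {D : ι → DNF} (hL : Primrec L)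
    (hD : Primrec D) : Primrec fun i => (D i).restrict (L i) := by
  unfold DNF.restrict Lit.restrict; fun_prop

end

/-! ### The parameters of coded objects -/

def termParams (n : ℕ) : List ℕ := (parseLT n).1.map Prod.fst

theorem mem_termParams (α : LinTerm) {i : ℕ} : i ∈ termParams α.code ↔ i ∈ α.params := by
  rw [termParams, parseLT_code, LinTerm.params, List.mem_toFinset]
  rfl

@[fun_prop] theorem primrec_termParams {ι : Type*} [Primcodable ι] {f : ι → ℕ} (hf : Primrec f) :
    Primrec fun i => termParams (f i) := by unfold termParams; fun_prop

/-- The parameters of the guard whose code is the length of `tbl`, when `tbl` lists the parameters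
for the smaller codes. -/
def guardParamsStep (tbl : List (List ℕ)) : List ℕ :=
  let b := tbl.length.unpair.2
  ([termParams b.unpair.2, termParams b.unpair.2.unpair.1 ++ termParams b.unpair.2.unpair.2,
    tbl.getD b [], tbl.getD b.unpair.1 [] ++ tbl.getD b.unpair.2 [],
    tbl.getD b.unpair.1 [] ++ tbl.getD b.unpair.2 []] : List (List ℕ)).getD tbl.length.unpair.1 []

def guardParams (n : ℕ) : List ℕ := courseRec (fun (_ : Unit) tbl => guardParamsStep tbl) () n

theorem primrec_guardParamsStep : Primrec guardParamsStep := by unfold guardParamsStep; fun_prop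

@[fun_prop] theorem primrec_guardParams {ι : Type*} [Primcodable ι] {f : ι → ℕ}
    (hf : Primrec f) : Primrec fun i => guardParams (f i) :=
  primrec_courseRec (primrec_guardParamsStep.comp Primrec.snd) (by fun_prop) hf

theorem mem_guardParams (g : Guard) {i : ℕ} : i ∈ guardParams g.code ↔ i ∈ g.params := by
  have key : ∀ n, guardParams n =
      guardParamsStep (table (fun (_ : Unit) tbl => guardParamsStep tbl) () n) := fun n => rfl
  have get : ∀ {m n}, m < n →
      (table (fun (_ : Unit) tbl => guardParamsStep tbl) () n).getD m [] = guardParams m :=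
    fun h => table_getD _ _ _ h
  have left : ∀ {a b c : ℕ}, 2 ≤ a → b < Nat.pair a (Nat.pair b c) := fun ha =>
    (Nat.left_le_pair _ _).trans_lt (lt_pair_pos_left ha)
  have right : ∀ {a b c : ℕ}, 2 ≤ a → c < Nat.pair a (Nat.pair b c) := fun ha =>
    (Nat.right_le_pair _ _).trans_lt (lt_pair_pos_left ha)
  induction g with
  | clock c α =>
    rw [key]
    simp [guardParamsStep, table_length, Guard.code, Guard.params, mem_termParams]
  | param c α β =>
    rw [key]
    simp [guardParamsStep, table_length, Guard.code, Guard.params, mem_termParams]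
  | not g ih =>
    rw [key, guardParamsStep, table_length, Guard.code, Nat.unpair_pair]
    dsimp only
    rw [get (lt_pair_pos_left le_rfl)]
    simp only [List.getD_cons_succ, List.getD_cons_zero]
    exact ih
  | and g h ih ih' =>
    rw [key, guardParamsStep, table_length, Guard.code, Nat.unpair_pair]
    dsimp only
    rw [Nat.unpair_pair]
    dsimp only
    rw [get (left (by omega)), get (right (by omega))]
    simp [Guard.params, ih, ih']
  | or g h ih ih' =>
    rw [key, guardParamsStep, table_length, Guard.code, Nat.unpair_pair]
    dsimp only
    rw [Nat.unpair_pair]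
    dsimp only
    rw [get (left (by omega)), get (right (by omega))]
    simp [Guard.params, ih, ih']

/-- The parameters of the formula whose code is the length of `tbl`, when `tbl` lists the
parameters for the smaller codes. -/
def qfParamsStep (tbl : List (List ℕ)) : List ℕ :=
  let b := tbl.length.unpair.2
  ([[], termParams b.unpair.1 ++ termParams b.unpair.2.unpair.2, tbl.getD b [],
    tbl.getD b.unpair.1 [] ++ tbl.getD b.unpair.2 [], tbl.getD b [],
    tbl.getD b.unpair.1 [] ++ (termParams b.unpair.2.unpair.2.unpair.1 ++
      tbl.getD b.unpair.2.unpair.2.unpair.2 []),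
    tbl.getD b.unpair.1 [] ++ (termParams b.unpair.2.unpair.2.unpair.1 ++
      tbl.getD b.unpair.2.unpair.2.unpair.2 [])] : List (List ℕ)).getD tbl.length.unpair.1 []

def qfParams (n : ℕ) : List ℕ := courseRec (fun (_ : Unit) tbl => qfParamsStep tbl) () n

theorem primrec_qfParamsStep : Primrec qfParamsStep := by unfold qfParamsStep; fun_prop

@[fun_prop] theorem primrec_qfParams {ι : Type*} [Primcodable ι] {f : ι → ℕ}
    (hf : Primrec f) : Primrec fun i => qfParams (f i) :=
  primrec_courseRec (primrec_qfParamsStep.comp Primrec.snd) (by fun_prop) hf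

theorem mem_qfParams (φ : QF) {i : ℕ} : i ∈ qfParams φ.code ↔ i ∈ φ.params := by
  have key : ∀ n, qfParams n =
      qfParamsStep (table (fun (_ : Unit) tbl => qfParamsStep tbl) () n) := fun n => rfl
  have get : ∀ {m n}, m < n →
      (table (fun (_ : Unit) tbl => qfParamsStep tbl) () n).getD m [] = qfParams m :=
    fun h => table_getD _ _ _ h
  have left : ∀ {a b c : ℕ}, 2 ≤ a → b < Nat.pair a (Nat.pair b c) := fun ha =>
    (Nat.left_le_pair _ _).trans_lt (lt_pair_pos_left ha)
  have right : ∀ {a b c : ℕ}, 2 ≤ a → c < Nat.pair a (Nat.pair b c) := fun ha =>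
    (Nat.right_le_pair _ _).trans_lt (lt_pair_pos_left ha)
  have right' : ∀ {a b c d e : ℕ}, 2 ≤ a →
      e < Nat.pair a (Nat.pair b (Nat.pair c (Nat.pair d e))) := fun ha =>
    ((Nat.right_le_pair _ _).trans (Nat.right_le_pair _ _)).trans_lt (right ha)
  induction φ with
  | prop σ =>
    rw [key]
    simp [qfParamsStep, table_length, QF.code, QF.params]
  | cmp α c β =>
    rw [key]
    simp [qfParamsStep, table_length, QF.code, QF.params, mem_termParams]
  | not φ ih =>
    rw [key, qfParamsStep, table_length, QF.code, Nat.unpair_pair]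
    dsimp only
    rw [get (lt_pair_pos_left le_rfl)]
    simp only [List.getD_cons_succ, List.getD_cons_zero]
    exact ih
  | or φ ψ ih ih' =>
    rw [key, qfParamsStep, table_length, QF.code, Nat.unpair_pair]
    dsimp only
    rw [Nat.unpair_pair]
    dsimp only
    rw [get (left (by omega)), get (right (by omega))]
    simp [QF.params, ih, ih']
  | exNext φ ih =>
    rw [key, qfParamsStep, table_length, QF.code, Nat.unpair_pair]
    dsimp only
    rw [get (lt_pair_pos_left (by omega))]
    simp only [List.getD_cons_succ, List.getD_cons_zero]
    exact ih
  | exUntil φ c α ψ ih ih' =>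
    rw [key, qfParamsStep, table_length, QF.code, Nat.unpair_pair]
    dsimp only
    rw [Nat.unpair_pair]
    dsimp only
    rw [Nat.unpair_pair]
    dsimp only
    rw [Nat.unpair_pair]
    dsimp only
    rw [get (left (by omega)), get (right' (by omega))]
    simp [QF.params, ih, ih', mem_termParams]
  | allUntil φ c α ψ ih ih' =>
    rw [key, qfParamsStep, table_length, QF.code, Nat.unpair_pair]
    dsimp only
    rw [Nat.unpair_pair]
    dsimp only
    rw [Nat.unpair_pair]
    dsimp only
    rw [Nat.unpair_pair]
    dsimp only
    rw [get (left (by omega)), get (right' (by omega))]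
    simp [QF.params, ih, ih', mem_termParams]

def automatonParams (n : ℕ) : List ℕ :=
  let a := (Encodable.decode n : Option (ℕ × List ℕ × List (List ℕ) × List ℕ)).getD (0, [], [], [])
  (a.2.1.flatMap fun n => guardParams
    ((Encodable.decode n : Option (ℕ × ℕ × ℕ × Bool × ℕ)).getD (0, 0, 0, false, 0)).2.2.1) ++
    a.2.2.2.flatMap guardParams

@[fun_prop] theorem primrec_automatonParams {ι : Type*} [Primcodable ι] {f : ι → ℕ}
    (hf : Primrec f) : Primrec fun i => automatonParams (f i) := by
  unfold automatonParams; fun_prop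

theorem Automaton.mem_params (A : Automaton) {i : ℕ} : i ∈ A.params ↔
    (∃ e ∈ A.edges, i ∈ e.guard.params) ∨ ∃ q, i ∈ (A.inv q).params := by
  have h : ∀ l : List (Edge A.numStates), i ∈ l.foldr (fun e s => e.guard.params ∪ s) ∅ ↔
      ∃ e ∈ l, i ∈ e.guard.params := by
    intro l
    induction l with
    | nil => simp
    | cons e l ih => simp [ih]
  simp [params, h]

theorem mem_automatonParams (A : Automaton) {i : ℕ} :
    i ∈ automatonParams A.code ↔ i ∈ A.params := by
  unfold automatonParams Automaton.code
  rw [Encodable.encodek, Automaton.mem_params]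
  simp [List.mem_flatMap, Edge.code, Encodable.encodek, mem_guardParams]

/-! ### Satisfaction depends only on the parameters that occur -/

theorem LinTerm.eval_congr {v w : ℕ → ℕ} {α : LinTerm} (h : ∀ i ∈ α.params, v i = w i) :
    α.eval v = α.eval w := by
  unfold LinTerm.eval
  congr 2
  refine List.map_congr_left fun p hp => ?_
  rw [h p.1 (List.mem_toFinset.2 (List.mem_map_of_mem hp))]

theorem Guard.holds_congr {v w : ℕ → ℕ} {x : ℕ} {g : Guard} (h : ∀ i ∈ g.params, v i = w i) :
    g.Holds v x ↔ g.Holds w x := by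
  induction g with
  | clock c α => simp only [Holds, LinTerm.eval_congr h]
  | param c α β =>
    simp only [Holds, LinTerm.eval_congr fun i hi => h i (Finset.mem_union_left _ hi),
      LinTerm.eval_congr fun i hi => h i (Finset.mem_union_right _ hi)]
  | not g ih => exact not_congr (ih h)
  | and g k ih ih' =>
    exact and_congr (ih fun i hi => h i (Finset.mem_union_left _ hi))
      (ih' fun i hi => h i (Finset.mem_union_right _ hi))
  | or g k ih ih' =>
    exact or_congr (ih fun i hi => h i (Finset.mem_union_left _ hi))
      (ih' fun i hi => h i (Finset.mem_union_right _ hi))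

theorem step_congr {A : Automaton} {v w : ℕ → ℕ} (h : ∀ i ∈ A.params, v i = w i) :
    Step A v = Step A w := by
  have hinv : ∀ q x, (A.inv q).Holds v x ↔ (A.inv q).Holds w x := fun q x =>
    Guard.holds_congr fun i hi => h i (A.mem_params.2 (Or.inr ⟨q, hi⟩))
  have hg : ∀ e ∈ A.edges, ∀ x, e.guard.Holds v x ↔ e.guard.Holds w x := fun e he x =>
    Guard.holds_congr fun i hi => h i (A.mem_params.2 (Or.inl ⟨e, he, hi⟩))
  funext s τ s'
  unfold Step
  rw [hinv, hinv]
  refine propext (and_congr_right' (and_congr_right' (exists_congr fun e =>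
    and_congr_right fun he => ?_)))
  rw [hg e he]

theorem QF.sat_congr {A : Automaton} {v w : ℕ → ℕ} {φ : QF}
    (h : ∀ i ∈ A.params ∪ φ.params, v i = w i) (s : Config A) :
    φ.Sat A v s ↔ φ.Sat A w s := by
  have hA : IsRun A v = IsRun A w := by
    funext s ρ τ
    unfold IsRun
    rw [step_congr fun i hi => h i (Finset.mem_union_left _ hi)]
  induction φ generalizing s with
  | prop σ => simp only [Sat, hA]
  | cmp α c β =>
    simp only [Sat, hA]
    rw [LinTerm.eval_congr fun i hi => h i (by simp [QF.params, hi]),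
      LinTerm.eval_congr fun i hi => h i (by simp [QF.params, hi])]
  | not φ ih => exact not_congr (ih h s)
  | or φ ψ ih ih' =>
    exact or_congr (ih (fun i hi => h i (by simp [QF.params] at hi ⊢; tauto)) s)
      (ih' (fun i hi => h i (by simp [QF.params] at hi ⊢; tauto)) s)
  | exNext φ ih => simp only [Sat, hA, ih h]
  | exUntil φ c α ψ ih ih' =>
    have hα : α.eval v = α.eval w := LinTerm.eval_congr fun i hi => h i (by simp [QF.params, hi])
    simp only [Sat, hA, ih fun i hi => h i (by simp [QF.params] at hi ⊢; tauto),
      ih' fun i hi => h i (by simp [QF.params] at hi ⊢; tauto), hα]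
  | allUntil φ c α ψ ih ih' =>
    have hα : α.eval v = α.eval w := LinTerm.eval_congr fun i hi => h i (by simp [QF.params, hi])
    simp only [Sat, hA, ih fun i hi => h i (by simp [QF.params] at hi ⊢; tauto),
      ih' fun i hi => h i (by simp [QF.params] at hi ⊢; tauto), hα]

/-! ### The characterizing guard -/

/-- The normal form that characterizes a formula in a state, from the codes of the automaton and
of the formula. -/
noncomputable def charDNF (a q n : ℕ) : DNF :=
  ((satSet (parseTA a) n).getD q []).restrict (automatonParams a ++ qfParams n)

@[fun_prop] theorem primrec_charDNF {ι : Type*} [Primcodable ι] {a q n : ι → ℕ} (ha : Primrec a)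
    (hq : Primrec q) (hn : Primrec n) : Primrec fun i => charDNF (a i) (q i) (n i) := by
  unfold charDNF; fun_prop

/-- The guard that characterizes the formula `φ` in the state `q`. -/
noncomputable def charGuard (A : Automaton) (q : Fin A.numStates) (φ : QF) : Guard :=
  (charDNF A.code q φ.code).toGuard

/-- The restricted normal form is evaluated at a valuation that agrees with `v` on all parameters of
`A` and `φ`, and satisfaction depends on no others. -/
theorem holds_charGuard {A : Automaton} {φ : QF} (hφ : φ.IsF) (q : Fin A.numStates) (x : ℕ)
    (v : ℕ → ℕ) : (charGuard A q φ).Holds v x ↔ φ.Sat A v (q, x) := by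
  rw [charGuard, DNF.holds_toGuard, charDNF, DNF.holds_restrict, parseTA_code,
    defines_satSet A φ hφ]
  refine QF.sat_congr (fun i hi => ?_) _
  rw [restrictVal, if_pos]
  rw [List.mem_append, mem_automatonParams, mem_qfParams]
  exact Finset.mem_union.1 hi

theorem charGuard_params (A : Automaton) (q : Fin A.numStates) (φ : QF) :
    (charGuard A q φ).params ⊆ A.params ∪ φ.params := fun i hi => by
  have := DNF.toGuard_params _ _ hi
  rwa [List.mem_append, mem_automatonParams, mem_qfParams, ← Finset.mem_union] at this

open FirstOrder FirstOrder.Language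

/-! ### Truth of the Presburger formulas -/

section Realize

variable {k : ℕ}

theorem LinTerm.realize_pos_sub_neg (env : ℕ → ℕ ⊕ Fin k) (w : ℕ ⊕ Fin k → ℕ) (α : LinTerm) :
    (((α.pos env).realize w : ℕ) : ℤ) - (((α.neg env).realize w : ℕ) : ℤ) =
      α.eval fun i => w (env i) := by
  obtain ⟨l, c⟩ := α
  unfold pos neg eval
  induction l with
  | nil =>
    simp only [List.foldr_nil, presburger.realize_natCast, List.map_nil, List.sum_nil, zero_add,
      Nat.cast_id]
    omega
  | cons p l ih =>
    simp only [List.foldr_cons, presburger.realize_add, presburger.realize_nsmul,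
      Term.realize_var, List.map_cons, List.sum_cons, smul_eq_mul] at ih ⊢
    push_cast at ih ⊢
    rw [add_assoc, ← ih]
    have : p.2 * (w (env p.1) : ℤ) = (p.2.toNat - (-p.2).toNat : ℤ) * (w (env p.1) : ℤ) := by
      congr 1
      omega
    rw [this]
    ring

theorem realize_exAdd (a : ℕ) (s t : presburger.Term (ℕ ⊕ Fin k)) (v : ℕ → ℕ) (xs : Fin k → ℕ) :
    (exAdd a s t).Realize v xs ↔
      ∃ y, s.realize (Sum.elim v xs) + a * y = t.realize (Sum.elim v xs) := by
  have h : ∀ y : ℕ, Sum.elim v (Fin.snoc xs y : Fin (k + 1) → ℕ) ∘ Sum.map id Fin.castSucc =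
      Sum.elim v xs := by
    intro y
    funext i
    rcases i with i | i <;> simp
  simp only [exAdd, BoundedFormula.realize_ex, BoundedFormula.realize_bdEqual,
    presburger.realize_add, Term.realize_relabel, h, presburger.realize_nsmul, Term.realize_var,
    Sum.elim_inr, Fin.snoc_last, smul_eq_mul]

/-- Since `y` is a natural number, one equation expresses both the congruence and the inequality; so
every comparison of guards other than `=` is an instance of `exAdd`. -/
theorem exists_add_mul_iff (a s t : ℕ) :
    (∃ y, s + a * y = t) ↔ (s : ℤ) ≡ t [ZMOD (a : ℤ)] ∧ (s : ℤ) ≤ t := by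
  rw [Int.modEq_iff_dvd]
  constructor
  · rintro ⟨y, rfl⟩
    push_cast
    exact ⟨⟨y, by ring⟩, le_add_of_nonneg_right (by positivity)⟩
  · rintro ⟨h, h'⟩
    obtain ⟨y, hy⟩ : a ∣ t - s := by
      rw [← Int.natCast_dvd_natCast, Nat.cast_sub (by omega)]
      exact h
    exact ⟨y, by omega⟩

theorem GCmp.realize_toFormula (c : GCmp) (s t : presburger.Term (ℕ ⊕ Fin k)) (v : ℕ → ℕ)
    (xs : Fin k → ℕ) : (c.toFormula s t).Realize v xs ↔
      c.Holds (s.realize (Sum.elim v xs) : ℕ) (t.realize (Sum.elim v xs) : ℕ) := by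
  have key : ∀ a b : ℕ, (∃ y, a + 1 * y = b) ↔ (a : ℤ) ≤ b := fun a b => by
    rw [exists_add_mul_iff]
    simp [Int.modEq_one]
  rcases c with (_ | _ | _ | _ | _) | a | a <;>
    simp only [toFormula, realize_exAdd, key, BoundedFormula.realize_bdEqual, Holds, Cmp.Holds,
      presburger.realize_add, presburger.realize_one, Nat.cast_inj, Nat.cast_add, Nat.cast_one,
      gt_iff_lt, ge_iff_le, Int.add_one_le_iff, exists_add_mul_iff]
  rw [Int.modEq_comm]

theorem Guard.realize_toFormula (env : ℕ → ℕ ⊕ Fin k) (x : ℕ) (g : Guard) (v : ℕ → ℕ)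
    (xs : Fin k → ℕ) : (g.toFormula env x).Realize v xs ↔
      g.Holds (fun i => Sum.elim v xs (env i)) x := by
  -- In the Presburger formula the negative parts of terms stand on the opposite side. All
  -- comparison symbols are invariant under adding the same number to both sides.
  have shift : ∀ (c : GCmp) (a b d : ℤ), c.Holds (a + d) (b + d) ↔ c.Holds a b := by
    rintro ((_ | _ | _ | _ | _) | a | a) <;> simp [GCmp.Holds, Cmp.Holds, Int.modEq_iff_dvd]
  induction g with
  | clock c α =>
    have h := α.realize_pos_sub_neg env (Sum.elim v xs)
    simp only [toFormula, GCmp.realize_toFormula, Holds, ← h, presburger.realize_add,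
      presburger.realize_natCast, Nat.cast_id, Nat.cast_add]
    rw [← shift c x _ (((α.neg env).realize (Sum.elim v xs) : ℕ) : ℤ), sub_add_cancel]
  | param c α β =>
    have h := α.realize_pos_sub_neg env (Sum.elim v xs)
    have h' := β.realize_pos_sub_neg env (Sum.elim v xs)
    simp only [toFormula, GCmp.realize_toFormula, Holds, ← h, ← h', presburger.realize_add,
      Nat.cast_add]
    rw [← shift c (_ - _) _ (((α.neg env).realize (Sum.elim v xs) : ℕ) +
      ((β.neg env).realize (Sum.elim v xs) : ℕ) : ℤ)]
    ring_nf
  | not g ih => simp only [toFormula, BoundedFormula.realize_not, ih, Holds]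
  | and g h ih ih' => simp only [toFormula, BoundedFormula.realize_inf, ih, ih', Holds]
  | or g h ih ih' => simp only [toFormula, BoundedFormula.realize_sup, ih, ih', Holds]

theorem realize_quantify {A : Automaton} {s : Config A} {φ : QF} {g : Guard} {x : ℕ}
    (h : ∀ v, g.Holds v x ↔ φ.Sat A v s) (v : ℕ → ℕ) (l : List (Quant × ℕ))
    (env : ℕ → ℕ ⊕ Fin k) (xs : Fin k → ℕ) : (quantify g x env l).Realize v xs ↔
      satQuants A s φ l fun i => Sum.elim v xs (env i) := by
  induction l generalizing k with
  | nil => exact (Guard.realize_toFormula _ _ _ _ _).trans (h _)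
  | cons p l ih =>
    obtain ⟨q, θ⟩ := p
    -- Redirecting `θ` to the newly bound variable corresponds to updating the valuation at `θ`; in
    -- both cases an earlier binding of the same parameter is overridden.
    have key : ∀ c : ℕ, (fun i => Sum.elim v (Fin.snoc xs c : Fin (k + 1) → ℕ) (Function.update
        (fun i => (env i).map id Fin.castSucc) θ (Sum.inr (Fin.last k)) i)) =
        Function.update (fun i => Sum.elim v xs (env i)) θ c := by
      intro c
      funext i
      by_cases hi : i = θ
      · subst hi; simp
      · rw [Function.update_of_ne hi, Function.update_of_ne hi]
        rcases env i with j | j <;> simp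
    cases q
    · simp only [quantify, BoundedFormula.realize_ex, ih, key, satQuants]
    · simp only [quantify, BoundedFormula.realize_all, ih, key, satQuants]

theorem realize_presburgerFormula {A : Automaton} {s : Config A} {f : Formula} {g : Guard} {x : ℕ}
    (h : ∀ v, g.Holds v x ↔ f.body.Sat A v s) (v : ℕ → ℕ) :
    (presburgerFormula f.quants g x).Realize v ↔ f.Sat A v s := by
  unfold presburgerFormula ParamTCTL.Formula.Sat FirstOrder.Language.Formula.Realize
  exact realize_quantify h v f.quants Sum.inl _

end Realize

/-! ### Free variables of the Presburger formulas -/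

section FreeVar

variable {k : ℕ}

theorem varFinsetLeft_add (s t : presburger.Term (ℕ ⊕ Fin k)) :
    (s + t).varFinsetLeft = s.varFinsetLeft ∪ t.varFinsetLeft := by
  have : (s + t).varFinsetLeft =
    Finset.univ.biUnion fun i : Fin 2 => (![s, t] i).varFinsetLeft := rfl
  ext
  simp [this, Fin.exists_fin_two]

theorem varFinsetLeft_one : (1 : presburger.Term (ℕ ⊕ Fin k)).varFinsetLeft = ∅ := rfl

theorem varFinsetLeft_natCast (n : ℕ) :
    ((n : ℕ) : presburger.Term (ℕ ⊕ Fin k)).varFinsetLeft = ∅ := by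
  induction n with
  | zero => rfl
  | succ n ih => rw [presburger.natCast_succ, varFinsetLeft_add, ih, varFinsetLeft_one]; rfl

theorem varFinsetLeft_nsmul (n : ℕ) (t : presburger.Term (ℕ ⊕ Fin k)) :
    (n • t).varFinsetLeft ⊆ t.varFinsetLeft := by
  induction n with
  | zero => exact Finset.empty_subset _
  | succ n ih =>
    rw [presburger.succ_nsmul, varFinsetLeft_add]
    exact Finset.union_subset ih le_rfl

theorem varFinsetLeft_relabel {m : ℕ} (g : Fin k → Fin m) (t : presburger.Term (ℕ ⊕ Fin k)) :
    (t.relabel (Sum.map id g)).varFinsetLeft = t.varFinsetLeft := by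
  induction t with
  | var i => rcases i with i | i <;> rfl
  | func f ts ih => simp only [Term.relabel, Term.varFinsetLeft, ih]

/-- The map `f` on coefficients is arbitrary, to treat the positive and the negative part at once.
-/
theorem LinTerm.varFinsetLeft_foldr (env : ℕ → ℕ ⊕ Fin k) (α : LinTerm) (f : ℤ → ℕ) (c : ℕ)
    {i : ℕ} (h : i ∈ (α.coeffs.foldr (fun p t => f p.2 • Term.var (env p.1) + t)
      (c : presburger.Term (ℕ ⊕ Fin k))).varFinsetLeft) : ∃ j ∈ α.params, env j = Sum.inl i := by
  obtain ⟨l, d⟩ := α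
  suffices ∃ p ∈ l, env p.1 = Sum.inl i by
    obtain ⟨p, hp, he⟩ := this
    exact ⟨p.1, by simpa [params] using ⟨p.2, hp⟩, he⟩
  dsimp only at h
  induction l with
  | nil => simp [varFinsetLeft_natCast] at h
  | cons p l ih =>
    rw [List.foldr_cons, varFinsetLeft_add, Finset.mem_union] at h
    rcases h with h | h
    · have := varFinsetLeft_nsmul _ _ h
      refine ⟨p, by simp, ?_⟩
      rcases he : env p.1 with j | j
      · rw [he] at this
        simp only [Term.varFinsetLeft, Finset.mem_singleton] at this
        rw [this]
      · rw [he] at this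
        simp at this
    · obtain ⟨q, hq, he⟩ := ih h
      exact ⟨q, by simp [hq], he⟩

theorem LinTerm.varFinsetLeft_pos (env : ℕ → ℕ ⊕ Fin k) (α : LinTerm) {i : ℕ}
    (h : i ∈ (α.pos env).varFinsetLeft) : ∃ j ∈ α.params, env j = Sum.inl i :=
  α.varFinsetLeft_foldr env Int.toNat _ h

theorem LinTerm.varFinsetLeft_neg (env : ℕ → ℕ ⊕ Fin k) (α : LinTerm) {i : ℕ}
    (h : i ∈ (α.neg env).varFinsetLeft) : ∃ j ∈ α.params, env j = Sum.inl i :=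
  α.varFinsetLeft_foldr env (fun c => (-c).toNat) _ h

theorem freeVarFinset_not (φ : presburger.BoundedFormula ℕ k) :
    φ.not.freeVarFinset = φ.freeVarFinset := Finset.union_empty _

theorem freeVarFinset_ex (φ : presburger.BoundedFormula ℕ (k + 1)) :
    φ.ex.freeVarFinset = φ.freeVarFinset := by
  unfold BoundedFormula.ex
  rw [freeVarFinset_not, BoundedFormula.freeVarFinset, freeVarFinset_not]

theorem freeVarFinset_inf (φ ψ : presburger.BoundedFormula ℕ k) :
    (φ ⊓ ψ).freeVarFinset = φ.freeVarFinset ∪ ψ.freeVarFinset := by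
  have : φ ⊓ ψ = (φ.imp ψ.not).not := rfl
  rw [this, freeVarFinset_not, BoundedFormula.freeVarFinset, freeVarFinset_not]

theorem freeVarFinset_sup (φ ψ : presburger.BoundedFormula ℕ k) :
    (φ ⊔ ψ).freeVarFinset = φ.freeVarFinset ∪ ψ.freeVarFinset := by
  have : φ ⊔ ψ = φ.not.imp ψ := rfl
  rw [this, BoundedFormula.freeVarFinset, freeVarFinset_not]

theorem freeVarFinset_exAdd (a : ℕ) (s t : presburger.Term (ℕ ⊕ Fin k)) :
    (exAdd a s t).freeVarFinset ⊆ s.varFinsetLeft ∪ t.varFinsetLeft := by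
  rw [exAdd, freeVarFinset_ex]
  refine Finset.union_subset_union ?_ (varFinsetLeft_relabel _ _).le
  rw [varFinsetLeft_add, varFinsetLeft_relabel]
  exact Finset.union_subset le_rfl ((varFinsetLeft_nsmul _ _).trans (Finset.empty_subset _))

theorem GCmp.freeVarFinset_toFormula (c : GCmp) (s t : presburger.Term (ℕ ⊕ Fin k)) :
    (c.toFormula s t).freeVarFinset ⊆ s.varFinsetLeft ∪ t.varFinsetLeft := by
  rcases c with (_ | _ | _ | _ | _) | a | a
  · exact le_rfl
  · refine (freeVarFinset_exAdd _ _ _).trans ?_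
    rw [varFinsetLeft_add, varFinsetLeft_one, Finset.union_empty]
  · exact freeVarFinset_exAdd _ _ _
  · refine (freeVarFinset_exAdd _ _ _).trans ?_
    rw [varFinsetLeft_add, varFinsetLeft_one, Finset.union_empty, Finset.union_comm]
  · exact (freeVarFinset_exAdd _ _ _).trans (Finset.union_comm _ _).le
  · exact freeVarFinset_exAdd _ _ _
  · exact (freeVarFinset_exAdd _ _ _).trans (Finset.union_comm _ _).le

theorem Guard.freeVarFinset_toFormula (env : ℕ → ℕ ⊕ Fin k) (x : ℕ) (g : Guard) {i : ℕ}
    (h : i ∈ (g.toFormula env x).freeVarFinset) : ∃ j ∈ g.params, env j = Sum.inl i := by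
  induction g with
  | clock c α =>
    have := GCmp.freeVarFinset_toFormula _ _ _ h
    rw [varFinsetLeft_add, varFinsetLeft_natCast, Finset.empty_union] at this
    exact (Finset.mem_union.1 this).elim (α.varFinsetLeft_neg env) (α.varFinsetLeft_pos env)
  | param c α β =>
    have := GCmp.freeVarFinset_toFormula _ _ _ h
    rw [varFinsetLeft_add, varFinsetLeft_add] at this
    have key : i ∈ (α.pos env).varFinsetLeft ∨ i ∈ (α.neg env).varFinsetLeft ∨
        i ∈ (β.pos env).varFinsetLeft ∨ i ∈ (β.neg env).varFinsetLeft := by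
      simp only [Finset.mem_union] at this
      tauto
    rcases key with h | h | h | h
    · obtain ⟨j, hj, e⟩ := α.varFinsetLeft_pos env h
      exact ⟨j, Finset.mem_union_left _ hj, e⟩
    · obtain ⟨j, hj, e⟩ := α.varFinsetLeft_neg env h
      exact ⟨j, Finset.mem_union_left _ hj, e⟩
    · obtain ⟨j, hj, e⟩ := β.varFinsetLeft_pos env h
      exact ⟨j, Finset.mem_union_right _ hj, e⟩
    · obtain ⟨j, hj, e⟩ := β.varFinsetLeft_neg env h
      exact ⟨j, Finset.mem_union_right _ hj, e⟩
  | not g ih => exact ih (by rwa [toFormula, freeVarFinset_not] at h)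
  | and g k ih ih' =>
    rw [toFormula, freeVarFinset_inf, Finset.mem_union] at h
    rcases h with h | h
    · obtain ⟨j, hj, e⟩ := ih h
      exact ⟨j, Finset.mem_union_left _ hj, e⟩
    · obtain ⟨j, hj, e⟩ := ih' h
      exact ⟨j, Finset.mem_union_right _ hj, e⟩
  | or g k ih ih' =>
    rw [toFormula, freeVarFinset_sup, Finset.mem_union] at h
    rcases h with h | h
    · obtain ⟨j, hj, e⟩ := ih h
      exact ⟨j, Finset.mem_union_left _ hj, e⟩
    · obtain ⟨j, hj, e⟩ := ih' h
      exact ⟨j, Finset.mem_union_right _ hj, e⟩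

/-- A parameter contributes a free variable only while `env` sends it to `Sum.inl`, and every
quantifier redirects its parameter to a bound variable. -/
theorem freeVarFinset_quantify (g : Guard) (x : ℕ) (l : List (Quant × ℕ)) (env : ℕ → ℕ ⊕ Fin k)
    {i : ℕ} (h : i ∈ (quantify g x env l).freeVarFinset) :
    ∃ j ∈ g.params, j ∉ l.map Prod.snd ∧ env j = Sum.inl i := by
  induction l generalizing k with
  | nil =>
    obtain ⟨j, hj, e⟩ := Guard.freeVarFinset_toFormula _ _ _ h
    exact ⟨j, hj, by simp, e⟩
  | cons p l ih =>
    obtain ⟨q, θ⟩ := p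
    have h' : i ∈ (quantify g x (Function.update (fun i => (env i).map id Fin.castSucc) θ
        (Sum.inr (Fin.last k))) l).freeVarFinset := by
      cases q
      · rwa [quantify, freeVarFinset_ex] at h
      · exact h
    obtain ⟨j, hj, hl, e⟩ := ih _ h'
    by_cases hθ : j = θ
    · subst hθ; simp at e
    · rw [Function.update_of_ne hθ] at e
      refine ⟨j, hj, by simpa [hθ] using hl, ?_⟩
      rcases he : env j with m | m
      · rw [he] at e; simpa using e
      · rw [he] at e; simp at e

theorem freeVarFinset_presburgerFormula {A : Automaton} {f : Formula} {g : Guard} (x : ℕ)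
    (h : g.params ⊆ A.params ∪ f.body.params) :
    (presburgerFormula f.quants g x).freeVarFinset ⊆ f.free A := fun i hi => by
  obtain ⟨j, hj, hl, e⟩ := freeVarFinset_quantify _ _ _ _ hi
  obtain rfl : j = i := Sum.inl.inj e
  exact Finset.mem_sdiff.2 ⟨h hj, by rwa [List.mem_toFinset]⟩

end FreeVar

open FirstOrder FirstOrder.Language

/-! ### Codes of terms and formulas of Presburger arithmetic -/

def addCode (s t : ℕ) : ℕ := Nat.pair 4 (Nat.pair s t)

def numeralCode (n : ℕ) : ℕ :=
  Nat.rec (Nat.pair 2 0) (fun _ a => addCode a (Nat.pair 3 0)) n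

def nsmulCode (n t : ℕ) : ℕ := Nat.rec (Nat.pair 2 0) (fun _ a => addCode a t) n

def notCode (f : ℕ) : ℕ := Nat.pair 2 (Nat.pair f (Nat.pair 0 0))

def infCode (f g : ℕ) : ℕ := notCode (Nat.pair 2 (Nat.pair f (notCode g)))

def supCode (f g : ℕ) : ℕ := Nat.pair 2 (Nat.pair (notCode f) g)

def exCode (f : ℕ) : ℕ := notCode (Nat.pair 3 (notCode f))

def exAddCode (k a s t : ℕ) : ℕ :=
  exCode (Nat.pair 1 (Nat.pair (addCode s (nsmulCode a (Nat.pair 1 k))) t))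

section

variable {ι : Type*} [Primcodable ι] {a f g k s t : ι → ℕ}

@[fun_prop] theorem primrec_addCode (hs : Primrec s) (ht : Primrec t) :
    Primrec fun i => addCode (s i) (t i) := by unfold addCode; fun_prop

@[fun_prop] theorem primrec_numeralCode (hs : Primrec s) :
    Primrec fun i => numeralCode (s i) := by unfold numeralCode; fun_prop

@[fun_prop] theorem primrec_nsmulCode (hs : Primrec s) (ht : Primrec t) :
    Primrec fun i => nsmulCode (s i) (t i) := by unfold nsmulCode; fun_prop

@[fun_prop] theorem primrec_notCode (hf : Primrec f) : Primrec fun i => notCode (f i) := by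
  unfold notCode; fun_prop

@[fun_prop] theorem primrec_infCode (hf : Primrec f) (hg : Primrec g) :
    Primrec fun i => infCode (f i) (g i) := by unfold infCode; fun_prop

@[fun_prop] theorem primrec_supCode (hf : Primrec f) (hg : Primrec g) :
    Primrec fun i => supCode (f i) (g i) := by unfold supCode; fun_prop

@[fun_prop] theorem primrec_exCode (hf : Primrec f) : Primrec fun i => exCode (f i) := by
  unfold exCode; fun_prop

@[fun_prop] theorem primrec_exAddCode (hk : Primrec k) (ha : Primrec a) (hs : Primrec s)
    (ht : Primrec t) : Primrec fun i => exAddCode (k i) (a i) (s i) (t i) := by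
  unfold exAddCode; fun_prop

end

section Codes

variable {k : ℕ} (s t : presburger.Term (ℕ ⊕ Fin k)) (φ ψ : presburger.BoundedFormula ℕ k)

theorem termCode_add : termCode (s + t) = addCode (termCode s) (termCode t) := rfl

theorem termCode_natCast (n : ℕ) :
    termCode (n : presburger.Term (ℕ ⊕ Fin k)) = numeralCode n := by
  induction n with
  | zero => rfl
  | succ n ih => rw [presburger.natCast_succ, termCode_add, ih]; rfl

theorem termCode_nsmul (n : ℕ) : termCode (n • t) = nsmulCode n (termCode t) := by
  induction n with
  | zero => rfl
  | succ n ih => rw [presburger.succ_nsmul, termCode_add, ih]; rfl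

/-- Bound variables are numbered from the outermost quantifier, so a further quantifier inside does
not change their indices. -/
theorem termCode_relabel : termCode (t.relabel (Sum.map id Fin.castSucc)) = termCode t := by
  induction t with
  | var i => rcases i with i | i <;> rfl
  | func f ts ih =>
    cases f with
    | zero => rfl
    | one => rfl
    | add => simp only [Term.relabel, termCode, ih]

theorem formulaCode_not : formulaCode φ.not = notCode (formulaCode φ) := rfl

theorem formulaCode_inf : formulaCode (φ ⊓ ψ) = infCode (formulaCode φ) (formulaCode ψ) := rfl

theorem formulaCode_sup : formulaCode (φ ⊔ ψ) = supCode (formulaCode φ) (formulaCode ψ) := rfl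

theorem formulaCode_ex (φ : presburger.BoundedFormula ℕ (k + 1)) :
    formulaCode φ.ex = exCode (formulaCode φ) := rfl

theorem formulaCode_bdEqual :
    formulaCode (Term.bdEqual s t) = Nat.pair 1 (Nat.pair (termCode s) (termCode t)) := rfl

theorem formulaCode_exAdd (a : ℕ) :
    formulaCode (exAdd a s t) = exAddCode k a (termCode s) (termCode t) := by
  rw [exAdd, formulaCode_ex, formulaCode_bdEqual, termCode_add, termCode_relabel, termCode_nsmul,
    termCode_relabel]
  rfl

end Codes

/-! ### Codes of quantified guards -/

/-- One more than the last position before `m` at which `j` occurs in `L`, or zero. -/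
def lastPos (L : List ℕ) (m j : ℕ) : ℕ :=
  Nat.rec 0 (fun i r => if L.getD i 0 = j then i + 1 else r) m

/-- The code of the variable that stands for the parameter `j`, if the parameters in `L` are bound
in this order. -/
def varCode (L : List ℕ) (j : ℕ) : ℕ :=
  if lastPos L L.length j = 0 then Nat.pair 0 j else Nat.pair 1 (lastPos L L.length j - 1)

def posCode (L : List ℕ) (α : LT) : ℕ :=
  α.1.foldr (fun p t => addCode (nsmulCode p.2.toNat (varCode L p.1)) t) (numeralCode α.2.toNat)

def negCode (L : List ℕ) (α : LT) : ℕ :=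
  α.1.foldr (fun p t => addCode (nsmulCode (-p.2).toNat (varCode L p.1)) t)
    (numeralCode (-α.2).toNat)

/-- The code of `exAdd` for terms in one or the other order. -/
def dirCode (k a : ℕ) (d : Bool) (s t : ℕ) : ℕ := bif d then exAddCode k a s t else exAddCode k a t s

/-- The flags `c` and `d` give the order of the two terms in `exAdd` for a clock atom of positive
sign and for the other atoms: `true` for the symbols of type `≤`, `false` for those of type `≥`. -/
def atomFormulaCode (L : List ℕ) (x : ℕ) (e : ℤ) (α : LT) (a : ℕ) (c d : Bool) : ℕ :=
  if e.sign = 1 then dirCode L.length a c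
    (addCode (numeralCode x) (negCode L (LT.neg α))) (posCode L (LT.neg α)) else
  if e.sign = -1 then dirCode L.length a d
    (addCode (numeralCode x) (negCode L α)) (posCode L α) else
  dirCode L.length a d (addCode (posCode L (LT.const 0)) (negCode L α))
    (addCode (posCode L α) (negCode L (LT.const 0)))

def litFormulaCode (L : List ℕ) (x : ℕ) (l : Lit) : ℕ :=
  let f := if l.2.1 = 0 then atomFormulaCode L x l.2.2.1 l.2.2.2 1 false true else
    supCode (atomFormulaCode L x l.2.2.1 l.2.2.2 l.2.1 true true)
      (atomFormulaCode L x l.2.2.1 l.2.2.2 l.2.1 false false)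
  bif l.1 then f else notCode f

def trueCode (L : List ℕ) : ℕ :=
  Nat.pair 1 (Nat.pair (addCode (posCode L (LT.const 0)) (negCode L (LT.const 0)))
    (addCode (posCode L (LT.const 0)) (negCode L (LT.const 0))))

def dnfFormulaCode (L : List ℕ) (x : ℕ) (D : DNF) : ℕ :=
  D.foldr (fun c f => supCode (c.foldr (fun l f => infCode (litFormulaCode L x l) f) (trueCode L)) f)
    (notCode (trueCode L))

/-- The code of the quantified formula, from the codes of the quantifiers. -/
def quantifyCode (l : List (ℕ × ℕ)) (x : ℕ) (D : DNF) : ℕ :=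
  l.foldr (fun p f => if p.1 = 0 then exCode f else Nat.pair 3 f)
    (dnfFormulaCode (l.map Prod.snd) x D)

section

variable {ι : Type*} [Primcodable ι] {L : ι → List ℕ} {x : ι → ℕ} {α : ι → LT}

@[fun_prop] theorem primrec_varCode (hL : Primrec L) (hx : Primrec x) :
    Primrec fun i => varCode (L i) (x i) := by unfold varCode lastPos; fun_prop

@[fun_prop] theorem primrec_posCode (hL : Primrec L) (hα : Primrec α) :
    Primrec fun i => posCode (L i) (α i) := by unfold posCode; fun_prop

@[fun_prop] theorem primrec_negCode (hL : Primrec L) (hα : Primrec α) :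
    Primrec fun i => negCode (L i) (α i) := by unfold negCode; fun_prop

@[fun_prop] theorem primrec_dirCode {k a s t : ι → ℕ} {d : ι → Bool} (hk : Primrec k)
    (ha : Primrec a) (hd : Primrec d) (hs : Primrec s) (ht : Primrec t) :
    Primrec fun i => dirCode (k i) (a i) (d i) (s i) (t i) := by unfold dirCode; fun_prop

@[fun_prop] theorem primrec_atomFormulaCode {e : ι → ℤ} {a : ι → ℕ} {c d : ι → Bool}
    (hL : Primrec L) (hx : Primrec x) (he : Primrec e) (hα : Primrec α) (ha : Primrec a)
    (hc : Primrec c) (hd : Primrec d) :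
    Primrec fun i => atomFormulaCode (L i) (x i) (e i) (α i) (a i) (c i) (d i) := by
  unfold atomFormulaCode; fun_prop

@[fun_prop] theorem primrec_litFormulaCode {l : ι → Lit} (hL : Primrec L) (hx : Primrec x)
    (hl : Primrec l) : Primrec fun i => litFormulaCode (L i) (x i) (l i) := by
  unfold litFormulaCode; fun_prop

@[fun_prop] theorem primrec_trueCode (hL : Primrec L) : Primrec fun i => trueCode (L i) := by
  unfold trueCode; fun_prop

@[fun_prop] theorem primrec_dnfFormulaCode {D : ι → DNF} (hL : Primrec L) (hx : Primrec x)
    (hD : Primrec D) : Primrec fun i => dnfFormulaCode (L i) (x i) (D i) := by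
  unfold dnfFormulaCode; fun_prop

@[fun_prop] theorem primrec_quantifyCode {l : ι → List (ℕ × ℕ)} {D : ι → DNF} (hl : Primrec l)
    (hx : Primrec x) (hD : Primrec D) : Primrec fun i => quantifyCode (l i) (x i) (D i) := by
  unfold quantifyCode; fun_prop

end

section Codes

variable {L : List ℕ} {env : ℕ → ℕ ⊕ Fin L.length}

theorem termCode_pos (h : ∀ j, termCode (Term.var (env j) : presburger.Term _) = varCode L j)
    (α : LT) : termCode (α.toLin.pos env) = posCode L α := by
  obtain ⟨l, c⟩ := α
  unfold LinTerm.pos posCode LT.toLin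
  induction l with
  | nil => exact termCode_natCast _
  | cons p l ih =>
    simp only [List.foldr_cons] at ih ⊢
    rw [termCode_add, termCode_nsmul, h, ih]

theorem termCode_neg (h : ∀ j, termCode (Term.var (env j) : presburger.Term _) = varCode L j)
    (α : LT) : termCode (α.toLin.neg env) = negCode L α := by
  obtain ⟨l, c⟩ := α
  unfold LinTerm.neg negCode LT.toLin
  induction l with
  | nil => exact termCode_natCast _
  | cons p l ih =>
    simp only [List.foldr_cons] at ih ⊢
    rw [termCode_add, termCode_nsmul, h, ih]

theorem formulaCode_atomGuard
    (h : ∀ j, termCode (Term.var (env j) : presburger.Term _) = varCode L j) (x : ℕ) (e : ℤ)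
    (α : LT) {c d : GCmp} {a : ℕ} {bc bd : Bool}
    (hc : ∀ s t : presburger.Term (ℕ ⊕ Fin L.length),
      formulaCode (c.toFormula s t) = dirCode L.length a bc (termCode s) (termCode t))
    (hd : ∀ s t : presburger.Term (ℕ ⊕ Fin L.length),
      formulaCode (d.toFormula s t) = dirCode L.length a bd (termCode s) (termCode t)) :
    formulaCode ((atomGuard e α c d).toFormula env x) = atomFormulaCode L x e α a bc bd := by
  unfold atomGuard atomFormulaCode
  split_ifs <;>
    simp only [Guard.toFormula, hc, hd, termCode_add, termCode_natCast, termCode_pos h,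
      termCode_neg h]

theorem formulaCode_lit (h : ∀ j, termCode (Term.var (env j) : presburger.Term _) = varCode L j)
    (x : ℕ) (l : Lit) : formulaCode (l.toGuard.toFormula env x) = litFormulaCode L x l := by
  obtain ⟨s, m, e, α⟩ := l
  have key : formulaCode ((if m = 0 then atomGuard e α (.base .ge) (.base .le) else
      .or (atomGuard e α (.congLe m.toPNat') (.congLe m.toPNat'))
      (atomGuard e α (.congGe m.toPNat') (.congGe m.toPNat'))).toFormula env x) =
      if m = 0 then atomFormulaCode L x e α 1 false true else
        supCode (atomFormulaCode L x e α m true true) (atomFormulaCode L x e α m false false) := by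
    by_cases hm : m = 0
    · rw [if_pos hm, if_pos hm]
      have h₁ : ∀ s t : presburger.Term (ℕ ⊕ Fin L.length), formulaCode
          ((GCmp.base .ge).toFormula s t) =
          dirCode L.length 1 false (termCode s) (termCode t) := fun s t => by
        rw [GCmp.toFormula, formulaCode_exAdd, dirCode, cond_false]
      have h₂ : ∀ s t : presburger.Term (ℕ ⊕ Fin L.length), formulaCode
          ((GCmp.base .le).toFormula s t) =
          dirCode L.length 1 true (termCode s) (termCode t) := fun s t => by
        rw [GCmp.toFormula, formulaCode_exAdd, dirCode, cond_true]
      exact formulaCode_atomGuard h x e α h₁ h₂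
    · have hm' : (m.toPNat' : ℕ) = m := by
        rw [Nat.toPNat'_coe, if_pos (Nat.pos_of_ne_zero hm)]
      have h₁ : ∀ s t : presburger.Term (ℕ ⊕ Fin L.length), formulaCode
          ((GCmp.congLe m.toPNat').toFormula s t) =
          dirCode L.length m true (termCode s) (termCode t) := fun s t => by
        rw [GCmp.toFormula, formulaCode_exAdd, hm', dirCode, cond_true]
      have h₂ : ∀ s t : presburger.Term (ℕ ⊕ Fin L.length), formulaCode
          ((GCmp.congGe m.toPNat').toFormula s t) =
          dirCode L.length m false (termCode s) (termCode t) := fun s t => by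
        rw [GCmp.toFormula, formulaCode_exAdd, hm', dirCode, cond_false]
      rw [if_neg hm, if_neg hm, Guard.toFormula, formulaCode_sup,
        formulaCode_atomGuard h x e α h₁ h₁, formulaCode_atomGuard h x e α h₂ h₂]
  cases s
  · simp only [Lit.toGuard, litFormulaCode, cond_false, Guard.toFormula, formulaCode_not, key]
  · simp only [Lit.toGuard, litFormulaCode, cond_true, key]

theorem formulaCode_dnf (h : ∀ j, termCode (Term.var (env j) : presburger.Term _) = varCode L j)
    (x : ℕ) (D : DNF) : formulaCode (D.toGuard.toFormula env x) = dnfFormulaCode L x D := by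
  have htrue : formulaCode (trueGuard.toFormula env x) = trueCode L := by
    unfold trueGuard
    rw [Guard.toFormula, GCmp.toFormula, formulaCode_bdEqual, termCode_add, termCode_pos h,
      termCode_neg h, trueCode]
  have hconj : ∀ c : List Lit, formulaCode
      ((c.foldr (fun l g => Guard.and l.toGuard g) trueGuard).toFormula env x) =
      c.foldr (fun l f => infCode (litFormulaCode L x l) f) (trueCode L) := by
    intro c
    induction c with
    | nil => rw [List.foldr_nil, List.foldr_nil, htrue]
    | cons l c ih =>
      simp only [List.foldr_cons, Guard.toFormula, formulaCode_inf, ih, formulaCode_lit h]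
  unfold DNF.toGuard dnfFormulaCode
  induction D with
  | nil => rw [List.foldr_nil, List.foldr_nil, Guard.toFormula, formulaCode_not, htrue]
  | cons c D ih => simp only [List.foldr_cons, Guard.toFormula, formulaCode_sup, ih, hconj]

end Codes

/-- `L` lists all quantified parameters and the first `k` of them are already bound. The last
occurrence before position `k` counts, as an inner quantifier shadows an outer one with the same
parameter. -/
theorem formulaCode_quantify (L : List ℕ) (x : ℕ) (D : DNF) {k : ℕ} (env : ℕ → ℕ ⊕ Fin k)
    (l : List (Quant × ℕ)) (hl : L.drop k = l.map Prod.snd) (hk : k ≤ L.length)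
    (h : ∀ j, termCode (Term.var (env j) : presburger.Term _) =
      if lastPos L k j = 0 then Nat.pair 0 j else Nat.pair 1 (lastPos L k j - 1)) :
    formulaCode (quantify D.toGuard x env l) =
      (l.map fun p => (p.1.code, p.2)).foldr (fun p f => if p.1 = 0 then exCode f else Nat.pair 3 f)
        (dnfFormulaCode L x D) := by
  induction l generalizing k with
  | nil =>
    obtain rfl : k = L.length := le_antisymm hk (List.drop_eq_nil_iff.1 hl)
    exact formulaCode_dnf h x D
  | cons p l ih =>
    obtain ⟨q, θ⟩ := p
    have hlt : k < L.length := by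
      by_contra hlt
      rw [List.drop_eq_nil_of_le (not_lt.1 hlt)] at hl
      simp at hl
    rw [List.drop_eq_getElem_cons hlt, List.map_cons, List.cons.injEq] at hl
    have hθ : L.getD k 0 = θ := by
      rw [List.getD_eq_getElem _ _ hlt]
      exact hl.1
    have hrec := ih (Function.update (fun i => (env i).map id Fin.castSucc) θ
      (Sum.inr (Fin.last k))) hl.2 hlt (fun j => by
        have hs : lastPos L (k + 1) j = if L.getD k 0 = j then k + 1 else lastPos L k j := rfl
        rw [hs, hθ]
        by_cases hj : j = θ
        · subst hj
          rw [Function.update_self, if_pos rfl, if_neg (Nat.succ_ne_zero k)]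
          rfl
        · rw [Function.update_of_ne hj, if_neg (Ne.symm hj), ← h j]
          rcases env j with i | i <;> rfl)
    cases q
    · rw [quantify, formulaCode_ex, hrec]
      rfl
    · rw [quantify, formulaCode, hrec]
      rfl

theorem formulaCode_presburgerFormula (l : List (Quant × ℕ)) (x : ℕ) (D : DNF) :
    formulaCode (presburgerFormula l D.toGuard x) =
      quantifyCode (l.map fun p => (p.1.code, p.2)) x D := by
  unfold presburgerFormula quantifyCode
  rw [List.map_map]
  exact formulaCode_quantify _ x D Sum.inl l rfl (Nat.zero_le _) fun j => rfl

end ParamTCTL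

/-! ### The characterization theorem -/

theorem corollary3p5 :
    ∃ Δ : (A : ParamTCTL.Automaton) → Fin A.numStates → ParamTCTL.QF → ParamTCTL.Guard,
      -- `Δ_{q,φ}` is effectively constructed from the automaton, the state and the formula
      (∃ F : ℕ × ℕ × ℕ → ℕ, Computable F ∧
        ∀ (A : ParamTCTL.Automaton) (q : Fin A.numStates) (φ : ParamTCTL.QF), φ.IsF →
          F (A.code, (q : ℕ), φ.code) = (Δ A q φ).code) ∧
      -- so is the Presburger formula `Q₁θ₁ ⋯ Q_kθ_k Δ_{q,φ}(x₀, Θ)`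
      (∃ F : ℕ × ℕ × ℕ × ℕ → ℕ, Computable F ∧
        ∀ (A : ParamTCTL.Automaton) (q : Fin A.numStates) (x₀ : ℕ) (f : ParamTCTL.Formula),
          f.body.IsF →
          F (A.code, (q : ℕ), x₀, f.code) =
            ParamTCTL.formulaCode
              (ParamTCTL.presburgerFormula f.quants (Δ A q f.body) x₀)) ∧
      -- it characterizes the valuations of the free parameters that satisfy the formula
      ∀ (A : ParamTCTL.Automaton) (q : Fin A.numStates) (x₀ : ℕ) (f : ParamTCTL.Formula),
        f.body.IsF →
        (ParamTCTL.presburgerFormula f.quants (Δ A q f.body) x₀).freeVarFinset ⊆ f.free A ∧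
        ∀ v : ℕ → ℕ,
          f.Sat A v (q, x₀) ↔
            (ParamTCTL.presburgerFormula f.quants (Δ A q f.body) x₀).Realize v := by
  -- Both functions are total and primitive recursive; numbers that are not codes are decoded to
  -- default values, on which nothing is claimed.
  refine ⟨ParamTCTL.charGuard, ⟨fun i => (ParamTCTL.charDNF i.1 i.2.1 i.2.2).guardCode, ?_, ?_⟩,
    ⟨fun i =>
      let p := (Encodable.decode i.2.2.2 : Option (List (ℕ × ℕ) × ℕ)).getD ([], 0)
      ParamTCTL.quantifyCode p.1 i.2.2.1 (ParamTCTL.charDNF i.1 i.2.1 p.2), ?_, ?_⟩, ?_⟩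
  · exact Primrec.to_comp (by fun_prop)
  · intro A q φ _
    exact (ParamTCTL.DNF.code_toGuard _).symm
  · exact Primrec.to_comp (by fun_prop)
  · intro A q x₀ f _
    rw [ParamTCTL.charGuard, ParamTCTL.formulaCode_presburgerFormula]
    simp only [ParamTCTL.Formula.code, Encodable.encodek, Option.getD_some]
  · intro A q x₀ f hf
    exact ⟨ParamTCTL.freeVarFinset_presburgerFormula x₀ (ParamTCTL.charGuard_params A q f.body),
      fun v => (ParamTCTL.realize_presburgerFormula
        (ParamTCTL.holds_charGuard hf q x₀) v).symm⟩
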